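/- Let $\mathcal G\rightrightarrows M$ be a Lie groupoid with source $s$, target $t$ and unit map $1$, where $\mathcal G$ and $M$ are finite-dimensional smooth manifolds without boundary and $M$ is Hausdorff and $\sigma$-compact. A VB-groupoid $\mathcal V\rightrightarrows E$ over $\mathcal G$ is a Lie groupoid such that $\mathcal V\to\mathcal G$ and $E\to M$ are smooth real vector bundles of finite (constant) rank and all structure maps $\tilde s,\tilde t,\tilde m,\tilde i,\tilde 1$ are vector bundle morphisms over those of $\mathcal G$. Its core is $C=\ker(\tilde s)|_M$, and its core anchor map is $\partial=\tilde t|_C:C\to E$. It is regular if $\partial$ has constant rank, of type zero if $\partial=0$, and of type one if $\partial$ is an isomorphism of vector bundles. A multiplicative section of $\mathcal V$ is a pair of smooth sections $V\in\Gamma(\mathcal V)$, $e\in\Gamma(E)$ such that $V:\mathcal G\to\mathcal V$ is a groupoid morphism covering $e:M\to E$; these form a vector space $\Gamma_{mult}(\mathcal V)$. The complex of multiplicative sections $C^\bullet_{mult}(\mathcal V)$ is the two-term cochain complex of real vector spaces, in degrees $0$ and $1$, \[ \delta:\Gamma(C)\to\Gamma_{mult}(\mathcal V),\qquad \delta(c)=c^r-c^l,\qquad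 c^r(g)=c(t(g))\cdot\tilde 0_g,\quad c^l(g)=-\tilde 0_g\cdot\tilde i(c(s(g))), \] where $c^r-c^l$ covers the section $\partial c$ of $E$. Let $\mathcal V$ be a regular VB-groupoid over $\mathcal G$. Then $\mathcal V$ has a type-zero component: there are VB-groupoids $\mathcal V_0$ of type zero and $\mathcal V_1$ of type one over $\mathcal G$ and an isomorphism of VB-groupoids $\mathcal V\cong\mathcal V_0\oplus\mathcal V_1$ over the identity of $\mathcal G$. Moreover, for every such decomposition, the complex $C^\bullet_{mult}(\mathcal V)$ is quasi-isomorphic to $C^\bullet_{mult}(\mathcal V_0)$. -/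

import Mathlib

open Bundle Set Topology
open scoped Manifold ContDiff Bundle

universe u v

noncomputable section

/-- The structure maps of a groupoid `G ⇉ M`. The multiplication `mul g h` is only meaningful for
composable pairs, i.e. when `src g = tgt h` (arrows are composed like functions); on all other
pairs it carries no information. -/
structure GroupoidMaps (G M : Type*) where
  src : G → M
  tgt : G → M
  one : M → G
  inv : G → G
  mul : G → G → G

/-- `𝒢` is a Lie groupoid: the groupoid axioms hold, the structure maps are smooth, and the source
map is a submersion. The target map `src ∘ inv` is then a submersion too. Since the source and
target are submersions, the set of composable pairs is an embedded submanifold of `G × G`, and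
smoothness of the multiplication on that submanifold is smoothness on that set. -/
structure IsLieGroupoid {EG HG EM HM G M : Type*}
    [NormedAddCommGroup EG] [NormedSpace ℝ EG] [TopologicalSpace HG]
    [NormedAddCommGroup EM] [NormedSpace ℝ EM] [TopologicalSpace HM]
    (IG : ModelWithCorners ℝ EG HG) (IM : ModelWithCorners ℝ EM HM)
    [TopologicalSpace G] [ChartedSpace HG G] [TopologicalSpace M] [ChartedSpace HM M]
    (𝒢 : GroupoidMaps G M) : Prop where
  src_one : ∀ x, 𝒢.src (𝒢.one x) = x
  tgt_one : ∀ x, 𝒢.tgt (𝒢.one x) = x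
  src_mul : ∀ g h, 𝒢.src g = 𝒢.tgt h → 𝒢.src (𝒢.mul g h) = 𝒢.src h
  tgt_mul : ∀ g h, 𝒢.src g = 𝒢.tgt h → 𝒢.tgt (𝒢.mul g h) = 𝒢.tgt g
  mul_assoc : ∀ g h k, 𝒢.src g = 𝒢.tgt h → 𝒢.src h = 𝒢.tgt k →
    𝒢.mul (𝒢.mul g h) k = 𝒢.mul g (𝒢.mul h k)
  one_mul : ∀ g, 𝒢.mul (𝒢.one (𝒢.tgt g)) g = g
  mul_one : ∀ g, 𝒢.mul g (𝒢.one (𝒢.src g)) = g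
  src_inv : ∀ g, 𝒢.src (𝒢.inv g) = 𝒢.tgt g
  tgt_inv : ∀ g, 𝒢.tgt (𝒢.inv g) = 𝒢.src g
  inv_mul : ∀ g, 𝒢.mul (𝒢.inv g) g = 𝒢.one (𝒢.src g)
  mul_inv : ∀ g, 𝒢.mul g (𝒢.inv g) = 𝒢.one (𝒢.tgt g)
  contMDiff_src : ContMDiff IG IM ∞ 𝒢.src
  contMDiff_tgt : ContMDiff IG IM ∞ 𝒢.tgt
  contMDiff_one : ContMDiff IM IG ∞ 𝒢.one
  contMDiff_inv : ContMDiff IG IG ∞ 𝒢.inv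
  contMDiffOn_mul : ContMDiffOn (IG.prod IG) IG ∞ (fun p : G × G => 𝒢.mul p.1 p.2)
    {p : G × G | 𝒢.src p.1 = 𝒢.tgt p.2}
  submersion_src : ∀ g, Function.Surjective (mfderiv IG IM 𝒢.src g)

/-- A Lie groupoid `G ⇉ M`. -/
structure LieGroupoid {EG HG EM HM : Type*}
    [NormedAddCommGroup EG] [NormedSpace ℝ EG] [TopologicalSpace HG]
    [NormedAddCommGroup EM] [NormedSpace ℝ EM] [TopologicalSpace HM]
    (IG : ModelWithCorners ℝ EG HG) (IM : ModelWithCorners ℝ EM HM) (G M : Type*)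
    [TopologicalSpace G] [ChartedSpace HG G] [TopologicalSpace M] [ChartedSpace HM M]
    extends GroupoidMaps G M where
  isLie : IsLieGroupoid IG IM toGroupoidMaps

/-- A smooth real vector bundle of finite rank over the manifold `B`. -/
structure SmoothVectorBundle {EB HB : Type*} [NormedAddCommGroup EB] [NormedSpace ℝ EB]
    [TopologicalSpace HB] (IB : ModelWithCorners ℝ EB HB) (B : Type u) [TopologicalSpace B]
    [ChartedSpace HB B] where
  Model : Type v
  Fiber : B → Type v
  [normedAddCommGroup : NormedAddCommGroup Model]
  [normedSpace : NormedSpace ℝ Model]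
  [finiteDimensional : FiniteDimensional ℝ Model]
  [addCommGroup : ∀ x, AddCommGroup (Fiber x)]
  [module : ∀ x, Module ℝ (Fiber x)]
  [topologicalSpace : ∀ x, TopologicalSpace (Fiber x)]
  [totalTopologicalSpace : TopologicalSpace (TotalSpace Model Fiber)]
  [fiberBundle : FiberBundle Model Fiber]
  [vectorBundle : VectorBundle ℝ Model Fiber]
  [contMDiffVectorBundle : ContMDiffVectorBundle ∞ Model Fiber IB]

attribute [instance] SmoothVectorBundle.normedAddCommGroup SmoothVectorBundle.normedSpace
  SmoothVectorBundle.finiteDimensional SmoothVectorBundle.addCommGroup SmoothVectorBundle.module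
  SmoothVectorBundle.topologicalSpace SmoothVectorBundle.totalTopologicalSpace
  SmoothVectorBundle.fiberBundle SmoothVectorBundle.vectorBundle
  SmoothVectorBundle.contMDiffVectorBundle

namespace SmoothVectorBundle

variable {EB HB : Type*} [NormedAddCommGroup EB] [NormedSpace ℝ EB] [TopologicalSpace HB]
  {IB : ModelWithCorners ℝ EB HB} {B : Type u} [TopologicalSpace B] [ChartedSpace HB B]

/-- The total space of a vector bundle. -/
abbrev Total (A : SmoothVectorBundle.{u, v} IB B) : Type (max u v) := TotalSpace A.Model A.Fiber

/-- The model with corners of the total space. -/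
abbrev model (A : SmoothVectorBundle.{u, v} IB B) :
    ModelWithCorners ℝ (EB × A.Model) (ModelProd HB A.Model) := IB.prod 𝓘(ℝ, A.Model)

/-- The identification of two fibers over equal base points. -/
def fiberCast (A : SmoothVectorBundle.{u, v} IB B) {x y : B} (h : x = y) :
    A.Fiber x ≃ₗ[ℝ] A.Fiber y :=
  h ▸ LinearEquiv.refl ℝ (A.Fiber x)

@[simp] theorem mk_fiberCast (A : SmoothVectorBundle.{u, v} IB B) {x y : B} (h : x = y)
    (a : A.Fiber x) : (⟨y, A.fiberCast h a⟩ : A.Total) = ⟨x, a⟩ := by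
  subst h; rfl

theorem fiberCast_eq_iff (A : SmoothVectorBundle.{u, v} IB B) {x y : B} (h : x = y)
    (a : A.Fiber x) (b : A.Fiber y) :
    A.fiberCast h a = b ↔ (⟨x, a⟩ : A.Total) = ⟨y, b⟩ := by
  subst h
  exact ⟨fun h => by rw [← h]; rfl, fun h => eq_of_heq (TotalSpace.mk.inj h).2⟩

/-- Sums of smooth sections along a map are smooth. -/
theorem contMDiff_add (A : SmoothVectorBundle.{u, v} IB B) {EN HN N : Type*}
    [NormedAddCommGroup EN] [NormedSpace ℝ EN] [TopologicalSpace HN]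
    {IN : ModelWithCorners ℝ EN HN} [TopologicalSpace N] [ChartedSpace HN N]
    {f : N → B} {s t : ∀ x, A.Fiber (f x)}
    (hs : ContMDiff IN A.model ∞ (fun x => (⟨f x, s x⟩ : A.Total)))
    (ht : ContMDiff IN A.model ∞ (fun x => (⟨f x, t x⟩ : A.Total))) :
    ContMDiff IN A.model ∞ (fun x => (⟨f x, s x + t x⟩ : A.Total)) := by
  intro x₀
  have hs' := contMDiffAt_totalSpace.1 (hs x₀)
  have ht' := contMDiffAt_totalSpace.1 (ht x₀)
  refine contMDiffAt_totalSpace.2 ⟨hs'.1, ?_⟩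
  refine (hs'.2.add ht'.2).congr_of_eventuallyEq ?_
  filter_upwards [hs'.1.continuousAt.preimage_mem_nhds
    ((trivializationAt A.Model A.Fiber (f x₀)).open_baseSet.mem_nhds
      (FiberBundle.mem_baseSet_trivializationAt' (f x₀)))] with x hx
  exact ((trivializationAt A.Model A.Fiber (f x₀)).linear ℝ hx).1 _ _

/-- Scalar multiples of smooth sections along a map are smooth. -/
theorem contMDiff_smul (A : SmoothVectorBundle.{u, v} IB B) {EN HN N : Type*}
    [NormedAddCommGroup EN] [NormedSpace ℝ EN] [TopologicalSpace HN]
    {IN : ModelWithCorners ℝ EN HN} [TopologicalSpace N] [ChartedSpace HN N]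
    {f : N → B} {s : ∀ x, A.Fiber (f x)} (a : ℝ)
    (hs : ContMDiff IN A.model ∞ (fun x => (⟨f x, s x⟩ : A.Total))) :
    ContMDiff IN A.model ∞ (fun x => (⟨f x, a • s x⟩ : A.Total)) := by
  intro x₀
  have hs' := contMDiffAt_totalSpace.1 (hs x₀)
  refine contMDiffAt_totalSpace.2 ⟨hs'.1, ?_⟩
  refine ((contMDiffAt_const (I' := 𝓘(ℝ, ℝ)) (c := a)).smul hs'.2).congr_of_eventuallyEq ?_
  filter_upwards [hs'.1.continuousAt.preimage_mem_nhds
    ((trivializationAt A.Model A.Fiber (f x₀)).open_baseSet.mem_nhds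
      (FiberBundle.mem_baseSet_trivializationAt' (f x₀)))] with x hx
  exact ((trivializationAt A.Model A.Fiber (f x₀)).linear ℝ hx).2 _ _

theorem mk_inj (A : SmoothVectorBundle.{u, v} IB B) {x : B} {a b : A.Fiber x}
    (h : (⟨x, a⟩ : A.Total) = ⟨x, b⟩) : a = b :=
  eq_of_heq (TotalSpace.mk.inj h).2

theorem mk_congr (A : SmoothVectorBundle.{u, v} IB B) (s : ∀ x, A.Fiber x) {x y : B}
    (h : x = y) : (⟨x, s x⟩ : A.Total) = ⟨y, s y⟩ := by
  subst h; rfl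

theorem contMDiff_zero (A : SmoothVectorBundle.{u, v} IB B) :
    ContMDiff IB A.model ∞ (fun x => (⟨x, 0⟩ : A.Total)) :=
  Bundle.contMDiff_zeroSection ℝ A.Fiber

/-- The Whitney sum of two vector bundles. -/
@[reducible] def prod [IsManifold IB ∞ B] (A A' : SmoothVectorBundle.{u, v} IB B) :
    SmoothVectorBundle.{u, v} IB B where
  Model := A.Model × A'.Model
  Fiber := fun x => A.Fiber x × A'.Fiber x
  totalTopologicalSpace := FiberBundle.Prod.topologicalSpace A.Model A.Fiber A'.Model A'.Fiber
  fiberBundle := FiberBundle.prod A.Model A.Fiber A'.Model A'.Fiber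
  vectorBundle := VectorBundle.prod ℝ A.Model A.Fiber A'.Model A'.Fiber
  contMDiffVectorBundle := Bundle.Prod.contMDiffVectorBundle A.Model A.Fiber A'.Model A'.Fiber

section Prod

variable [IsManifold IB ∞ B] (A A' : SmoothVectorBundle.{u, v} IB B)

/-- The projection of the Whitney sum to the first summand. -/
def fst (p : (A.prod A').Total) : A.Total := ⟨p.1, p.2.1⟩

/-- The projection of the Whitney sum to the second summand. -/
def snd (p : (A.prod A').Total) : A'.Total := ⟨p.1, p.2.2⟩

variable {A A'}

theorem prod_ext {p q : (A.prod A').Total} (h1 : fst A A' p = fst A A' q)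
    (h2 : snd A A' p = snd A A' q) : p = q := by
  obtain ⟨x, a⟩ := p
  obtain ⟨y, b⟩ := q
  obtain ⟨hx, ha⟩ := TotalSpace.mk.inj h1
  obtain ⟨_, ha'⟩ := TotalSpace.mk.inj h2
  dsimp only at hx
  subst hx
  exact congrArg (TotalSpace.mk x) (Prod.ext (eq_of_heq ha) (eq_of_heq ha'))

theorem contMDiffWithinAt_prod_iff {EN HN N : Type*}
    [NormedAddCommGroup EN] [NormedSpace ℝ EN] [TopologicalSpace HN]
    {IN : ModelWithCorners ℝ EN HN} [TopologicalSpace N] [ChartedSpace HN N]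
    {f : N → (A.prod A').Total} {S : Set N} {x : N} :
    ContMDiffWithinAt IN (A.prod A').model ∞ f S x ↔
      ContMDiffWithinAt IN A.model ∞ (fun x => fst A A' (f x)) S x ∧
      ContMDiffWithinAt IN A'.model ∞ (fun x => snd A A' (f x)) S x := by
  have key : ContMDiffWithinAt IN 𝓘(ℝ, A.Model × A'.Model) ∞
      (fun y => (trivializationAt (A.prod A').Model (A.prod A').Fiber (f x).proj (f y)).2) S x ↔
      ContMDiffWithinAt IN 𝓘(ℝ, A.Model) ∞
        (fun y => (trivializationAt A.Model A.Fiber (f x).proj (fst A A' (f y))).2) S x ∧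
      ContMDiffWithinAt IN 𝓘(ℝ, A'.Model) ∞
        (fun y => (trivializationAt A'.Model A'.Fiber (f x).proj (snd A A' (f y))).2) S x :=
    contMDiffWithinAt_prod_module_iff _
  constructor
  · intro h
    obtain ⟨h1, h2⟩ := Bundle.contMDiffWithinAt_totalSpace.1 h
    obtain ⟨k1, k2⟩ := key.1 h2
    exact ⟨Bundle.contMDiffWithinAt_totalSpace.2 ⟨h1, k1⟩,
      Bundle.contMDiffWithinAt_totalSpace.2 ⟨h1, k2⟩⟩
  · rintro ⟨h, h'⟩
    obtain ⟨h1, h2⟩ := Bundle.contMDiffWithinAt_totalSpace.1 h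
    obtain ⟨_, h2'⟩ := Bundle.contMDiffWithinAt_totalSpace.1 h'
    exact Bundle.contMDiffWithinAt_totalSpace.2 ⟨h1, key.2 ⟨h2, h2'⟩⟩

theorem contMDiff_prod_iff {EN HN N : Type*}
    [NormedAddCommGroup EN] [NormedSpace ℝ EN] [TopologicalSpace HN]
    {IN : ModelWithCorners ℝ EN HN} [TopologicalSpace N] [ChartedSpace HN N]
    {f : N → (A.prod A').Total} :
    ContMDiff IN (A.prod A').model ∞ f ↔
      ContMDiff IN A.model ∞ (fun x => fst A A' (f x)) ∧
      ContMDiff IN A'.model ∞ (fun x => snd A A' (f x)) :=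
  ⟨fun h => ⟨fun x => (contMDiffWithinAt_prod_iff.1 (h x)).1,
    fun x => (contMDiffWithinAt_prod_iff.1 (h x)).2⟩,
    fun h x => contMDiffWithinAt_prod_iff.2 ⟨h.1 x, h.2 x⟩⟩

theorem contMDiff_fst : ContMDiff (A.prod A').model A.model ∞ (fst A A') :=
  (contMDiff_prod_iff.1 contMDiff_id).1

theorem contMDiff_snd : ContMDiff (A.prod A').model A'.model ∞ (snd A A') :=
  (contMDiff_prod_iff.1 contMDiff_id).2

end Prod

section Submersion

variable {EN HN N : Type*} [NormedAddCommGroup EN] [NormedSpace ℝ EN] [TopologicalSpace HN]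
  {IN : ModelWithCorners ℝ EN HN} [TopologicalSpace N] [ChartedSpace HN N]
  (A : SmoothVectorBundle.{u, v} IB B) (D : SmoothVectorBundle IN N)
  {φ : B → N} (Φ : ∀ x, A.Fiber x →ₗ[ℝ] D.Fiber (φ x))

/-- The differential of a vector bundle map in local trivializations: it is onto if the map is a
submersion on the base and onto on the fiber; on the zero section, the latter is also necessary. -/
theorem mfderiv_bundleMap (hφ : ContMDiff IB IN ∞ φ)
    (hΦ : ContMDiff A.model D.model ∞ (fun p : A.Total => (⟨φ p.1, Φ p.1 p.2⟩ : D.Total)))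
    (p : A.Total) :
    (Function.Surjective (mfderiv IB IN φ p.1) → Function.Surjective (Φ p.1) →
      Function.Surjective (mfderiv A.model D.model
        (fun p : A.Total => (⟨φ p.1, Φ p.1 p.2⟩ : D.Total)) p)) ∧
    (p.2 = 0 → Function.Surjective (mfderiv A.model D.model
        (fun p : A.Total => (⟨φ p.1, Φ p.1 p.2⟩ : D.Total)) p) →
      Function.Surjective (Φ p.1)) := by
  obtain ⟨g, w⟩ := p
  set T : A.Total → D.Total := fun p => ⟨φ p.1, Φ p.1 p.2⟩ with hT
  set e := trivializationAt A.Model A.Fiber g with he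
  set e' := trivializationAt D.Model D.Fiber (φ g) with he'
  have hg : g ∈ e.baseSet := FiberBundle.mem_baseSet_trivializationAt' g
  have hg' : φ g ∈ e'.baseSet := FiberBundle.mem_baseSet_trivializationAt' (φ g)
  have : ContMDiffVectorBundle 1 A.Model A.Fiber IB :=
    ContMDiffVectorBundle.of_le (n := ∞) (by exact_mod_cast le_top)
  have : ContMDiffVectorBundle 1 D.Model D.Fiber IN :=
    ContMDiffVectorBundle.of_le (n := ∞) (by exact_mod_cast le_top)
  have de := e.mdifferentiable A.Fiber (I := IB)
  have de' := e'.mdifferentiable D.Fiber (I := IN)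
  set u : A.Model := (e ⟨g, w⟩).2 with hu
  have hsymm : e.toOpenPartialHomeomorph.symm (g, u) = ⟨g, w⟩ :=
    e.symm_apply_mk_proj (x := (⟨g, w⟩ : A.Total)) (e.mem_source.2 hg)
  have htar : (g, u) ∈ e.toOpenPartialHomeomorph.target := e.mem_target.2 hg
  have hsrc' : T ⟨g, w⟩ ∈ e'.toOpenPartialHomeomorph.source := e'.mem_source.2 hg'
  have hTd : MDifferentiableAt A.model D.model T ⟨g, w⟩ :=
    (hΦ _).mdifferentiableAt (by simp)
  set Ψ : B × A.Model → N × D.Model := fun q => e' (T (e.toOpenPartialHomeomorph.symm q)) with hΨ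
  have dsymm : MDifferentiableAt (IB.prod 𝓘(ℝ, A.Model)) A.model
      e.toOpenPartialHomeomorph.symm (g, u) := de.mdifferentiableAt_symm htar
  have dT1 : MDifferentiableAt (IB.prod 𝓘(ℝ, A.Model)) D.model
      (fun q => T (e.toOpenPartialHomeomorph.symm q)) (g, u) :=
    MDifferentiableAt.comp (I' := A.model) (g, u) (by rw [hsymm]; exact hTd) dsymm
  have de1 : MDifferentiableAt D.model (IN.prod 𝓘(ℝ, D.Model)) e'
      (T (e.toOpenPartialHomeomorph.symm (g, u))) := by
    rw [hsymm]; exact de'.mdifferentiableAt hsrc'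
  have dΨ : MDifferentiableAt (IB.prod 𝓘(ℝ, A.Model)) (IN.prod 𝓘(ℝ, D.Model)) Ψ (g, u) :=
    MDifferentiableAt.comp (I' := D.model) (g, u) de1 dT1
  have chain : ∀ z, mfderiv (IB.prod 𝓘(ℝ, A.Model)) (IN.prod 𝓘(ℝ, D.Model)) Ψ (g, u) z =
      mfderiv D.model (IN.prod 𝓘(ℝ, D.Model)) e' (T (e.toOpenPartialHomeomorph.symm (g, u)))
        (mfderiv A.model D.model T (e.toOpenPartialHomeomorph.symm (g, u))
          (mfderiv (IB.prod 𝓘(ℝ, A.Model)) A.model e.toOpenPartialHomeomorph.symm (g, u) z)) := by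
    intro z
    have h1 := mfderiv_comp (I' := D.model) (g, u) de1 dT1
    have h2 := mfderiv_comp (I' := A.model) (g, u) (g := T) (by rw [hsymm]; exact hTd) dsymm
    have h3 : mfderiv (IB.prod 𝓘(ℝ, A.Model)) (IN.prod 𝓘(ℝ, D.Model)) Ψ (g, u) = _ := h1
    rw [h3]
    have h4 : mfderiv (IB.prod 𝓘(ℝ, A.Model)) D.model
      (fun q => T (e.toOpenPartialHomeomorph.symm q)) (g, u) = _ := h2
    rw [h4]
    rfl
  have bsymm : Function.Bijective
      (mfderiv (IB.prod 𝓘(ℝ, A.Model)) A.model e.toOpenPartialHomeomorph.symm (g, u)) :=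
    de.symm.mfderiv_bijective htar
  have be' : Function.Bijective (mfderiv D.model (IN.prod 𝓘(ℝ, D.Model)) e'
      (T (e.toOpenPartialHomeomorph.symm (g, u)))) := by
    rw [hsymm]; exact de'.mfderiv_bijective hsrc'
  have hsurj : Function.Surjective (mfderiv A.model D.model T ⟨g, w⟩) ↔ Function.Surjective
      (mfderiv (IB.prod 𝓘(ℝ, A.Model)) (IN.prod 𝓘(ℝ, D.Model)) Ψ (g, u)) := by
    rw [← hsymm]
    constructor
    · intro h y
      obtain ⟨y1, rfl⟩ := be'.2 y
      obtain ⟨y2, rfl⟩ := h y1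
      obtain ⟨y3, rfl⟩ := bsymm.2 y2
      exact ⟨y3, chain y3⟩
    · intro h y
      obtain ⟨z, hz⟩ := h (mfderiv D.model (IN.prod 𝓘(ℝ, D.Model)) e'
        (T (e.toOpenPartialHomeomorph.symm (g, u))) y)
      rw [chain] at hz
      exact ⟨_, be'.1 hz⟩
  -- the restriction of `Ψ` to the fiber is linear
  let L : A.Model →ₗ[ℝ] D.Model := (e'.linearEquivAt ℝ (φ g) hg').toLinearMap ∘ₗ Φ g ∘ₗ
    (e.linearEquivAt ℝ g hg).symm.toLinearMap
  have hL : Function.Surjective L ↔ Function.Surjective (Φ g) := by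
    simp [L]
  have hΨ2 : (fun z => Ψ (g, z)) = fun z => (φ g, L.toContinuousLinearMap z) := by
    funext z
    have h1 : e.toOpenPartialHomeomorph.symm (g, z) = ⟨g, (e.linearEquivAt ℝ g hg).symm z⟩ :=
      (e.mk_symm hg z).symm
    change e' (T (e.toOpenPartialHomeomorph.symm (g, z))) = _
    rw [h1]
    exact Prod.ext (e'.coe_fst' hg') rfl
  have p2 : ∀ z, mfderiv 𝓘(ℝ, A.Model) (IN.prod 𝓘(ℝ, D.Model)) (fun z => Ψ (g, z)) u z =
      ((0, L z) : EN × D.Model) := by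
    intro z
    rw [hΨ2, mfderiv_prodMk mdifferentiableAt_const
      L.toContinuousLinearMap.mdifferentiableAt, mfderiv_const,
      ContinuousLinearMap.mfderiv_eq]
    rfl
  -- the base component of `Ψ`
  have dΨ1 : MDifferentiableAt IB (IN.prod 𝓘(ℝ, D.Model)) (fun z => Ψ (z, u)) g :=
    MDifferentiableAt.comp (I' := IB.prod 𝓘(ℝ, A.Model)) g (g := Ψ) (f := fun z => (z, u)) dΨ
      (mdifferentiableAt_id.prodMk mdifferentiableAt_const)
  have near : ∀ᶠ z in 𝓝 g, z ∈ e.baseSet ∧ φ z ∈ e'.baseSet :=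
    Filter.Eventually.and (e.open_baseSet.mem_nhds hg)
      (hφ.continuous.continuousAt.preimage_mem_nhds (e'.open_baseSet.mem_nhds hg'))
  have p1 : ∀ y, (show EN × D.Model from
      mfderiv IB (IN.prod 𝓘(ℝ, D.Model)) (fun z => Ψ (z, u)) g y).1 = mfderiv IB IN φ g y := by
    intro y
    have h1 : mfderiv IB IN (fun z => (Ψ (z, u)).1) g = mfderiv IB IN φ g := by
      apply Filter.EventuallyEq.mfderiv_eq
      filter_upwards [near] with z hz
      have h2 : (e.toOpenPartialHomeomorph.symm (z, u)).proj = z := e.proj_symm_apply' hz.1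
      have h3 : (T (e.toOpenPartialHomeomorph.symm (z, u))).proj ∈ e'.baseSet := by
        simp only [hT, h2, hz.2]
      change (e' (T (e.toOpenPartialHomeomorph.symm (z, u)))).1 = φ z
      rw [e'.coe_fst' h3]
      simp only [hT, h2]
    have h4 := mfderiv_comp (I' := IN.prod 𝓘(ℝ, D.Model)) g (g := Prod.fst)
      (f := fun z => Ψ (z, u)) mdifferentiableAt_fst dΨ1
    have h5 : mfderiv IB IN (fun z => (Ψ (z, u)).1) g = _ := h4
    rw [← h1, h5, mfderiv_fst]
    rfl
  have p0 : w = 0 → ∀ y, (show EN × D.Model from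
      mfderiv IB (IN.prod 𝓘(ℝ, D.Model)) (fun z => Ψ (z, u)) g y).2 = 0 := by
    intro hw y
    have hu0 : u = 0 := by
      rw [hu, hw]
      exact (e.linearEquivAt ℝ g hg).map_zero
    have h1 : mfderiv IB 𝓘(ℝ, D.Model) (fun z => (Ψ (z, u)).2) g =
        mfderiv IB 𝓘(ℝ, D.Model) (fun _ => (0 : D.Model)) g := by
      apply Filter.EventuallyEq.mfderiv_eq
      filter_upwards [near] with z hz
      have h2 : e.toOpenPartialHomeomorph.symm (z, u) = ⟨z, 0⟩ := by
        rw [hu0]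
        exact (e.mk_symm hz.1 0).symm.trans
          (congrArg (TotalSpace.mk z) (e.linearEquivAt ℝ z hz.1).symm.map_zero)
      change (e' (T (e.toOpenPartialHomeomorph.symm (z, u)))).2 = 0
      rw [h2]
      simp only [hT, map_zero]
      exact (e'.linearEquivAt ℝ (φ z) hz.2).map_zero
    have h4 := mfderiv_comp (I' := IN.prod 𝓘(ℝ, D.Model)) g (g := Prod.snd)
      (f := fun z => Ψ (z, u)) mdifferentiableAt_snd dΨ1
    have h5 : mfderiv IB 𝓘(ℝ, D.Model) (fun z => (Ψ (z, u)).2) g = _ := h4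
    have h6 := congrArg (fun k => k y) (h5.symm.trans h1)
    rw [mfderiv_snd, mfderiv_const] at h6
    exact h6
  have split : ∀ (y : EB) (z : A.Model), mfderiv (IB.prod 𝓘(ℝ, A.Model)) (IN.prod 𝓘(ℝ, D.Model))
      Ψ (g, u) (y, z) = mfderiv IB (IN.prod 𝓘(ℝ, D.Model)) (fun z => Ψ (z, u)) g y +
        mfderiv 𝓘(ℝ, A.Model) (IN.prod 𝓘(ℝ, D.Model)) (fun z => Ψ (g, z)) u z :=
    fun y z => mfderiv_prod_eq_add_apply (v := (y, z)) dΨ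
  let D1 : EB → EN × D.Model := fun y =>
    mfderiv IB (IN.prod 𝓘(ℝ, D.Model)) (fun z => Ψ (z, u)) g y
  let D0 : EB → EN := fun y => mfderiv IB IN φ g y
  let DΨ : EB × A.Model → EN × D.Model := fun y =>
    mfderiv (IB.prod 𝓘(ℝ, A.Model)) (IN.prod 𝓘(ℝ, D.Model)) Ψ (g, u) y
  have final : ∀ y z, DΨ (y, z) = (D0 y, (D1 y).2 + L z) := by
    intro y z
    have h1 : DΨ (y, z) = D1 y + ((0, L z) : EN × D.Model) :=
      (split y z).trans (congrArg (fun t => (D1 y + t : EN × D.Model)) (p2 z))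
    have h2 : (D1 y).1 = D0 y := p1 y
    rw [h1, ← h2]
    exact Prod.ext (add_zero _) rfl
  rw [hsurj, ← hL]
  constructor
  · intro (h1 : Function.Surjective D0) h2
    change Function.Surjective DΨ
    rintro ⟨a, b⟩
    obtain ⟨y, hy⟩ := h1 a
    obtain ⟨z, hz⟩ := h2 (b - (D1 y).2)
    refine ⟨(y, z), ?_⟩
    rw [final, hy, hz, add_sub_cancel]
  · intro hw (h : Function.Surjective DΨ) b
    obtain ⟨⟨y, z⟩, hyz⟩ := h (0, b)
    refine ⟨z, ?_⟩
    rw [final] at hyz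
    have h1 : (D1 y).2 + L z = b := congrArg Prod.snd hyz
    have h2 : (D1 y).2 = 0 := p0 hw y
    rwa [h2, zero_add] at h1

end Submersion

end SmoothVectorBundle

section VBGroupoids

variable {EG HG EM HM : Type*}
  [NormedAddCommGroup EG] [NormedSpace ℝ EG] [TopologicalSpace HG]
  [NormedAddCommGroup EM] [NormedSpace ℝ EM] [TopologicalSpace HM]
  {IG : ModelWithCorners ℝ EG HG} {IM : ModelWithCorners ℝ EM HM}
  {G M : Type u} [TopologicalSpace G] [ChartedSpace HG G] [TopologicalSpace M] [ChartedSpace HM M]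

/-- The structure maps of a VB-groupoid `V ⇉ E` over `𝒢 : G ⇉ M`, covering those of `𝒢`: the
fiberwise linear source, target, unit and inversion, and the multiplication. Again `mul g h v w` is
only meaningful for composable elements. -/
structure VBGroupoidMaps (𝒢 : LieGroupoid IG IM G M) where
  /-- the vector bundle `V → G` -/
  top : SmoothVectorBundle.{u, v} IG G
  /-- the side bundle `E → M` -/
  side : SmoothVectorBundle.{u, v} IM M
  src : ∀ g, top.Fiber g →ₗ[ℝ] side.Fiber (𝒢.src g)
  tgt : ∀ g, top.Fiber g →ₗ[ℝ] side.Fiber (𝒢.tgt g)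
  one : ∀ x, side.Fiber x →ₗ[ℝ] top.Fiber (𝒢.one x)
  inv : ∀ g, top.Fiber g →ₗ[ℝ] top.Fiber (𝒢.inv g)
  mul : ∀ g h, top.Fiber g → top.Fiber h → top.Fiber (𝒢.mul g h)

/-- The structure maps between the total spaces of `V` and `E`. -/
def VBGroupoidMaps.total {𝒢 : LieGroupoid IG IM G M} (V : VBGroupoidMaps.{u, v} 𝒢) :
    GroupoidMaps V.top.Total V.side.Total where
  src p := ⟨𝒢.src p.1, V.src p.1 p.2⟩
  tgt p := ⟨𝒢.tgt p.1, V.tgt p.1 p.2⟩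
  one p := ⟨𝒢.one p.1, V.one p.1 p.2⟩
  inv p := ⟨𝒢.inv p.1, V.inv p.1 p.2⟩
  mul p q := ⟨𝒢.mul p.1 q.1, V.mul p.1 q.1 p.2 q.2⟩

/-- A VB-groupoid `V ⇉ E` over the Lie groupoid `𝒢 : G ⇉ M`: a Lie groupoid `V ⇉ E`, where `V → G`
and `E → M` are vector bundles and all structure maps are vector bundle morphisms over those of
`𝒢`. The last two fields say that the multiplication is linear on the fiber
`{(v, w) ∈ V_g × V_h | s(v) = t(w)}` over the composable pair `(g, h)`. -/
structure VBGroupoid (𝒢 : LieGroupoid IG IM G M) extends VBGroupoidMaps.{u, v} 𝒢 where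
  isLie : IsLieGroupoid top.model side.model toVBGroupoidMaps.total
  mul_add : ∀ (g h : G) (v v' : top.Fiber g) (w w' : top.Fiber h),
    toVBGroupoidMaps.total.src ⟨g, v⟩ = toVBGroupoidMaps.total.tgt ⟨h, w⟩ →
    toVBGroupoidMaps.total.src ⟨g, v'⟩ = toVBGroupoidMaps.total.tgt ⟨h, w'⟩ →
    mul g h (v + v') (w + w') = mul g h v w + mul g h v' w'
  mul_smul : ∀ (g h : G) (a : ℝ) (v : top.Fiber g) (w : top.Fiber h),
    toVBGroupoidMaps.total.src ⟨g, v⟩ = toVBGroupoidMaps.total.tgt ⟨h, w⟩ →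
    mul g h (a • v) (a • w) = a • mul g h v w

namespace VBGroupoid

variable {𝒢 : LieGroupoid IG IM G M}

/-- An isomorphism of VB-groupoids over the identity of `𝒢`: a pair of vector bundle isomorphisms
which form an isomorphism of groupoids. -/
structure Iso (V W : VBGroupoid.{u, v} 𝒢) where
  top : ∀ g, V.top.Fiber g ≃ₗ[ℝ] W.top.Fiber g
  side : ∀ x, V.side.Fiber x ≃ₗ[ℝ] W.side.Fiber x
  contMDiff_top : ContMDiff V.top.model W.top.model ∞
    (fun p : V.top.Total => (⟨p.1, top p.1 p.2⟩ : W.top.Total))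
  contMDiff_top_symm : ContMDiff W.top.model V.top.model ∞
    (fun p : W.top.Total => (⟨p.1, (top p.1).symm p.2⟩ : V.top.Total))
  contMDiff_side : ContMDiff V.side.model W.side.model ∞
    (fun p : V.side.Total => (⟨p.1, side p.1 p.2⟩ : W.side.Total))
  contMDiff_side_symm : ContMDiff W.side.model V.side.model ∞
    (fun p : W.side.Total => (⟨p.1, (side p.1).symm p.2⟩ : V.side.Total))
  map_src : ∀ g v, side _ (V.src g v) = W.src g (top g v)
  map_tgt : ∀ g v, side _ (V.tgt g v) = W.tgt g (top g v)
  map_one : ∀ x e, top _ (V.one x e) = W.one x (side x e)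
  map_mul : ∀ g h v w, V.total.src ⟨g, v⟩ = V.total.tgt ⟨h, w⟩ →
    top _ (V.mul g h v w) = W.mul g h (top g v) (top h w)

/-! ### The core -/

/-- The fiber at `x` of the core `C = ker(s)|_M` of a VB-groupoid. -/
def coreFiber (V : VBGroupoid.{u, v} 𝒢) (x : M) : Submodule ℝ (V.top.Fiber (𝒢.one x)) :=
  LinearMap.ker (V.src (𝒢.one x))

/-- The core anchor map `∂ : C → E`, the restriction of the target map. -/
def coreAnchor (V : VBGroupoid.{u, v} 𝒢) (x : M) : V.coreFiber x →ₗ[ℝ] V.side.Fiber x :=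
  ((V.side.fiberCast (𝒢.isLie.tgt_one x)).toLinearMap ∘ₗ V.tgt (𝒢.one x)).domRestrict
    (V.coreFiber x)

/-- A VB-groupoid is regular if its core anchor map has constant rank. -/
def IsRegular (V : VBGroupoid.{u, v} 𝒢) : Prop :=
  ∃ r : ℕ, ∀ x, Module.finrank ℝ (LinearMap.range (V.coreAnchor x)) = r

/-- A VB-groupoid is (regular) of type zero if its core anchor map vanishes. -/
def IsTypeZero (V : VBGroupoid.{u, v} 𝒢) : Prop :=
  ∀ x, V.coreAnchor x = 0

/-- A VB-groupoid is (regular) of type one if its core anchor map is an isomorphism of vector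
bundles, i.e. is an isomorphism on every fiber. -/
def IsTypeOne (V : VBGroupoid.{u, v} 𝒢) : Prop :=
  ∀ x, Function.Bijective (V.coreAnchor x)

/-! ### The complex of multiplicative sections -/

/-- Smooth sections of the core `C`: smooth sections of `V` along the unit map `M → G` with values
in the fibers of `C`. -/
def coreSections (V : VBGroupoid.{u, v} 𝒢) :
    Submodule ℝ (∀ x, V.top.Fiber (𝒢.one x)) where
  carrier := {c | ContMDiff IM V.top.model ∞ (fun x => (⟨𝒢.one x, c x⟩ : V.top.Total)) ∧
    ∀ x, c x ∈ V.coreFiber x}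
  add_mem' hc hd := ⟨V.top.contMDiff_add hc.1 hd.1, fun x => add_mem (hc.2 x) (hd.2 x)⟩
  zero_mem' := ⟨V.top.contMDiff_zero.comp 𝒢.isLie.contMDiff_one, fun _ => zero_mem _⟩
  smul_mem' a _ hc := ⟨V.top.contMDiff_smul a hc.1, fun x => Submodule.smul_mem _ a (hc.2 x)⟩

theorem mul_zero_zero (V : VBGroupoid.{u, v} 𝒢) (g h : G) (hgh : 𝒢.src g = 𝒢.tgt h) :
    V.mul g h 0 0 = 0 := by
  have h0 : V.total.src ⟨g, 0⟩ = V.total.tgt ⟨h, 0⟩ := by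
    simpa only [VBGroupoidMaps.total, map_zero] using V.side.mk_congr (fun _ => 0) hgh
  simpa using V.mul_smul g h 0 0 0 h0

/-- The space of multiplicative sections of `V`: pairs of a smooth section of `V` and a smooth
section of `E` which form a groupoid morphism from `𝒢` to `V ⇉ E`. -/
def multSections (V : VBGroupoid.{u, v} 𝒢) :
    Submodule ℝ (Cₛ^∞⟮IG; V.top.Model, V.top.Fiber⟯ × Cₛ^∞⟮IM; V.side.Model, V.side.Fiber⟯) where
  carrier := {p | (∀ g, V.src g (p.1 g) = p.2 (𝒢.src g)) ∧
    (∀ g, V.tgt g (p.1 g) = p.2 (𝒢.tgt g)) ∧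
    (∀ x, V.one x (p.2 x) = p.1 (𝒢.one x)) ∧
    ∀ g h, 𝒢.src g = 𝒢.tgt h → p.1 (𝒢.mul g h) = V.mul g h (p.1 g) (p.1 h)}
  add_mem' := by
    rintro p q ⟨hp1, hp2, hp3, hp4⟩ ⟨hq1, hq2, hq3, hq4⟩
    refine ⟨fun g => ?_, fun g => ?_, fun x => ?_, fun g h hgh => ?_⟩
    · simp [hp1, hq1]
    · simp [hp2, hq2]
    · simp [hp3, hq3]
    · have h1 : V.total.src ⟨g, p.1 g⟩ = V.total.tgt ⟨h, p.1 h⟩ := by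
        simpa only [VBGroupoidMaps.total, hp1, hp2] using V.side.mk_congr p.2 hgh
      have h2 : V.total.src ⟨g, q.1 g⟩ = V.total.tgt ⟨h, q.1 h⟩ := by
        simpa only [VBGroupoidMaps.total, hq1, hq2] using V.side.mk_congr q.2 hgh
      simp [hp4 g h hgh, hq4 g h hgh, V.mul_add g h _ _ _ _ h1 h2]
  zero_mem' := by
    refine ⟨fun g => ?_, fun g => ?_, fun x => ?_, fun g h hgh => ?_⟩ <;>
      simp [V.mul_zero_zero, *]
  smul_mem' := by
    rintro a p ⟨hp1, hp2, hp3, hp4⟩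
    refine ⟨fun g => ?_, fun g => ?_, fun x => ?_, fun g h hgh => ?_⟩
    · simp [hp1]
    · simp [hp2]
    · simp [hp3]
    · have h1 : V.total.src ⟨g, p.1 g⟩ = V.total.tgt ⟨h, p.1 h⟩ := by
        simpa only [VBGroupoidMaps.total, hp1, hp2] using V.side.mk_congr p.2 hgh
      simp [hp4 g h hgh, V.mul_smul g h a _ _ h1]

theorem mul_inv_one_src (𝒢 : LieGroupoid IG IM G M) (g : G) :
    𝒢.mul g (𝒢.inv (𝒢.one (𝒢.src g))) = g := by
  have h : 𝒢.inv (𝒢.one (𝒢.src g)) = 𝒢.one (𝒢.src g) := by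
    have h1 := 𝒢.isLie.mul_one (𝒢.inv (𝒢.one (𝒢.src g)))
    rw [𝒢.isLie.src_inv, 𝒢.isLie.tgt_one] at h1
    have h2 := 𝒢.isLie.inv_mul (𝒢.one (𝒢.src g))
    rw [𝒢.isLie.src_one] at h2
    exact h1.symm.trans h2
  rw [h, 𝒢.isLie.mul_one]

/-- The right invariant section `c^r(g) = c(t(g)) · 0_g`. -/
def rightInvariant (V : VBGroupoid.{u, v} 𝒢) (c : ∀ x, V.top.Fiber (𝒢.one x)) (g : G) :
    V.top.Fiber g :=
  V.top.fiberCast (𝒢.isLie.one_mul g) (V.mul (𝒢.one (𝒢.tgt g)) g (c (𝒢.tgt g)) 0)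

/-- The left invariant section `c^l(g) = - 0_g · (c(s(g)))⁻¹`. -/
def leftInvariant (V : VBGroupoid.{u, v} 𝒢) (c : ∀ x, V.top.Fiber (𝒢.one x)) (g : G) :
    V.top.Fiber g :=
  - V.top.fiberCast (mul_inv_one_src 𝒢 g)
    (V.mul g (𝒢.inv (𝒢.one (𝒢.src g))) 0 (V.inv (𝒢.one (𝒢.src g)) (c (𝒢.src g))))

section Differential

variable (V : VBGroupoid.{u, v} 𝒢)

theorem src_zero (g : G) : V.total.src ⟨g, 0⟩ = ⟨𝒢.src g, 0⟩ := by
  simp only [VBGroupoidMaps.total, map_zero]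

theorem tgt_zero (g : G) : V.total.tgt ⟨g, 0⟩ = ⟨𝒢.tgt g, 0⟩ := by
  simp only [VBGroupoidMaps.total, map_zero]

theorem total_mul_zero {g h : G} (hgh : 𝒢.src g = 𝒢.tgt h) :
    V.total.mul ⟨g, 0⟩ ⟨h, 0⟩ = ⟨𝒢.mul g h, 0⟩ := by
  simp only [VBGroupoidMaps.total, V.mul_zero_zero g h hgh]

variable (c : V.coreSections)

theorem src_core (x : M) : V.total.src ⟨𝒢.one x, c.1 x⟩ = ⟨x, 0⟩ := by
  have h : V.src _ (c.1 x) = 0 := c.2.2 x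
  simpa only [VBGroupoidMaps.total, h] using V.side.mk_congr (fun _ => 0) (𝒢.isLie.src_one x)

theorem tgt_core (x : M) :
    V.total.tgt ⟨𝒢.one x, c.1 x⟩ = ⟨x, V.coreAnchor x ⟨c.1 x, c.2.2 x⟩⟩ := by
  simp [coreAnchor, VBGroupoidMaps.total]

theorem comp_right (g : G) :
    V.total.src ⟨𝒢.one (𝒢.tgt g), c.1 (𝒢.tgt g)⟩ = V.total.tgt ⟨g, 0⟩ := by
  rw [src_core, tgt_zero]

theorem comp_left (g : G) :
    V.total.src ⟨g, 0⟩ = V.total.tgt (V.total.inv ⟨𝒢.one (𝒢.src g), c.1 (𝒢.src g)⟩) := by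
  rw [V.isLie.tgt_inv, src_core, src_zero]

theorem mk_rightInvariant (g : G) : (⟨g, V.rightInvariant c.1 g⟩ : V.top.Total) =
    V.total.mul ⟨𝒢.one (𝒢.tgt g), c.1 (𝒢.tgt g)⟩ ⟨g, 0⟩ := by
  simp [rightInvariant, VBGroupoidMaps.total]

theorem mk_neg_leftInvariant (g : G) : (⟨g, -V.leftInvariant c.1 g⟩ : V.top.Total) =
    V.total.mul ⟨g, 0⟩ (V.total.inv ⟨𝒢.one (𝒢.src g), c.1 (𝒢.src g)⟩) := by
  simp [leftInvariant, VBGroupoidMaps.total]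

theorem src_right (g : G) : V.total.src ⟨g, V.rightInvariant c.1 g⟩ = ⟨𝒢.src g, 0⟩ := by
  rw [mk_rightInvariant, V.isLie.src_mul _ _ (V.comp_right c g), src_zero]

theorem tgt_right (g : G) : V.total.tgt ⟨g, V.rightInvariant c.1 g⟩ =
    ⟨𝒢.tgt g, V.coreAnchor _ ⟨c.1 (𝒢.tgt g), c.2.2 _⟩⟩ := by
  rw [mk_rightInvariant, V.isLie.tgt_mul _ _ (V.comp_right c g), tgt_core]

theorem src_left (g : G) : V.total.src ⟨g, -V.leftInvariant c.1 g⟩ =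
    ⟨𝒢.src g, V.coreAnchor _ ⟨c.1 (𝒢.src g), c.2.2 _⟩⟩ := by
  rw [mk_neg_leftInvariant, V.isLie.src_mul _ _ (V.comp_left c g), V.isLie.src_inv, tgt_core]

theorem tgt_left (g : G) : V.total.tgt ⟨g, -V.leftInvariant c.1 g⟩ = ⟨𝒢.tgt g, 0⟩ := by
  rw [mk_neg_leftInvariant, V.isLie.tgt_mul _ _ (V.comp_left c g), tgt_zero]

theorem src_diff (g : G) : V.src g (V.rightInvariant c.1 g - V.leftInvariant c.1 g) =
    V.coreAnchor _ ⟨c.1 (𝒢.src g), c.2.2 _⟩ := by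
  have h1 := V.side.mk_inj (V.src_right c g)
  have h2 := V.side.mk_inj (V.src_left c g)
  rw [sub_eq_add_neg, map_add, h1, h2, zero_add]

theorem tgt_diff (g : G) : V.tgt g (V.rightInvariant c.1 g - V.leftInvariant c.1 g) =
    V.coreAnchor _ ⟨c.1 (𝒢.tgt g), c.2.2 _⟩ := by
  have h1 := V.side.mk_inj (V.tgt_right c g)
  have h2 := V.side.mk_inj (V.tgt_left c g)
  rw [sub_eq_add_neg, map_add, h1, h2, add_zero]

theorem anchor_congr {x y : M} (h : x = y) :
    (⟨x, V.coreAnchor x ⟨c.1 x, c.2.2 x⟩⟩ : V.side.Total) =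
      ⟨y, V.coreAnchor y ⟨c.1 y, c.2.2 y⟩⟩ :=
  V.side.mk_congr (fun x => V.coreAnchor x ⟨c.1 x, c.2.2 x⟩) h

theorem mul_diff (g h : G) (hgh : 𝒢.src g = 𝒢.tgt h) :
    V.rightInvariant c.1 (𝒢.mul g h) - V.leftInvariant c.1 (𝒢.mul g h) =
      V.mul g h (V.rightInvariant c.1 g - V.leftInvariant c.1 g)
        (V.rightInvariant c.1 h - V.leftInvariant c.1 h) := by
  have hz : (⟨𝒢.src g, 0⟩ : V.side.Total) = ⟨𝒢.tgt h, 0⟩ := V.side.mk_congr (fun _ => 0) hgh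
  -- the three composable pairs
  have k1 : V.total.src ⟨g, V.rightInvariant c.1 g⟩ = V.total.tgt ⟨h, 0⟩ := by
    rw [src_right, tgt_zero, hz]
  have k2 : V.total.src ⟨g, -V.leftInvariant c.1 g⟩ =
      V.total.tgt ⟨h, V.rightInvariant c.1 h⟩ := by
    rw [src_left, tgt_right]
    exact V.anchor_congr c hgh
  have k3 : V.total.src ⟨g, 0⟩ = V.total.tgt ⟨h, -V.leftInvariant c.1 h⟩ := by
    rw [src_zero, tgt_left, hz]
  have k23 : V.total.src ⟨g, -V.leftInvariant c.1 g + 0⟩ =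
      V.total.tgt ⟨h, V.rightInvariant c.1 h + -V.leftInvariant c.1 h⟩ := by
    have h2 := V.side.mk_inj (V.tgt_left c h)
    have h2' : V.tgt h (-V.leftInvariant c.1 h) = 0 := h2
    rw [add_zero, k2]
    simp only [VBGroupoidMaps.total, map_add, h2', add_zero]
  have z00 : V.total.src ⟨g, 0⟩ = V.total.tgt ⟨h, 0⟩ := by rw [src_zero, tgt_zero, hz]
  -- the three products
  have e1 : V.mul g h (V.rightInvariant c.1 g) 0 = V.rightInvariant c.1 (𝒢.mul g h) := by
    apply V.top.mk_inj
    change V.total.mul ⟨g, V.rightInvariant c.1 g⟩ ⟨h, 0⟩ = _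
    rw [mk_rightInvariant, mk_rightInvariant,
      V.isLie.mul_assoc _ _ _ (V.comp_right c g) z00, V.total_mul_zero hgh,
      V.top.mk_congr (fun x => (0 : V.top.Fiber x)) rfl]
    congr 1
    have := congrArg (fun x => (⟨𝒢.one x, c.1 x⟩ : V.top.Total)) (𝒢.isLie.tgt_mul g h hgh)
    exact this.symm
  have e3 : V.mul g h 0 (-V.leftInvariant c.1 h) = -V.leftInvariant c.1 (𝒢.mul g h) := by
    apply V.top.mk_inj
    change V.total.mul ⟨g, 0⟩ ⟨h, -V.leftInvariant c.1 h⟩ = _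
    rw [mk_neg_leftInvariant, mk_neg_leftInvariant,
      ← V.isLie.mul_assoc _ _ _ z00 (V.comp_left c h), V.total_mul_zero hgh]
    congr 2
    have := congrArg (fun x => (⟨𝒢.one x, c.1 x⟩ : V.top.Total)) (𝒢.isLie.src_mul g h hgh)
    exact this.symm
  have e2 : V.mul g h (-V.leftInvariant c.1 g) (V.rightInvariant c.1 h) = 0 := by
    apply V.top.mk_inj
    change V.total.mul ⟨g, -V.leftInvariant c.1 g⟩ ⟨h, V.rightInvariant c.1 h⟩ = _
    have hc : (⟨𝒢.one (𝒢.src g), c.1 (𝒢.src g)⟩ : V.top.Total) =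
      ⟨𝒢.one (𝒢.tgt h), c.1 (𝒢.tgt h)⟩ := by rw [hgh]
    have i1 := V.comp_left c g
    have i2 := V.comp_right c h
    have i3 : V.total.src (V.total.inv ⟨𝒢.one (𝒢.tgt h), c.1 (𝒢.tgt h)⟩) =
      V.total.tgt ⟨𝒢.one (𝒢.tgt h), c.1 (𝒢.tgt h)⟩ := V.isLie.src_inv _
    rw [mk_neg_leftInvariant, mk_rightInvariant]
    rw [hc] at i1 ⊢
    rw [V.isLie.mul_assoc _ _ _ i1 (by rw [V.isLie.tgt_mul _ _ i2, i3]),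
      ← V.isLie.mul_assoc _ _ _ i3 i2, V.isLie.inv_mul, i2, V.isLie.one_mul,
      V.total_mul_zero hgh]
  calc V.rightInvariant c.1 (𝒢.mul g h) - V.leftInvariant c.1 (𝒢.mul g h)
      = V.mul g h (V.rightInvariant c.1 g) 0 +
          (V.mul g h (-V.leftInvariant c.1 g) (V.rightInvariant c.1 h) +
            V.mul g h 0 (-V.leftInvariant c.1 h)) := by
        rw [e1, e2, e3, zero_add, sub_eq_add_neg]
    _ = V.mul g h (V.rightInvariant c.1 g + (-V.leftInvariant c.1 g + 0))
          (0 + (V.rightInvariant c.1 h + -V.leftInvariant c.1 h)) := by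
        rw [← V.mul_add _ _ _ _ _ _ k2 k3, ← V.mul_add _ _ _ _ _ _ k1 k23]
    _ = _ := by rw [add_zero, zero_add, sub_eq_add_neg, sub_eq_add_neg]

theorem one_diff (x : M) : V.one x (V.coreAnchor x ⟨c.1 x, c.2.2 x⟩) =
    V.rightInvariant c.1 (𝒢.one x) - V.leftInvariant c.1 (𝒢.one x) := by
  set a : V.top.Total := ⟨𝒢.one x, V.rightInvariant c.1 (𝒢.one x) -
    V.leftInvariant c.1 (𝒢.one x)⟩ with ha
  have hxx : 𝒢.src (𝒢.one x) = 𝒢.tgt (𝒢.one x) := by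
    rw [𝒢.isLie.src_one, 𝒢.isLie.tgt_one]
  have hs : V.total.src a = ⟨x, V.coreAnchor x ⟨c.1 x, c.2.2 x⟩⟩ := by
    rw [← V.anchor_congr c (𝒢.isLie.src_one x), ← src_diff]
    rfl
  have ht : V.total.tgt a = ⟨x, V.coreAnchor x ⟨c.1 x, c.2.2 x⟩⟩ := by
    rw [← V.anchor_congr c (𝒢.isLie.tgt_one x), ← tgt_diff]
    rfl
  have haa : V.total.mul a a = a := by
    have h1 : 𝒢.mul (𝒢.one x) (𝒢.one x) = 𝒢.one x := by
      have := 𝒢.isLie.one_mul (𝒢.one x)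
      rwa [𝒢.isLie.tgt_one] at this
    have h2 := V.mul_diff c _ _ hxx
    change (⟨𝒢.mul (𝒢.one x) (𝒢.one x), V.mul _ _ _ _⟩ : V.top.Total) = _
    rw [← h2]
    exact V.top.mk_congr (fun g => V.rightInvariant c.1 g - V.leftInvariant c.1 g) h1
  have hst : V.total.src a = V.total.tgt a := hs.trans ht.symm
  have key : V.total.one (V.total.src a) = a := by
    have h1 := V.isLie.inv_mul a
    have h2 := V.isLie.mul_assoc (V.total.inv a) a a (V.isLie.src_inv a) hst
    rw [haa, h1, hst, V.isLie.one_mul] at h2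
    rw [hst]
    exact h2.symm
  rw [hs] at key
  exact V.top.mk_inj key

theorem contMDiff_core_anchor : ContMDiff IM V.side.model ∞
    (fun x => (⟨x, V.coreAnchor x ⟨c.1 x, c.2.2 x⟩⟩ : V.side.Total)) := by
  have h := V.isLie.contMDiff_tgt.comp c.2.1
  refine h.congr fun x => ?_
  exact (V.tgt_core c x).symm

theorem contMDiff_rightInvariant : ContMDiff IG V.top.model ∞
    (fun g => (⟨g, V.rightInvariant c.1 g⟩ : V.top.Total)) := by
  have h : ContMDiff IG (V.top.model.prod V.top.model) ∞
      (fun g => ((⟨𝒢.one (𝒢.tgt g), c.1 (𝒢.tgt g)⟩, ⟨g, 0⟩) : V.top.Total × V.top.Total)) :=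
    (c.2.1.comp 𝒢.isLie.contMDiff_tgt).prodMk V.top.contMDiff_zero
  have h2 := V.isLie.contMDiffOn_mul.comp_contMDiff h (fun g => V.comp_right c g)
  exact h2.congr fun g => V.mk_rightInvariant c g

theorem contMDiff_neg_leftInvariant : ContMDiff IG V.top.model ∞
    (fun g => (⟨g, -V.leftInvariant c.1 g⟩ : V.top.Total)) := by
  have h : ContMDiff IG (V.top.model.prod V.top.model) ∞
      (fun g => ((⟨g, 0⟩, V.total.inv ⟨𝒢.one (𝒢.src g), c.1 (𝒢.src g)⟩) :
        V.top.Total × V.top.Total)) :=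
    V.top.contMDiff_zero.prodMk
      (V.isLie.contMDiff_inv.comp (c.2.1.comp 𝒢.isLie.contMDiff_src))
  have h2 := V.isLie.contMDiffOn_mul.comp_contMDiff h (fun g => V.comp_left c g)
  exact h2.congr fun g => V.mk_neg_leftInvariant c g

theorem rightInvariant_add (c d : V.coreSections) (g : G) :
    V.rightInvariant (c + d).1 g = V.rightInvariant c.1 g + V.rightInvariant d.1 g := by
  have h := V.mul_add _ _ _ _ _ _ (V.comp_right c g) (V.comp_right d g)
  rw [add_zero] at h
  simp only [rightInvariant, ← map_add]
  rw [← h]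
  rfl

theorem leftInvariant_add (c d : V.coreSections) (g : G) :
    V.leftInvariant (c + d).1 g = V.leftInvariant c.1 g + V.leftInvariant d.1 g := by
  have h := V.mul_add _ _ _ _ _ _ (V.comp_left c g) (V.comp_left d g)
  rw [add_zero, ← map_add] at h
  simp only [leftInvariant]
  rw [← neg_add, ← map_add, ← h]
  rfl

theorem rightInvariant_smul (a : ℝ) (g : G) :
    V.rightInvariant (a • c).1 g = a • V.rightInvariant c.1 g := by
  have h := V.mul_smul _ _ a _ _ (V.comp_right c g)
  rw [smul_zero] at h
  simp only [rightInvariant, ← map_smul]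
  rw [← h]
  rfl

theorem leftInvariant_smul (a : ℝ) (g : G) :
    V.leftInvariant (a • c).1 g = a • V.leftInvariant c.1 g := by
  have h := V.mul_smul _ _ a _ _ (V.comp_left c g)
  rw [smul_zero, ← map_smul] at h
  simp only [leftInvariant]
  rw [smul_neg, ← map_smul, ← h]
  rfl

end Differential

/-- The differential `δ(c) = c^r - c^l` of the complex of multiplicative sections; the
multiplicative section `c^r - c^l` covers the section `∂c` of `E`. -/
def delta (V : VBGroupoid.{u, v} 𝒢) : V.coreSections →ₗ[ℝ] V.multSections where
  toFun c := ⟨(⟨fun g => V.rightInvariant c.1 g - V.leftInvariant c.1 g, by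
      have h := V.top.contMDiff_add (V.contMDiff_rightInvariant c)
        (V.contMDiff_neg_leftInvariant c)
      simpa only [sub_eq_add_neg] using h⟩,
      ⟨fun x => V.coreAnchor x ⟨c.1 x, c.2.2 x⟩, V.contMDiff_core_anchor c⟩),
    V.src_diff c, V.tgt_diff c, V.one_diff c, V.mul_diff c⟩
  map_add' c d := by
    refine Subtype.ext (Prod.ext (ContMDiffSection.ext fun g => ?_)
      (ContMDiffSection.ext fun x => ?_))
    · change V.rightInvariant (c + d).1 g - V.leftInvariant (c + d).1 g =
        (V.rightInvariant c.1 g - V.leftInvariant c.1 g) +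
          (V.rightInvariant d.1 g - V.leftInvariant d.1 g)
      rw [rightInvariant_add, leftInvariant_add]
      abel
    · exact (V.coreAnchor x).map_add ⟨c.1 x, c.2.2 x⟩ ⟨d.1 x, d.2.2 x⟩
  map_smul' a c := by
    refine Subtype.ext (Prod.ext (ContMDiffSection.ext fun g => ?_)
      (ContMDiffSection.ext fun x => ?_))
    · change V.rightInvariant (a • c).1 g - V.leftInvariant (a • c).1 g =
        a • (V.rightInvariant c.1 g - V.leftInvariant c.1 g)
      rw [rightInvariant_smul, leftInvariant_smul, smul_sub]
    · exact (V.coreAnchor x).map_smul a ⟨c.1 x, c.2.2 x⟩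

/-- The complex of multiplicative sections `δ : Γ(C) → Γ_mult(V)`, a cochain complex of real vector
spaces concentrated in degrees `0` and `1`. -/
def multComplex (V : VBGroupoid.{u, v} 𝒢) : CochainComplex (ModuleCat.{max u v} ℝ) ℤ :=
  HomologicalComplex.double (c := ComplexShape.up ℤ) (i₀ := 0) (i₁ := 1)
    (ModuleCat.ofHom V.delta) (by simp)

/-! ### Direct sums -/

section DirectSum

theorem src_surjective (V : VBGroupoid.{u, v} 𝒢) (g : G) : Function.Surjective (V.src g) :=
  (SmoothVectorBundle.mfderiv_bundleMap V.top V.side V.src 𝒢.isLie.contMDiff_src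
    V.isLie.contMDiff_src ⟨g, 0⟩).2 rfl (V.isLie.submersion_src ⟨g, 0⟩)

variable [IsManifold IG ∞ G] [IsManifold IM ∞ M]

/-- The structure maps of the direct sum, defined componentwise. -/
@[reducible] def sumMaps (V W : VBGroupoid.{u, v} 𝒢) : VBGroupoidMaps.{u, v} 𝒢 where
  top := V.top.prod W.top
  side := V.side.prod W.side
  src g := (V.src g).prodMap (W.src g)
  tgt g := (V.tgt g).prodMap (W.tgt g)
  one x := (V.one x).prodMap (W.one x)
  inv g := (V.inv g).prodMap (W.inv g)
  mul g h p q := (V.mul g h p.1 q.1, W.mul g h p.2 q.2)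

theorem composable_sum {V W : VBGroupoid.{u, v} 𝒢} {p q : (V.top.prod W.top).Total}
    (h : (V.sumMaps W).total.src p = (V.sumMaps W).total.tgt q) :
    V.total.src (V.top.fst W.top p) = V.total.tgt (V.top.fst W.top q) ∧
    W.total.src (V.top.snd W.top p) = W.total.tgt (V.top.snd W.top q) :=
  ⟨congrArg (V.side.fst W.side) h, congrArg (V.side.snd W.side) h⟩

theorem isLie_sum (V W : VBGroupoid.{u, v} 𝒢) :
    IsLieGroupoid (V.top.prod W.top).model (V.side.prod W.side).model (V.sumMaps W).total where
  src_one p := SmoothVectorBundle.prod_ext (V.isLie.src_one (V.side.fst W.side p))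
    (W.isLie.src_one (V.side.snd W.side p))
  tgt_one p := SmoothVectorBundle.prod_ext (V.isLie.tgt_one (V.side.fst W.side p))
    (W.isLie.tgt_one (V.side.snd W.side p))
  src_mul _ _ h := SmoothVectorBundle.prod_ext (V.isLie.src_mul _ _ (composable_sum h).1)
    (W.isLie.src_mul _ _ (composable_sum h).2)
  tgt_mul _ _ h := SmoothVectorBundle.prod_ext (V.isLie.tgt_mul _ _ (composable_sum h).1)
    (W.isLie.tgt_mul _ _ (composable_sum h).2)
  mul_assoc _ _ _ h k := SmoothVectorBundle.prod_ext
    (V.isLie.mul_assoc _ _ _ (composable_sum h).1 (composable_sum k).1)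
    (W.isLie.mul_assoc _ _ _ (composable_sum h).2 (composable_sum k).2)
  one_mul p := SmoothVectorBundle.prod_ext (V.isLie.one_mul (V.top.fst W.top p))
    (W.isLie.one_mul (V.top.snd W.top p))
  mul_one p := SmoothVectorBundle.prod_ext (V.isLie.mul_one (V.top.fst W.top p))
    (W.isLie.mul_one (V.top.snd W.top p))
  src_inv p := SmoothVectorBundle.prod_ext (V.isLie.src_inv (V.top.fst W.top p))
    (W.isLie.src_inv (V.top.snd W.top p))
  tgt_inv p := SmoothVectorBundle.prod_ext (V.isLie.tgt_inv (V.top.fst W.top p))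
    (W.isLie.tgt_inv (V.top.snd W.top p))
  inv_mul p := SmoothVectorBundle.prod_ext (V.isLie.inv_mul (V.top.fst W.top p))
    (W.isLie.inv_mul (V.top.snd W.top p))
  mul_inv p := SmoothVectorBundle.prod_ext (V.isLie.mul_inv (V.top.fst W.top p))
    (W.isLie.mul_inv (V.top.snd W.top p))
  contMDiff_src := SmoothVectorBundle.contMDiff_prod_iff.2
    ⟨V.isLie.contMDiff_src.comp SmoothVectorBundle.contMDiff_fst,
      W.isLie.contMDiff_src.comp SmoothVectorBundle.contMDiff_snd⟩
  contMDiff_tgt := SmoothVectorBundle.contMDiff_prod_iff.2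
    ⟨V.isLie.contMDiff_tgt.comp SmoothVectorBundle.contMDiff_fst,
      W.isLie.contMDiff_tgt.comp SmoothVectorBundle.contMDiff_snd⟩
  contMDiff_one := SmoothVectorBundle.contMDiff_prod_iff.2
    ⟨V.isLie.contMDiff_one.comp SmoothVectorBundle.contMDiff_fst,
      W.isLie.contMDiff_one.comp SmoothVectorBundle.contMDiff_snd⟩
  contMDiff_inv := SmoothVectorBundle.contMDiff_prod_iff.2
    ⟨V.isLie.contMDiff_inv.comp SmoothVectorBundle.contMDiff_fst,
      W.isLie.contMDiff_inv.comp SmoothVectorBundle.contMDiff_snd⟩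
  contMDiffOn_mul := fun p hp => SmoothVectorBundle.contMDiffWithinAt_prod_iff.2
    ⟨(V.isLie.contMDiffOn_mul _ (composable_sum hp).1).comp p
        (ContMDiff.contMDiffOn (s := univ) ((SmoothVectorBundle.contMDiff_fst.comp
          contMDiff_fst).prodMk (SmoothVectorBundle.contMDiff_fst.comp contMDiff_snd)) p
            trivial |>.mono (subset_univ _))
        (fun _ hq => (composable_sum hq).1),
      (W.isLie.contMDiffOn_mul _ (composable_sum hp).2).comp p
        (ContMDiff.contMDiffOn (s := univ) ((SmoothVectorBundle.contMDiff_snd.comp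
          contMDiff_fst).prodMk (SmoothVectorBundle.contMDiff_snd.comp contMDiff_snd)) p
            trivial |>.mono (subset_univ _))
        (fun _ hq => (composable_sum hq).2)⟩
  submersion_src p :=
    (SmoothVectorBundle.mfderiv_bundleMap (V.top.prod W.top) (V.side.prod W.side)
      (V.sumMaps W).src 𝒢.isLie.contMDiff_src
      (SmoothVectorBundle.contMDiff_prod_iff.2
        ⟨V.isLie.contMDiff_src.comp SmoothVectorBundle.contMDiff_fst,
          W.isLie.contMDiff_src.comp SmoothVectorBundle.contMDiff_snd⟩) p).1
      (𝒢.isLie.submersion_src p.1)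
      (Prod.map_surjective.2 ⟨V.src_surjective p.1, W.src_surjective p.1⟩)

/-- The direct sum `V ⊕ W ⇉ E ⊕ E'` of two VB-groupoids over `𝒢`. -/
def directSum (V W : VBGroupoid.{u, v} 𝒢) : VBGroupoid.{u, v} 𝒢 where
  toVBGroupoidMaps := V.sumMaps W
  isLie := V.isLie_sum W
  mul_add g h _ _ _ _ hp hq := Prod.ext
    (V.mul_add g h _ _ _ _ (composable_sum hp).1 (composable_sum hq).1)
    (W.mul_add g h _ _ _ _ (composable_sum hp).2 (composable_sum hq).2)
  mul_smul g h a _ _ hp := Prod.ext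
    (V.mul_smul g h a _ _ (composable_sum hp).1) (W.mul_smul g h a _ _ (composable_sum hp).2)

/-- `V₀` is a type zero component of `V`: it is of type zero, and `V` is isomorphic to the direct
sum of `V₀` and a VB-groupoid of type one. -/
def IsTypeZeroComponent (V₀ V : VBGroupoid.{u, v} 𝒢) : Prop :=
  V₀.IsTypeZero ∧ ∃ V₁ : VBGroupoid.{u, v} 𝒢, V₁.IsTypeOne ∧ Nonempty (V.Iso (V₀.directSum V₁))

end DirectSum

end VBGroupoid
end VBGroupoids

/-- Two cochain complexes of vector spaces are quasi-isomorphic. Over a field, the existence of a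
quasi-isomorphism is equivalent to the existence of a zigzag of quasi-isomorphisms. -/
def QuasiIsomorphic (K L : CochainComplex (ModuleCat.{v} ℝ) ℤ) : Prop :=
  ∃ f : K ⟶ L, QuasiIso f

end

/-! Write `s`, `t` for the source and target of `V`, and `∂ : C → E` for the core anchor. Constant
rank of `∂` gives a smooth generalized inverse `σ : E → C`, with `∂σ∂ = ∂` and `σ∂σ = σ`, so `π =
∂σ` is a smooth projection of `E` onto `im ∂`. It lifts to arrows over `g` by `v ↦ σ(t v) · 0_g ·
σ(s v)⁻¹` (`CoreSplitting.arrMap`). Products of such arrows telescope, so this is a groupoid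
morphism. It sees `v` only through `π(t v)` and `π(s v)`, hence it is idempotent, and its range over
`g` is `im ∂` at `t(g)` plus `im ∂` at `s(g)`, of constant rank.

The images of this projection and of its complement are therefore VB-groupoids, and `V` is their
direct sum (`Projection.decomp`). In the image of the projection an arrow is determined by its
source and target, and every element of `im ∂` is reached from the core: type one
(`isTypeOne_image`). On the complement `∂` takes values in `im π ∩ ker π = 0`: type zero
(`isTypeZero_image_compl`).

To obtain `σ` without making the core a bundle, `∂` is replaced by `t - s` on the restriction of `V`
to the units, which has the same range. A generalized inverse is found locally by inverting an `r ×
r` block; since `TST = T` is an affine condition on `S`, a partition of unity glues the local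
solutions (`exists_genInverse`).

For `V₁` of type one, right translation by zero arrows identifies the common kernel of `s` and `t`
on each fiber with a subspace of `ker ∂ = 0`. A multiplicative section is thus determined by the
section `e` of `E` that it covers, and `δ(∂⁻¹e)` covers `e`; hence `δ` is bijective
(`IsTypeOne.delta_bijective`). For any decomposition the complex of `V` is that of `V₀` plus a
contractible one, which gives a homotopy equivalence (`IsTypeZeroComponent.quasiIsomorphic`). -/

noncomputable section

/-! ### Vector bundle maps in local trivializations -/

/-- A basis of `X` identifies `X →L[ℝ] Y` with `Y ^ d`, so operator-valued smoothness reduces to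
smoothness on finitely many vectors. -/
theorem contMDiffWithinAt_clm_of_apply {EN HN N : Type*} [NormedAddCommGroup EN] [NormedSpace ℝ EN]
    [TopologicalSpace HN] {IN : ModelWithCorners ℝ EN HN} [TopologicalSpace N] [ChartedSpace HN N]
    {X Y : Type*} [NormedAddCommGroup X] [NormedSpace ℝ X] [FiniteDimensional ℝ X]
    [NormedAddCommGroup Y] [NormedSpace ℝ Y] {f : N → X →L[ℝ] Y} {x : N} {s : Set N}
    (h : ∀ w, ContMDiffWithinAt IN 𝓘(ℝ, Y) ∞ (fun z => f z w) s x) :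
    ContMDiffWithinAt IN 𝓘(ℝ, X →L[ℝ] Y) ∞ f s x := by
  let d := Module.finrank ℝ X
  have hd : d = Module.finrank ℝ (Fin d → ℝ) := (Module.finrank_fin_fun ℝ).symm
  let e₁ := ContinuousLinearEquiv.ofFinrankEq hd
  let e₂ := (e₁.arrowCongr (1 : Y ≃L[ℝ] Y)).trans (ContinuousLinearEquiv.piRing (Fin d))
  have h1 : ContMDiffWithinAt IN 𝓘(ℝ, Fin d → Y) ∞ (fun z => e₂ (f z)) s x :=
    contMDiffWithinAt_pi_space.2 fun i => h _
  have h2 : f = fun z => e₂.symm (e₂ (f z)) := by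
    funext z; simp
  rw [h2]
  exact e₂.symm.contDiff.contMDiff.contMDiffAt.comp_contMDiffWithinAt x h1

theorem contMDiffAt_ringInverse {EN HN N : Type*} [NormedAddCommGroup EN] [NormedSpace ℝ EN]
    [TopologicalSpace HN] {IN : ModelWithCorners ℝ EN HN} [TopologicalSpace N] [ChartedSpace HN N]
    {X : Type*} [NormedAddCommGroup X] [NormedSpace ℝ X] [FiniteDimensional ℝ X]
    {f : N → X →L[ℝ] X} {x : N} (hf : ContMDiffAt IN 𝓘(ℝ, X →L[ℝ] X) ∞ f x)
    (hx : IsUnit (f x)) : ContMDiffAt IN 𝓘(ℝ, X →L[ℝ] X) ∞ (fun z => Ring.inverse (f z)) x := by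
  have : CompleteSpace X := FiniteDimensional.complete ℝ X
  obtain ⟨y, hy⟩ := hx
  have h := contDiffAt_ringInverse ℝ (n := ∞) y
  rw [hy] at h
  exact h.contMDiffAt.comp x hf

namespace SmoothVectorBundle

section LocalRep

variable {EB HB : Type*} [NormedAddCommGroup EB] [NormedSpace ℝ EB] [TopologicalSpace HB]
  {IB : ModelWithCorners ℝ EB HB} {B : Type*} [TopologicalSpace B] [ChartedSpace HB B]
  {EN HN N : Type*} [NormedAddCommGroup EN] [NormedSpace ℝ EN] [TopologicalSpace HN]
  {IN : ModelWithCorners ℝ EN HN} [TopologicalSpace N] [ChartedSpace HN N]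
  {A : SmoothVectorBundle IB B} {D : SmoothVectorBundle IN N}
  {φ : B → N} (Φ : ∀ x, A.Fiber x →ₗ[ℝ] D.Fiber (φ x))

/-- A fiberwise linear map of vector bundles, read in the preferred trivializations at `x₀`
and `y₀`. -/
def localRep (x₀ : B) (y₀ : N) (x : B) : A.Model →L[ℝ] D.Model :=
  LinearMap.toContinuousLinearMap
    (((trivializationAt D.Model D.Fiber y₀).linearMapAt ℝ (φ x)) ∘ₗ Φ x ∘ₗ
      ((trivializationAt A.Model A.Fiber x₀).symmₗ ℝ x))

variable {Φ}

theorem localRep_apply {x₀ : B} {y₀ : N} {x : B} 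
    (hy : φ x ∈ (trivializationAt D.Model D.Fiber y₀).baseSet) (w : A.Model) :
    localRep Φ x₀ y₀ x w = (trivializationAt D.Model D.Fiber y₀
      ⟨φ x, Φ x ((trivializationAt A.Model A.Fiber x₀).symmₗ ℝ x w)⟩).2 := by
  simp [localRep, hy]

theorem localRep_apply_coord {x₀ : B} {y₀ : N} {x : B} 
    (hx : x ∈ (trivializationAt A.Model A.Fiber x₀).baseSet)
    (hy : φ x ∈ (trivializationAt D.Model D.Fiber y₀).baseSet) (a : A.Fiber x) :
    localRep Φ x₀ y₀ x (trivializationAt A.Model A.Fiber x₀ ⟨x, a⟩).2 =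
      (trivializationAt D.Model D.Fiber y₀ ⟨φ x, Φ x a⟩).2 := by
  rw [localRep_apply hy]
  have := (trivializationAt A.Model A.Fiber x₀).symmₗ_linearMapAt (R := ℝ) hx a
  rw [Trivialization.linearMapAt_apply, if_pos hx] at this
  rw [this]

/-- A smooth vector bundle map is smooth in local trivializations. -/
theorem contMDiffAt_localRep (hφ : ContMDiff IB IN ∞ φ)
    (hΦ : ContMDiff A.model D.model ∞ (fun p : A.Total => (⟨φ p.1, Φ p.1 p.2⟩ : D.Total)))
    {x₀ : B} {y₀ : N} {x : B}
    (hx : x ∈ (trivializationAt A.Model A.Fiber x₀).baseSet)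
    (hy : φ x ∈ (trivializationAt D.Model D.Fiber y₀).baseSet) :
    ContMDiffAt IB 𝓘(ℝ, A.Model →L[ℝ] D.Model) ∞ (localRep Φ x₀ y₀) x := by
  rw [← contMDiffWithinAt_univ]
  refine contMDiffWithinAt_clm_of_apply fun w => ?_
  rw [contMDiffWithinAt_univ]
  -- The local section with constant coordinate `w` is smooth; its image under `Φ`, read in `D`, is
  -- `localRep` applied to `w`.
  have h1 : ContMDiffAt IB A.model ∞ (fun z =>
      (⟨z, (trivializationAt A.Model A.Fiber x₀).symmₗ ℝ z w⟩ : A.Total)) x := by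
    rw [(trivializationAt A.Model A.Fiber x₀).contMDiffAt_iff
      ((trivializationAt A.Model A.Fiber x₀).mem_source.2 hx)]
    refine ⟨contMDiffAt_id, ?_⟩
    refine (contMDiffAt_const (c := w)).congr_of_eventuallyEq ?_
    filter_upwards [(trivializationAt A.Model A.Fiber x₀).open_baseSet.mem_nhds hx] with z hz
    have := (trivializationAt A.Model A.Fiber x₀).linearMapAt_symmₗ (R := ℝ) hz w
    rwa [Trivialization.linearMapAt_apply, if_pos hz] at this
  have h2 := (hΦ.contMDiffAt).comp x h1
  rw [(trivializationAt D.Model D.Fiber y₀).contMDiffAt_iff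
      ((trivializationAt D.Model D.Fiber y₀).mem_source.2 hy)] at h2
  refine h2.2.congr_of_eventuallyEq ?_
  filter_upwards [hφ.continuous.continuousAt.preimage_mem_nhds
    ((trivializationAt D.Model D.Fiber y₀).open_baseSet.mem_nhds hy)] with z hz
  exact localRep_apply hz w

/-- A vector bundle map which is smooth in local trivializations is smooth. -/
theorem contMDiff_of_localRep (hφ : ContMDiff IB IN ∞ φ)
    (h : ∀ x, ContMDiffAt IB 𝓘(ℝ, A.Model →L[ℝ] D.Model) ∞ (localRep Φ x (φ x)) x) :
    ContMDiff A.model D.model ∞ (fun p : A.Total => (⟨φ p.1, Φ p.1 p.2⟩ : D.Total)) := by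
  rintro p
  have hp : ContMDiffAt A.model IB ∞ (fun p : A.Total => p.1) p :=
    Bundle.contMDiffAt_proj A.Fiber
  rw [contMDiffAt_totalSpace]
  refine ⟨hφ.contMDiffAt.comp p hp, ?_⟩
  have h1 : ContMDiffAt A.model 𝓘(ℝ, A.Model →L[ℝ] D.Model) ∞
    (fun q : A.Total => localRep Φ p.1 (φ p.1) q.1) p := (h p.1).comp p hp
  have h2 := (contMDiffAt_totalSpace.1 (contMDiffAt_id (I := A.model) (n := ∞) (x := p))).2
  -- Near `p` the fiber coordinate of the image is `localRep` at the base point applied to the fiber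
  -- coordinate of the argument, and both depend smoothly on the argument.
  refine (h1.clm_apply h2).congr_of_eventuallyEq ?_
  have n1 : ∀ᶠ q : A.Total in 𝓝 p, q.1 ∈ (trivializationAt A.Model A.Fiber p.1).baseSet :=
    hp.continuousAt.preimage_mem_nhds
      ((trivializationAt A.Model A.Fiber p.1).open_baseSet.mem_nhds
        (FiberBundle.mem_baseSet_trivializationAt' _))
  have n2 : ∀ᶠ q : A.Total in 𝓝 p, φ q.1 ∈ (trivializationAt D.Model D.Fiber (φ p.1)).baseSet :=
    (hφ.contMDiffAt.comp p hp).continuousAt.preimage_mem_nhds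
      ((trivializationAt D.Model D.Fiber (φ p.1)).open_baseSet.mem_nhds
        (FiberBundle.mem_baseSet_trivializationAt' _))
  filter_upwards [n1, n2] with q hq hq'
  exact (localRep_apply_coord hq hq' q.2).symm

end LocalRep

end SmoothVectorBundle

/-! ### The image of a smooth projection of a vector bundle -/

/-- An idempotent splits through its range. The range is exchanged for a prescribed space `W` of the
same dimension because the image bundle needs one model fiber for all base points. -/
theorem exists_factor_of_idempotent {X W : Type*} [NormedAddCommGroup X] [NormedSpace ℝ X]
    [FiniteDimensional ℝ X] [NormedAddCommGroup W] [NormedSpace ℝ W] [FiniteDimensional ℝ W]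
    (Q : X →L[ℝ] X) (hQ : ∀ w, Q (Q w) = Q w)
    (h : Module.finrank ℝ (LinearMap.range (Q : X →ₗ[ℝ] X)) = Module.finrank ℝ W) :
    ∃ (l : X →L[ℝ] W) (i : W →L[ℝ] X), (∀ z, l (i z) = z) ∧ ∀ w, i (l w) = Q w := by
  let E : LinearMap.range (Q : X →ₗ[ℝ] X) ≃ₗ[ℝ] W := LinearEquiv.ofFinrankEq _ _ h
  refine ⟨LinearMap.toContinuousLinearMap (E.toLinearMap ∘ₗ (Q : X →ₗ[ℝ] X).rangeRestrict),
    LinearMap.toContinuousLinearMap ((Submodule.subtype _) ∘ₗ E.symm.toLinearMap), fun z => ?_,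
    fun w => ?_⟩
  · obtain ⟨w, hw⟩ := (E.symm z).2
    have h1 : (Q : X →ₗ[ℝ] X).rangeRestrict ((E.symm z : X)) = E.symm z := by
      apply Subtype.ext
      change Q (E.symm z : X) = E.symm z
      rw [← hw]
      exact hQ w
    simp [h1]
  · simp

namespace SmoothVectorBundle

variable {EB HB : Type*} [NormedAddCommGroup EB] [NormedSpace ℝ EB] [TopologicalSpace HB]
  {IB : ModelWithCorners ℝ EB HB} {B : Type u} [TopologicalSpace B] [ChartedSpace HB B]

/-- A smooth idempotent endomorphism of constant rank of a vector bundle. -/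
structure SmoothProjection (A : SmoothVectorBundle.{u, v} IB B) where
  map : ∀ x, A.Fiber x →ₗ[ℝ] A.Fiber x
  idem : ∀ x a, map x (map x a) = map x a
  smooth : ContMDiff A.model A.model ∞ (fun p : A.Total => (⟨p.1, map p.1 p.2⟩ : A.Total))
  rank : ℕ
  finrank_range : ∀ x, Module.finrank ℝ (LinearMap.range (map x)) = rank

namespace SmoothProjection

variable {A : SmoothVectorBundle.{u, v} IB B} (P : SmoothProjection A)

/-- The projection in local trivializations. -/
abbrev rep (x₀ x₁ x : B) : A.Model →L[ℝ] A.Model :=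
  localRep (φ := fun x => x) P.map x₀ x₁ x

/-- The base set of the preferred trivialization at a point. -/
abbrev nbhd (A : SmoothVectorBundle.{u, v} IB B) (x₀ : B) : Set B :=
  (trivializationAt A.Model A.Fiber x₀).baseSet

theorem mem_nbhd (x : B) : x ∈ nbhd A x :=
  FiberBundle.mem_baseSet_trivializationAt' x

theorem contMDiffAt_rep {x₀ x₁ x : B} (h₀ : x ∈ nbhd A x₀) (h₁ : x ∈ nbhd A x₁) :
    ContMDiffAt IB 𝓘(ℝ, A.Model →L[ℝ] A.Model) ∞ (P.rep x₀ x₁) x :=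
  contMDiffAt_localRep contMDiff_id P.smooth h₀ h₁

theorem rep_rep {x₀ x₁ x₂ x : B} (h₁ : x ∈ nbhd A x₁) (h₂ : x ∈ nbhd A x₂) (w : A.Model) :
    P.rep x₁ x₂ x (P.rep x₀ x₁ x w) = P.rep x₀ x₂ x w := by
  rw [rep, rep, localRep_apply (φ := fun x => x) h₁, localRep_apply_coord (φ := fun x => x) h₁ h₂,
    rep, localRep_apply (φ := fun x => x) h₂, P.idem]

theorem finrank_range_rep (x : B) :
    Module.finrank ℝ (LinearMap.range (P.rep x x x : A.Model →ₗ[ℝ] A.Model)) = P.rank := by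
  let e := (trivializationAt A.Model A.Fiber x).linearEquivAt ℝ x (mem_nbhd x)
  have h : (P.rep x x x : A.Model →ₗ[ℝ] A.Model) = e.toLinearMap ∘ₗ P.map x ∘ₗ
      e.symm.toLinearMap := by
    ext w
    obtain ⟨a, rfl⟩ := e.surjective w
    have := localRep_apply_coord (φ := fun x => x) (Φ := P.map) (mem_nbhd x) (mem_nbhd x) a
    simp only [ContinuousLinearMap.coe_coe, LinearMap.coe_comp, LinearEquiv.coe_coe,
      Function.comp_apply, LinearEquiv.symm_apply_apply]
    exact this
  rw [h, LinearMap.range_comp, LinearMap.range_comp, LinearEquiv.range, Submodule.map_top,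
    LinearEquiv.finrank_map_eq, P.finrank_range]

/-- The model fiber of the image of a projection. -/
abbrev ImageModel (P : SmoothProjection A) : Type v := ULift.{v} (Fin P.rank) → ℝ

theorem exists_factor (x : B) : ∃ q : (A.Model →L[ℝ] P.ImageModel) × (P.ImageModel →L[ℝ] A.Model),
    (∀ z, q.1 (q.2 z) = z) ∧ ∀ w, q.2 (q.1 w) = P.rep x x x w := by
  obtain ⟨l, i, h⟩ := exists_factor_of_idempotent (W := P.ImageModel) (P.rep x x x)
    (fun w => P.rep_rep (mem_nbhd x) (mem_nbhd x) w) (by simp [finrank_range_rep])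
  exact ⟨(l, i), h⟩

/-- The projection of the model fiber to the model fiber of the image. -/
def lower (x : B) : A.Model →L[ℝ] P.ImageModel := (P.exists_factor x).choose.1

/-- The inclusion of the model fiber of the image. -/
def raise (x : B) : P.ImageModel →L[ℝ] A.Model := (P.exists_factor x).choose.2

theorem lower_raise (x : B) (z : P.ImageModel) : P.lower x (P.raise x z) = z :=
  (P.exists_factor x).choose_spec.1 z

theorem raise_lower (x : B) (w : A.Model) : P.raise x (P.lower x w) = P.rep x x x w :=
  (P.exists_factor x).choose_spec.2 w

theorem lower_rep (x : B) (w : A.Model) : P.lower x (P.rep x x x w) = P.lower x w := by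
  rw [← raise_lower, lower_raise]

theorem rep_raise (x : B) (z : P.ImageModel) : P.rep x x x (P.raise x z) = P.raise x z := by
  rw [← raise_lower, lower_raise]

/-- An endomorphism of the model fiber which intertwines the projection at `x` with the
projection at `x₀`. -/
def twist (x₀ x : B) : A.Model →L[ℝ] A.Model :=
  -- For idempotents `Q₀`, `Q` the element `U = Q₀Q + (1 - Q₀)(1 - Q)` satisfies `UQ = Q₀Q = Q₀U`;
  -- where it is invertible it conjugates `Q` into `Q₀`.
  P.rep x₀ x₀ x₀ * P.rep x₀ x₀ x + (1 - P.rep x₀ x₀ x₀) * (1 - P.rep x₀ x₀ x)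

theorem contMDiffAt_twist {x₀ x : B} (h : x ∈ nbhd A x₀) :
    ContMDiffAt IB 𝓘(ℝ, A.Model →L[ℝ] A.Model) ∞ (P.twist x₀) x := by
  have h1 := P.contMDiffAt_rep h h
  have h2 : ContDiff ℝ ∞ (fun T : A.Model →L[ℝ] A.Model =>
    P.rep x₀ x₀ x₀ * T + (1 - P.rep x₀ x₀ x₀) * (1 - T)) := by fun_prop
  exact h2.contMDiff.contMDiffAt.comp x h1

/-- Units are open, so this value at the center makes the twist invertible nearby; that is why `dom`
is a neighborhood of its center. -/
theorem twist_self (x : B) : P.twist x x = 1 := by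
  ext w
  simp [twist, P.rep_rep (mem_nbhd x) (mem_nbhd x)]

theorem twist_rep {x₀ x : B} (h : x ∈ nbhd A x₀) (w : A.Model) :
    P.twist x₀ x (P.rep x₀ x₀ x w) = P.rep x₀ x₀ x₀ (P.rep x₀ x₀ x w) := by
  simp [twist, P.rep_rep h h]

theorem rep_twist {x₀ x : B} (w : A.Model) :
    P.rep x₀ x₀ x₀ (P.twist x₀ x w) = P.rep x₀ x₀ x₀ (P.rep x₀ x₀ x w) := by
  simp [twist, P.rep_rep (mem_nbhd x₀) (mem_nbhd x₀)]

/-- The domain of the preferred trivialization of the image. -/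
def dom (x₀ : B) : Set B := nbhd A x₀ ∩ {x | IsUnit (P.twist x₀ x)}

theorem isOpen_dom (x₀ : B) : IsOpen (P.dom x₀) := by
  have : CompleteSpace A.Model := FiniteDimensional.complete ℝ A.Model
  have h : ContinuousOn (P.twist x₀) (nbhd A x₀) := fun x hx =>
    (P.contMDiffAt_twist hx).continuousAt.continuousWithinAt
  exact h.isOpen_inter_preimage (trivializationAt A.Model A.Fiber x₀).open_baseSet Units.isOpen

theorem mem_dom (x : B) : x ∈ P.dom x :=
  ⟨mem_nbhd x, by simp [twist_self]⟩

/-- The inverse of the preferred trivialization, as a map to the model fiber of `A`. -/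
def untwist (x₀ x : B) : P.ImageModel →L[ℝ] A.Model :=
  (Ring.inverse (P.twist x₀ x)).comp (P.raise x₀)

theorem contMDiffAt_untwist {x₀ x : B} (h : x ∈ P.dom x₀) :
    ContMDiffAt IB 𝓘(ℝ, P.ImageModel →L[ℝ] A.Model) ∞ (P.untwist x₀) x :=
  (contMDiffAt_ringInverse (P.contMDiffAt_twist h.1) h.2).clm_comp contMDiffAt_const

theorem twist_untwist {x₀ x : B} (h : x ∈ P.dom x₀) (z : P.ImageModel) :
    P.twist x₀ x (P.untwist x₀ x z) = P.raise x₀ z := by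
  have h1 := Ring.mul_inverse_cancel _ h.2
  exact congrArg (fun T : A.Model →L[ℝ] A.Model => T (P.raise x₀ z)) h1

/-- On a vector fixed by the projection at `x`, the twist is the projection at `x₀`, which is `raise
∘ lower`; undoing the twist returns the vector. -/
theorem untwist_lower {x₀ x : B} (h : x ∈ P.dom x₀) (w : A.Model) (hw : P.rep x₀ x₀ x w = w) :
    P.untwist x₀ x (P.lower x₀ w) = w := by
  have h1 := Ring.inverse_mul_cancel _ h.2
  have h2 := congrArg (fun T : A.Model →L[ℝ] A.Model => T w) h1
  have h3 : P.raise x₀ (P.lower x₀ w) = P.twist x₀ x w := by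
    rw [raise_lower, ← hw, twist_rep _ h.1]
  change Ring.inverse (P.twist x₀ x) (P.raise x₀ (P.lower x₀ w)) = w
  rw [h3]
  exact h2

/-- With `U`, `Q`, `Q₀` for the twist and the projections at `x` and `x₀`: `lower` absorbs `Q₀`, and
`Q₀ Q U⁻¹ = Q₀ U U⁻¹ = Q₀`, which fixes the range of `raise`. -/
theorem lower_rep_untwist {x₀ x : B} (h : x ∈ P.dom x₀) (z : P.ImageModel) :
    P.lower x₀ (P.rep x₀ x₀ x (P.untwist x₀ x z)) = z := by
  rw [← lower_rep, ← rep_twist, twist_untwist _ h, rep_raise, lower_raise]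

/-- The fiber of the image of a projection. -/
abbrev ImageFiber (P : SmoothProjection A) (x : B) : Type v := LinearMap.range (P.map x)

theorem map_coe {x : B} (a : P.ImageFiber x) : P.map x (a : A.Fiber x) = a := by
  obtain ⟨b, hb⟩ := a.2
  rw [← hb, P.idem]

/-- The fiberwise linear projection onto the image. -/
def toImage (x : B) : A.Fiber x →ₗ[ℝ] P.ImageFiber x := (P.map x).rangeRestrict

@[simp] theorem toImage_coe (x : B) (a : P.ImageFiber x) : P.toImage x (a : A.Fiber x) = a :=
  Subtype.ext (P.map_coe a)

theorem rep_coord {x₀ x : B} (h : x ∈ nbhd A x₀) (a : P.ImageFiber x) :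
    P.rep x₀ x₀ x (trivializationAt A.Model A.Fiber x₀ ⟨x, a⟩).2 =
      (trivializationAt A.Model A.Fiber x₀ ⟨x, a⟩).2 := by
  rw [rep, localRep_apply_coord (φ := fun x => x) h h, map_coe]

theorem symm_coord {x₀ x : B} (h : x ∈ nbhd A x₀) (a : A.Fiber x) :
    (trivializationAt A.Model A.Fiber x₀).symmₗ ℝ x
      (trivializationAt A.Model A.Fiber x₀ ⟨x, a⟩).2 = a := by
  have := (trivializationAt A.Model A.Fiber x₀).symmₗ_linearMapAt (R := ℝ) h a
  rwa [Trivialization.linearMapAt_apply, if_pos h] at this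

/-- The preferred pretrivialization of the image. -/
def imagePretriv (x₀ : B) : Pretrivialization P.ImageModel (π P.ImageModel P.ImageFiber) where
  toFun p := (p.1, P.lower x₀ (trivializationAt A.Model A.Fiber x₀ ⟨p.1, p.2.1⟩).2)
  -- Over `dom` the vector already lies in the image, since `U⁻¹Q₀ = QU⁻¹` for the twist `U`. There
  -- `toImage` moves nothing and only supplies membership.
  invFun q := ⟨q.1, P.toImage q.1 ((trivializationAt A.Model A.Fiber x₀).symmₗ ℝ q.1
    (P.untwist x₀ q.1 q.2))⟩
  source := π P.ImageModel P.ImageFiber ⁻¹' P.dom x₀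
  target := P.dom x₀ ×ˢ univ
  map_source' _ hp := ⟨hp, trivial⟩
  map_target' _ hq := hq.1
  left_inv' := by
    rintro ⟨x, a⟩ hp
    have hx : x ∈ P.dom x₀ := hp
    refine congrArg (TotalSpace.mk x) (Subtype.ext ?_)
    change P.map x ((trivializationAt A.Model A.Fiber x₀).symmₗ ℝ x (P.untwist x₀ x
      (P.lower x₀ (trivializationAt A.Model A.Fiber x₀ ⟨x, a⟩).2))) = a
    rw [untwist_lower _ hx _ (P.rep_coord hx.1 a), symm_coord hx.1, map_coe]
  right_inv' := by
    rintro ⟨x, z⟩ hq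
    have hx : x ∈ P.dom x₀ := hq.1
    refine Prod.ext rfl ?_
    change P.lower x₀ (trivializationAt A.Model A.Fiber x₀ ⟨x, P.map x
      ((trivializationAt A.Model A.Fiber x₀).symmₗ ℝ x (P.untwist x₀ x z))⟩).2 = z
    rw [← localRep_apply (φ := fun x => x) (Φ := P.map) hx.1]
    exact P.lower_rep_untwist hx z
  open_target := (P.isOpen_dom x₀).prod isOpen_univ
  baseSet := P.dom x₀
  open_baseSet := P.isOpen_dom x₀
  source_eq := rfl
  target_eq := rfl
  proj_toFun _ _ := rfl

theorem imagePretriv_symm {x₀ x : B} (h : x ∈ P.dom x₀) (z : P.ImageModel) :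
    (P.imagePretriv x₀).symm x z = P.toImage x ((trivializationAt A.Model A.Fiber x₀).symmₗ ℝ x
      (P.untwist x₀ x z)) := by
  have h1 := (P.imagePretriv x₀).mk_symm h z
  exact eq_of_heq (TotalSpace.mk.inj h1).2

/-- The coordinate changes of the image bundle. -/
def imageCoord (x₀ x₁ x : B) : P.ImageModel →L[ℝ] P.ImageModel :=
  (P.lower x₁).comp ((P.rep x₀ x₁ x).comp (P.untwist x₀ x))

/-- The transition function of `A` never occurs by itself: composed with the projection it is `rep
x₀ x₁`, already known to be smooth. -/
theorem contMDiffOn_imageCoord (x₀ x₁ : B) :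
    ContMDiffOn IB 𝓘(ℝ, P.ImageModel →L[ℝ] P.ImageModel) ∞ (P.imageCoord x₀ x₁)
      (P.dom x₀ ∩ P.dom x₁) := fun _ hx =>
  (contMDiffAt_const.clm_comp ((P.contMDiffAt_rep hx.1.1 hx.2.1).clm_comp
    (P.contMDiffAt_untwist hx.1))).contMDiffWithinAt

theorem imageCoord_apply {x₀ x₁ x : B} (h : x ∈ P.dom x₀ ∩ P.dom x₁) (z : P.ImageModel) :
    P.imageCoord x₀ x₁ x z = (P.imagePretriv x₁ ⟨x, (P.imagePretriv x₀).symm x z⟩).2 := by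
  rw [imagePretriv_symm _ h.1]
  change P.lower x₁ (P.rep x₀ x₁ x (P.untwist x₀ x z)) = P.lower x₁ (trivializationAt A.Model
    A.Fiber x₁ ⟨x, P.map x _⟩).2
  rw [rep, localRep_apply (φ := fun x => x) h.2.1]

/-- The prebundle structure on the image. -/
def imagePrebundle : VectorPrebundle ℝ P.ImageModel P.ImageFiber where
  pretrivializationAtlas := range P.imagePretriv
  pretrivialization_linear' := by
    rintro _ ⟨x₀, rfl⟩
    refine ⟨fun x hx => ?_⟩
    let L := (P.lower x₀ : A.Model →ₗ[ℝ] P.ImageModel) ∘ₗ ((trivializationAt A.Model A.Fiber x₀).linearEquivAt ℝ x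
      hx.1).toLinearMap ∘ₗ (LinearMap.range (P.map x)).subtype
    exact ⟨L.map_add, L.map_smul⟩
  pretrivializationAt := P.imagePretriv
  mem_base_pretrivializationAt := P.mem_dom
  pretrivialization_mem_atlas x := ⟨x, rfl⟩
  exists_coordChange := by
    rintro _ ⟨x₀, rfl⟩ _ ⟨x₁, rfl⟩
    exact ⟨P.imageCoord x₀ x₁, (P.contMDiffOn_imageCoord x₀ x₁).continuousOn,
      fun x hx z => P.imageCoord_apply hx z⟩
  totalSpaceMk_isInducing x := by
    let E := (trivializationAt A.Model A.Fiber x).continuousLinearEquivAt ℝ x (mem_nbhd x)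
    have h1 : IsInducing (fun a : P.ImageFiber x => E (a : A.Fiber x)) :=
      E.toHomeomorph.isInducing.comp IsInducing.subtypeVal
    have h2 : (P.imagePretriv x ∘ TotalSpace.mk x) = fun a : P.ImageFiber x =>
        (x, P.lower x (E (a : A.Fiber x))) := rfl
    have h3 : Continuous (fun a : P.ImageFiber x => (x, P.lower x (E (a : A.Fiber x)))) :=
      continuous_const.prodMk ((P.lower x).continuous.comp h1.continuous)
    rw [h2]
    -- Applying `raise` to the coordinate recovers the `A`-coordinate of a vector of the image, so
    -- the trivialization induces the subspace topology on the fiber.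
    refine IsInducing.of_comp h3 ((P.raise x).continuous.comp continuous_snd) ?_
    convert h1 using 2 with a
    change P.raise x (P.lower x (E (a : A.Fiber x))) = E (a : A.Fiber x)
    rw [raise_lower]
    exact P.rep_coord (mem_nbhd x) a

instance : P.imagePrebundle.IsContMDiff IB ∞ where
  exists_contMDiffCoordChange := by
    rintro _ ⟨x₀, rfl⟩ _ ⟨x₁, rfl⟩
    exact ⟨P.imageCoord x₀ x₁, P.contMDiffOn_imageCoord x₀ x₁, fun x hx z => P.imageCoord_apply hx z⟩

/-- The image of a smooth projection of constant rank is a smooth vector bundle. -/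
def image : SmoothVectorBundle.{u, v} IB B where
  Model := P.ImageModel
  Fiber := P.ImageFiber
  totalTopologicalSpace := P.imagePrebundle.totalSpaceTopology
  fiberBundle := P.imagePrebundle.toFiberBundle
  vectorBundle := P.imagePrebundle.toVectorBundle
  contMDiffVectorBundle := P.imagePrebundle.contMDiffVectorBundle IB

/-- The fiberwise inclusion of the image bundle. -/
def inclₗ (x : B) : P.image.Fiber x →ₗ[ℝ] A.Fiber x := (LinearMap.range (P.map x)).subtype

/-- The fiberwise projection to the image bundle. -/
def projₗ (x : B) : A.Fiber x →ₗ[ℝ] P.image.Fiber x := P.toImage x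

@[simp] theorem incl_projₗ (x : B) (a : A.Fiber x) : P.inclₗ x (P.projₗ x a) = P.map x a := rfl

@[simp] theorem proj_inclₗ (x : B) (a : P.image.Fiber x) : P.projₗ x (P.inclₗ x a) = a :=
  P.toImage_coe x a

@[simp] theorem map_inclₗ (x : B) (a : P.image.Fiber x) : P.map x (P.inclₗ x a) = P.inclₗ x a :=
  P.map_coe a

theorem inclₗ_injective (x : B) : Function.Injective (P.inclₗ x) :=
  Function.LeftInverse.injective (P.proj_inclₗ x)

/-- The inclusion of the image bundle. -/
def incl (p : P.image.Total) : A.Total := ⟨p.1, P.inclₗ p.1 p.2⟩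

/-- The projection to the image bundle. -/
def proj (p : A.Total) : P.image.Total := ⟨p.1, P.projₗ p.1 p.2⟩

theorem proj_incl (p : P.image.Total) : P.proj (P.incl p) = p :=
  congrArg (TotalSpace.mk p.1) (P.proj_inclₗ p.1 p.2)

theorem incl_injective : Function.Injective P.incl :=
  Function.LeftInverse.injective P.proj_incl

/-- In trivializations centered at `x` the projection reads `lower ∘ rep`; likewise the inclusion
below reads `rep ∘ untwist`. -/
theorem contMDiff_proj : ContMDiff A.model P.image.model ∞ P.proj := by
  refine contMDiff_of_localRep (A := A) (D := P.image) (φ := fun x => x) (Φ := P.projₗ)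
    contMDiff_id fun x => ?_
  have h : ContMDiffAt IB 𝓘(ℝ, A.Model →L[ℝ] P.ImageModel) ∞
      (fun y => (P.lower x).comp (P.rep x x y)) x :=
    contMDiffAt_const.clm_comp (P.contMDiffAt_rep (mem_nbhd x) (mem_nbhd x))
  refine h.congr_of_eventuallyEq ?_
  filter_upwards [(P.isOpen_dom x).mem_nhds (P.mem_dom x)] with y hy
  ext1 w
  have hy' : y ∈ (trivializationAt P.image.Model P.image.Fiber x).baseSet := hy
  refine (localRep_apply (D := P.image) (φ := fun x => x) hy' w).trans ?_
  exact congrArg (P.lower x) (localRep_apply (φ := fun x => x) (Φ := P.map) hy.1 w).symm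

theorem contMDiff_incl : ContMDiff P.image.model A.model ∞ P.incl := by
  refine contMDiff_of_localRep (A := P.image) (D := A) (φ := fun x => x) (Φ := P.inclₗ)
    contMDiff_id fun x => ?_
  have h : ContMDiffAt IB 𝓘(ℝ, P.ImageModel →L[ℝ] A.Model) ∞
      (fun y => (P.rep x x y).comp (P.untwist x y)) x :=
    (P.contMDiffAt_rep (mem_nbhd x) (mem_nbhd x)).clm_comp (P.contMDiffAt_untwist (P.mem_dom x))
  refine h.congr_of_eventuallyEq ?_
  filter_upwards [(P.isOpen_dom x).mem_nhds (P.mem_dom x)] with y hy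
  ext1 z
  have hy' : y ∈ (trivializationAt P.image.Model P.image.Fiber x).baseSet := hy
  refine (localRep_apply (A := P.image) (D := A) (φ := fun x => x) hy.1 z).trans ?_
  refine Eq.trans ?_ (localRep_apply (φ := fun x => x) (Φ := P.map) hy.1 (P.untwist x y z)).symm
  rw [Trivialization.symmₗ_apply _ hy']
  have h1 : (trivializationAt P.image.Model P.image.Fiber x).symm y z = P.projₗ y
      ((trivializationAt A.Model A.Fiber x).symmₗ ℝ y (P.untwist x y z)) :=
    P.imagePretriv_symm hy z
  rw [h1, incl_projₗ]

/-- The inclusion has the smooth left inverse `proj`. Every smoothness question about maps into the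
image bundle is thereby moved to `A`. -/
theorem contMDiffWithinAt_image_iff {EN HN N : Type*}
    [NormedAddCommGroup EN] [NormedSpace ℝ EN] [TopologicalSpace HN]
    {IN : ModelWithCorners ℝ EN HN} [TopologicalSpace N] [ChartedSpace HN N]
    {f : N → P.image.Total} {S : Set N} {x : N} :
    ContMDiffWithinAt IN P.image.model ∞ f S x ↔
      ContMDiffWithinAt IN A.model ∞ (fun x => P.incl (f x)) S x := by
  refine ⟨fun h => P.contMDiff_incl.contMDiffAt.comp_contMDiffWithinAt x h, fun h => ?_⟩
  have := P.contMDiff_proj.contMDiffAt.comp_contMDiffWithinAt x h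
  exact this.congr (fun y _ => (P.proj_incl (f y)).symm) (P.proj_incl (f x)).symm

theorem contMDiff_image_iff {EN HN N : Type*}
    [NormedAddCommGroup EN] [NormedSpace ℝ EN] [TopologicalSpace HN]
    {IN : ModelWithCorners ℝ EN HN} [TopologicalSpace N] [ChartedSpace HN N]
    {f : N → P.image.Total} :
    ContMDiff IN P.image.model ∞ f ↔ ContMDiff IN A.model ∞ (fun x => P.incl (f x)) :=
  ⟨fun h x => P.contMDiffWithinAt_image_iff.1 (h x),
    fun h x => P.contMDiffWithinAt_image_iff.2 (h x)⟩

end SmoothProjection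

end SmoothVectorBundle

/-! ### Smooth generalized inverses of vector bundle maps of constant rank -/

/-- Take for `i` a linear section of `T` over its range and for `j` a retraction onto that range,
both read in `ℝ ^ r`. -/
theorem exists_compress {X Y : Type*} [NormedAddCommGroup X] [NormedSpace ℝ X]
    [FiniteDimensional ℝ X] [NormedAddCommGroup Y] [NormedSpace ℝ Y] [FiniteDimensional ℝ Y]
    (T : X →L[ℝ] Y) {r : ℕ} (hr : Module.finrank ℝ (LinearMap.range (T : X →ₗ[ℝ] Y)) = r) :
    ∃ (i : (Fin r → ℝ) →L[ℝ] X) (j : Y →L[ℝ] (Fin r → ℝ)), j.comp (T.comp i) = 1 := by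
  let E : LinearMap.range (T : X →ₗ[ℝ] Y) ≃ₗ[ℝ] (Fin r → ℝ) :=
    LinearEquiv.ofFinrankEq _ _ (by simp [hr])
  obtain ⟨i, hi⟩ := (T : X →ₗ[ℝ] Y).rangeRestrict.exists_rightInverse_of_surjective
    (LinearMap.range_rangeRestrict _)
  obtain ⟨j, hj⟩ := (LinearMap.range (T : X →ₗ[ℝ] Y)).subtype.exists_leftInverse_of_injective
    (Submodule.ker_subtype _)
  refine ⟨LinearMap.toContinuousLinearMap (i ∘ₗ E.symm.toLinearMap),
    LinearMap.toContinuousLinearMap (E.toLinearMap ∘ₗ j), ?_⟩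
  ext1 z
  have h1 : ∀ w, T (i w) = w := fun w => congrArg Subtype.val (LinearMap.congr_fun hi w)
  have h2 : ∀ w : LinearMap.range (T : X →ₗ[ℝ] Y), j w = w := fun w => LinearMap.congr_fun hj w
  simp [h1, h2]

/-- This is where the exact rank enters. Since `j ∘ T ∘ i` is onto `ℝ ^ r`, the range of `T ∘ i` has
dimension at least `r`, so it is the whole range of `T`. It remains to check the identity on vectors
`T (i z)`, where it is cancellation. -/
theorem compress_inverse {X Y : Type*} [NormedAddCommGroup X] [NormedSpace ℝ X]
    [FiniteDimensional ℝ X] [NormedAddCommGroup Y] [NormedSpace ℝ Y] [FiniteDimensional ℝ Y]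
    (T : X →L[ℝ] Y) {r : ℕ} (hr : Module.finrank ℝ (LinearMap.range (T : X →ₗ[ℝ] Y)) = r)
    (i : (Fin r → ℝ) →L[ℝ] X) (j : Y →L[ℝ] (Fin r → ℝ)) (h : IsUnit (j.comp (T.comp i))) (w : X) :
    T (i (Ring.inverse (j.comp (T.comp i)) (j (T w)))) = T w := by
  set S := Ring.inverse (j.comp (T.comp i)) with hS
  have h1 : ∀ z, j (T (i (S z))) = z := fun z =>
    congrArg (fun R : (Fin r → ℝ) →L[ℝ] (Fin r → ℝ) => R z) (Ring.mul_inverse_cancel _ h)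
  let R : Submodule ℝ Y := LinearMap.range ((T : X →ₗ[ℝ] Y) ∘ₗ (i : (Fin r → ℝ) →ₗ[ℝ] X))
  have h2 : R = LinearMap.range (T : X →ₗ[ℝ] Y) := by
    refine Submodule.eq_of_le_of_finrank_le ?_ ?_
    · rintro _ ⟨z, rfl⟩
      exact ⟨i z, rfl⟩
    · have h3 : R.map (j : Y →ₗ[ℝ] (Fin r → ℝ)) = ⊤ := by
        rw [eq_top_iff]
        intro z _
        exact ⟨T (i (S z)), ⟨S z, rfl⟩, h1 z⟩
      have h4 := Submodule.finrank_map_le (j : Y →ₗ[ℝ] (Fin r → ℝ)) R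
      rw [h3, finrank_top, Module.finrank_fin_fun] at h4
      rwa [hr]
  have h3 : T w ∈ R := by rw [h2]; exact ⟨w, rfl⟩
  obtain ⟨z, hz⟩ := h3
  have hz' : T (i z) = T w := hz
  have h4 : S (j (T (i z))) = z :=
    congrArg (fun R : (Fin r → ℝ) →L[ℝ] (Fin r → ℝ) => R z) (Ring.inverse_mul_cancel _ h)
  rw [← hz', h4]

namespace SmoothVectorBundle

section Pullback

variable {EB HB : Type*} [NormedAddCommGroup EB] [NormedSpace ℝ EB] [TopologicalSpace HB]
  {IB : ModelWithCorners ℝ EB HB} {B : Type*} [TopologicalSpace B] [ChartedSpace HB B]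
  {EN HN : Type*} [NormedAddCommGroup EN] [NormedSpace ℝ EN] [TopologicalSpace HN]
  {IN : ModelWithCorners ℝ EN HN} {N : Type u} [TopologicalSpace N] [ChartedSpace HN N]

/-- The pullback of a vector bundle along a smooth map. -/
def pullback (A : SmoothVectorBundle.{_, v} IB B) (f : C^∞⟮IN, N; IB, B⟯) :
    SmoothVectorBundle.{u, v} IN N where
  Model := A.Model
  Fiber := f *ᵖ A.Fiber
  addCommGroup x := A.addCommGroup (f x)
  module x := A.module (f x)
  vectorBundle := VectorBundle.pullback (F := A.Model) (E := A.Fiber) ℝ f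
  contMDiffVectorBundle := ContMDiffVectorBundle.pullback A.Model A.Fiber IN f

/-- The fiber of the pullback, as a fiber of the original bundle. -/
def pullbackEquiv (A : SmoothVectorBundle.{_, v} IB B) (f : C^∞⟮IN, N; IB, B⟯) (x : N) :
    (A.pullback f).Fiber x ≃ₗ[ℝ] A.Fiber (f x) := LinearEquiv.refl ℝ (A.Fiber (f x))

/-- The trivialization of the pullback at `x` is that of `A` at `f x`, so in coordinates this map is
the identity. -/
theorem contMDiff_pullbackEquiv (A : SmoothVectorBundle.{_, v} IB B) (f : C^∞⟮IN, N; IB, B⟯) :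
    ContMDiff (A.pullback f).model A.model ∞
      (fun p : (A.pullback f).Total => (⟨f p.1, A.pullbackEquiv f p.1 p.2⟩ : A.Total)) := by
  refine contMDiff_of_localRep (A := A.pullback f) (D := A) (φ := f)
    (Φ := fun x => (A.pullbackEquiv f x).toLinearMap) f.contMDiff fun x => ?_
  have h : ContMDiffAt IN 𝓘(ℝ, A.Model →L[ℝ] A.Model) ∞
      (fun _ : N => ContinuousLinearMap.id ℝ A.Model) x := contMDiffAt_const
  refine h.congr_of_eventuallyEq ?_
  filter_upwards [f.contMDiff.continuous.continuousAt.preimage_mem_nhds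
    ((trivializationAt A.Model A.Fiber (f x)).open_baseSet.mem_nhds
      (FiberBundle.mem_baseSet_trivializationAt' (f x)))] with y hy
  ext1 w
  have hy' : y ∈ (trivializationAt (A.pullback f).Model (A.pullback f).Fiber x).baseSet := hy
  refine (localRep_apply (A := A.pullback f) (D := A) (φ := f) hy w).trans ?_
  have := (trivializationAt (A.pullback f).Model (A.pullback f).Fiber x).linearMapAt_symmₗ
    (R := ℝ) hy' w
  rwa [Trivialization.linearMapAt_apply, if_pos hy'] at this

end Pullback

variable {EM HM : Type*} [NormedAddCommGroup EM] [NormedSpace ℝ EM] [TopologicalSpace HM]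
  {IM : ModelWithCorners ℝ EM HM} {M : Type u} [TopologicalSpace M] [ChartedSpace HM M]

section GenInverse

variable {A D : SmoothVectorBundle.{u, v} IM M} {T : ∀ x, A.Fiber x →ₗ[ℝ] D.Fiber x}

/-- The trivialization of `A` at `x₀` read in the fiber at `x`. -/
abbrev triv (A : SmoothVectorBundle.{u, v} IM M) (x₀ x : M) : A.Fiber x →ₗ[ℝ] A.Model :=
  (trivializationAt A.Model A.Fiber x₀).linearMapAt ℝ x

/-- The inverse trivialization of `A` at `x₀` read in the fiber at `x`. -/
abbrev trivSymm (A : SmoothVectorBundle.{u, v} IM M) (x₀ x : M) : A.Model →ₗ[ℝ] A.Fiber x :=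
  (trivializationAt A.Model A.Fiber x₀).symmₗ ℝ x

/-- The base set of the preferred trivialization at a point. -/
abbrev trivBase (A : SmoothVectorBundle.{u, v} IM M) (x₀ : M) : Set M :=
  (trivializationAt A.Model A.Fiber x₀).baseSet

theorem trivSymm_triv {x₀ x : M} (h : x ∈ trivBase A x₀) (a : A.Fiber x) :
    trivSymm A x₀ x (triv A x₀ x a) = a :=
  (trivializationAt A.Model A.Fiber x₀).symmₗ_linearMapAt h a

theorem mem_trivBase (A : SmoothVectorBundle.{u, v} IM M) (x : M) : x ∈ trivBase A x :=
  FiberBundle.mem_baseSet_trivializationAt' x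

theorem localRep_eq (T : ∀ x, A.Fiber x →ₗ[ℝ] D.Fiber x) (x₀ x₁ x : M) (w : A.Model) :
    localRep (φ := fun x => x) T x₀ x₁ x w = triv D x₁ x (T x (trivSymm A x₀ x w)) := rfl

theorem finrank_fiber (A : SmoothVectorBundle.{u, v} IM M) (x : M) :
    Module.finrank ℝ (A.Fiber x) = Module.finrank ℝ A.Model :=
  ((trivializationAt A.Model A.Fiber x).linearEquivAt ℝ x (mem_trivBase A x)).finrank_eq

instance (A : SmoothVectorBundle.{u, v} IM M) (x : M) : FiniteDimensional ℝ (A.Fiber x) :=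
  ((trivializationAt A.Model A.Fiber x).linearEquivAt ℝ x (mem_trivBase A x)).symm.finiteDimensional

theorem finrank_range_localRep {x₀ x₁ x : M} (h₀ : x ∈ trivBase A x₀) (h₁ : x ∈ trivBase D x₁) :
    Module.finrank ℝ (LinearMap.range
      (localRep (φ := fun x => x) T x₀ x₁ x : A.Model →ₗ[ℝ] D.Model)) =
      Module.finrank ℝ (LinearMap.range (T x)) := by
  let e := (trivializationAt A.Model A.Fiber x₀).linearEquivAt ℝ x h₀
  let e' := (trivializationAt D.Model D.Fiber x₁).linearEquivAt ℝ x h₁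
  have h : (localRep (φ := fun x => x) T x₀ x₁ x : A.Model →ₗ[ℝ] D.Model) =
      e'.toLinearMap ∘ₗ T x ∘ₗ e.symm.toLinearMap := by
    ext w
    obtain ⟨a, rfl⟩ := e.surjective w
    have := localRep_apply_coord (φ := fun x => x) (Φ := T) h₀ h₁ a
    simp only [ContinuousLinearMap.coe_coe, LinearMap.coe_comp, LinearEquiv.coe_coe,
      Function.comp_apply, LinearEquiv.symm_apply_apply]
    exact this
  rw [h, LinearMap.range_comp, LinearMap.range_comp, LinearEquiv.range, Submodule.map_top,
    LinearEquiv.finrank_map_eq]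

/-- Compress `T` to an `r × r` block which is the identity at `x₀`. The block stays invertible
nearby, and constancy of the rank turns its inverse into a generalized inverse of `T`. -/
theorem exists_local_genInverse
    (hT : ContMDiff A.model D.model ∞ (fun p : A.Total => (⟨p.1, T p.1 p.2⟩ : D.Total)))
    {r : ℕ} (hr : ∀ x, Module.finrank ℝ (LinearMap.range (T x)) = r) (x₀ : M) :
    ∃ (U : Set M) (S : M → (D.Model →L[ℝ] A.Model)), IsOpen U ∧ x₀ ∈ U ∧
      U ⊆ trivBase A x₀ ∩ trivBase D x₀ ∧
      (∀ x ∈ U, ContMDiffAt IM 𝓘(ℝ, D.Model →L[ℝ] A.Model) ∞ S x) ∧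
      ∀ x ∈ U, ∀ a, T x (trivSymm A x₀ x (S x (triv D x₀ x (T x a)))) = T x a := by
  let Q : M → (A.Model →L[ℝ] D.Model) := localRep (φ := fun x => x) T x₀ x₀
  obtain ⟨i, j, hij⟩ := exists_compress (Q x₀)
    ((finrank_range_localRep (mem_trivBase A x₀) (mem_trivBase D x₀)).trans (hr x₀))
  let W : Set M := trivBase A x₀ ∩ trivBase D x₀
  have hW : IsOpen W := (trivializationAt A.Model A.Fiber x₀).open_baseSet.inter
    (trivializationAt D.Model D.Fiber x₀).open_baseSet
  let R : M → ((Fin r → ℝ) →L[ℝ] (Fin r → ℝ)) := fun x => j.comp ((Q x).comp i)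
  have hR : ∀ x ∈ W, ContMDiffAt IM 𝓘(ℝ, (Fin r → ℝ) →L[ℝ] (Fin r → ℝ)) ∞ R x := fun x hx =>
    contMDiffAt_const.clm_comp
      ((contMDiffAt_localRep contMDiff_id hT hx.1 hx.2).clm_comp contMDiffAt_const)
  -- In coordinates `S = i (j T i)⁻¹ j`. `Ring.inverse` is zero on non-units, so `S` is defined
  -- everywhere but meaningful only where the block is invertible.
  refine ⟨W ∩ {x | IsUnit (R x)}, fun x => i.comp ((Ring.inverse (R x)).comp j), ?_, ?_, ?_, ?_, ?_⟩
  · have h : ContinuousOn R W := fun x hx => (hR x hx).continuousAt.continuousWithinAt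
    exact h.isOpen_inter_preimage hW Units.isOpen
  · refine ⟨⟨mem_trivBase A x₀, mem_trivBase D x₀⟩, ?_⟩
    change IsUnit (j.comp ((Q x₀).comp i))
    rw [hij]
    exact isUnit_one
  · exact inter_subset_left
  · intro x hx
    exact contMDiffAt_const.clm_comp
      ((contMDiffAt_ringInverse (hR x hx.1) hx.2).clm_comp contMDiffAt_const)
  · rintro x ⟨⟨hA, hD⟩, hU⟩ a
    have h := compress_inverse (Q x) ((finrank_range_localRep hA hD).trans (hr x)) i j hU
      (triv A x₀ x a)
    simp only [Q, localRep_eq, trivSymm_triv hA] at h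
    have h2 := congrArg (trivSymm D x₀ x) h
    rw [trivSymm_triv hD, trivSymm_triv hD] at h2
    exact h2

variable [FiniteDimensional ℝ EM] [IsManifold IM ∞ M] [T2Space M] [SigmaCompactSpace M]

/-- A smooth vector bundle map of constant rank has a smooth generalized inverse. -/
theorem exists_genInverse
    (hT : ContMDiff A.model D.model ∞ (fun p : A.Total => (⟨p.1, T p.1 p.2⟩ : D.Total)))
    {r : ℕ} (hr : ∀ x, Module.finrank ℝ (LinearMap.range (T x)) = r) :
    ∃ S : ∀ x, D.Fiber x →ₗ[ℝ] A.Fiber x,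
      ContMDiff D.model A.model ∞ (fun p : D.Total => (⟨p.1, S p.1 p.2⟩ : A.Total)) ∧
      ∀ x a, T x (S x (T x a)) = T x a := by
  choose U S hU hmem hsub hS hinv using exists_local_genInverse hT hr
  obtain ⟨ρ, hρ⟩ := SmoothPartitionOfUnity.exists_isSubordinate IM isClosed_univ U hU
    (fun x _ => mem_iUnion.2 ⟨x, hmem x⟩)
  -- The local solutions, transported to the fibers. Averaging them preserves `T S T = T`, because
  -- the identity is affine in `S` and the weights sum to one.
  let K : M → ∀ x, D.Fiber x →ₗ[ℝ] A.Fiber x := fun x₀ x =>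
    trivSymm A x₀ x ∘ₗ (S x₀ x : D.Model →ₗ[ℝ] A.Model) ∘ₗ triv D x₀ x
  refine ⟨fun x => ∑ i ∈ ρ.finsupport x, ρ i x • K i x, ?_, fun x a => ?_⟩
  · refine contMDiff_of_localRep (A := D) (D := A) (φ := fun x => x) (Φ := fun x =>
      ∑ i ∈ ρ.finsupport x, ρ i x • K i x) contMDiff_id fun x₀ => ?_
    -- The finite sum has an index set that varies with `x`; as a `finsum` it becomes a locally
    -- finite sum, to which the smoothness criterion of the partition of unity applies.
    have h1 : localRep (A := D) (D := A) (φ := fun x => x) (fun x =>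
        ∑ i ∈ ρ.finsupport x, ρ i x • K i x) x₀ x₀ =
        fun x => ∑ᶠ i, ρ i x • localRep (A := D) (D := A) (φ := fun x => x) (K i) x₀ x₀ x := by
      funext x
      rw [← ρ.sum_finsupport_smul_eq_finsum x
        (fun i x => localRep (A := D) (D := A) (φ := fun x => x) (K i) x₀ x₀ x)]
      ext1 w
      rw [localRep_eq]
      simp only [LinearMap.sum_apply, LinearMap.smul_apply, map_sum, map_smul,
        sum_apply, smul_apply, localRep_eq]
    change ContMDiffAt _ _ _ (localRep (A := D) (D := A) (φ := fun x => x) (fun x =>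
        ∑ i ∈ ρ.finsupport x, ρ i x • K i x) x₀ x₀) x₀
    rw [h1]
    refine ρ.contMDiffAt_finsum fun i hi => ?_
    have hx₀ : x₀ ∈ U i := hρ i hi
    -- The identity map read in two trivializations is their transition function. The map `K i` read
    -- at `x₀` is `S i` between two of these.
    have hid : ∀ C : SmoothVectorBundle.{u, v} IM M, ∀ y z : M, ∀ x ∈ trivBase C y ∩ trivBase C z,
        ContMDiffAt IM 𝓘(ℝ, C.Model →L[ℝ] C.Model) ∞ (localRep (A := C) (D := C)
          (φ := fun x => x) (fun _ => LinearMap.id) y z) x := fun C y z x hx =>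
      contMDiffAt_localRep contMDiff_id contMDiff_id hx.1 hx.2
    have h2 := (hid A i x₀ x₀ ⟨(hsub i hx₀).1, mem_trivBase A x₀⟩).clm_comp
      ((hS i x₀ hx₀).clm_comp (hid D x₀ i x₀ ⟨mem_trivBase D x₀, (hsub i hx₀).2⟩))
    exact h2
  · simp only [LinearMap.sum_apply, LinearMap.smul_apply, map_sum, map_smul]
    have h1 : ∀ i ∈ ρ.finsupport x, ρ i x • T x (K i x (T x a)) = ρ i x • T x a := by
      intro i hi
      have hx : x ∈ U i := hρ i (subset_closure (by simpa using hi))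
      rw [show T x (K i x (T x a)) = T x a from hinv i x hx a]
    rw [Finset.sum_congr rfl h1, ← Finset.sum_smul, ρ.sum_finsupport x (mem_univ x), one_smul]

end GenInverse

end SmoothVectorBundle

/-! ### Homotopy equivalences of two-term complexes -/

section TwoTerm

open CategoryTheory HomologicalComplex

variable {K₀ K₁ L₀ L₁ : ModuleCat.{v} ℝ} (d : K₀ ⟶ K₁) (d' : L₀ ⟶ L₁)

/-- The two-term cochain complex of a linear map, in degrees `0` and `1`. -/
abbrev twoTerm : CochainComplex (ModuleCat.{v} ℝ) ℤ :=
  HomologicalComplex.double (c := ComplexShape.up ℤ) (i₀ := 0) (i₁ := 1) d (by simp)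

variable {d d'} in
/-- A morphism of two-term complexes. -/
def twoTermMap (f₀ : K₀ ⟶ L₀) (f₁ : K₁ ⟶ L₁) (comm : f₀ ≫ d' = d ≫ f₁) :
    twoTerm d ⟶ twoTerm d' :=
  mkHomFromDouble _ (by simp) (f₀ ≫ (doubleXIso₀ d' _).inv)
    (f₁ ≫ (doubleXIso₁ d' _ (by simp)).inv)
    (by rw [double_d _ _ (by simp)]; simp [reassoc_of% comm])
    (fun k _ => by rw [double_d_eq_zero₀ _ _ _ _ (by simp), Limits.comp_zero])

variable {d} in
/-- The homotopy operator of a map from degree `1` to degree `0`. -/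
def twoTermHomotopy (h : K₁ ⟶ K₀) (i j : ℤ) (_ : (ComplexShape.up ℤ).Rel j i) :
    (twoTerm d).X i ⟶ (twoTerm d).X j :=
  if hij : i = 1 ∧ j = 0 then
    eqToHom (by rw [hij.1]) ≫ (doubleXIso₁ d _ (by simp)).hom ≫ h ≫ (doubleXIso₀ d _).inv ≫
      eqToHom (by rw [hij.2])
  else 0

/-- A homotopy equivalence of two-term complexes which is strictly inverted on one side is a
quasi-isomorphism. -/
theorem quasiIsomorphic_twoTerm (f₀ : K₀ ⟶ L₀) (f₁ : K₁ ⟶ L₁) (g₀ : L₀ ⟶ K₀) (g₁ : L₁ ⟶ K₁)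
    (h : K₁ ⟶ K₀) (hf : f₀ ≫ d' = d ≫ f₁) (hg : g₀ ≫ d = d' ≫ g₁)
    (gf₀ : g₀ ≫ f₀ = 𝟙 _) (gf₁ : g₁ ≫ f₁ = 𝟙 _)
    (h₀ : d ≫ h = f₀ ≫ g₀ - 𝟙 _) (h₁ : h ≫ d = f₁ ≫ g₁ - 𝟙 _) :
    QuasiIsomorphic (twoTerm d) (twoTerm d') := by
  let F := twoTermMap f₀ f₁ hf
  let H := twoTermMap g₀ g₁ hg
  have r01 : (ComplexShape.up ℤ).Rel 0 1 := by simp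
  -- The only nonzero component of the homotopy is `h`, so its boundary is `d ≫ h` in degree `0` and
  -- `h ≫ d` in degree `1`.
  have key : F ≫ H - 𝟙 _ = Homotopy.nullHomotopicMap' (twoTermHomotopy (d := d) h) := by
    apply from_double_hom_ext
    · rw [Homotopy.nullHomotopicMap'_f (k₂ := -1) (k₁ := 0) (k₀ := 1) (by simp) (by simp),
        double_d _ _ (by simp), double_d_eq_zero₀ _ _ _ _ (by simp), Limits.comp_zero, add_zero]
      simp only [F, H, twoTermMap, twoTermHomotopy, sub_f_apply, comp_f, id_f,
        mkHomFromDouble_f₀]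
      simp [reassoc_of% h₀]
    · rw [Homotopy.nullHomotopicMap'_f (k₂ := 0) (k₁ := 1) (k₀ := 2) (by simp) (by simp),
        double_d _ _ (by simp), double_d_eq_zero₀ _ _ _ _ (by simp), Limits.zero_comp, zero_add]
      simp only [F, H, twoTermMap, twoTermHomotopy, sub_f_apply, comp_f, id_f,
        mkHomFromDouble_f₁]
      simp [reassoc_of% h₁]
  have key' : H ≫ F = 𝟙 _ := by
    apply from_double_hom_ext
    · simp only [F, H, twoTermMap, comp_f, id_f, mkHomFromDouble_f₀]
      simp [reassoc_of% gf₀]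
    · simp only [F, H, twoTermMap, comp_f, id_f, mkHomFromDouble_f₁]
      simp [reassoc_of% gf₁]
  let E : HomotopyEquiv (twoTerm d) (twoTerm d') :=
    { hom := F
      inv := H
      homotopyHomInvId := (Homotopy.equivSubZero).symm
        ((Homotopy.ofEq key).trans (Homotopy.nullHomotopy' _))
      homotopyInvHomId := Homotopy.ofEq key' }
  exact ⟨F, E.quasiIso_hom⟩

end TwoTerm

/-! ### Morphisms of VB-groupoids and the cochain maps they induce. -/

section VBGroupoidMorphisms

variable {EG HG EM HM : Type*}
  [NormedAddCommGroup EG] [NormedSpace ℝ EG] [TopologicalSpace HG]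
  [NormedAddCommGroup EM] [NormedSpace ℝ EM] [TopologicalSpace HM]
  {IG : ModelWithCorners ℝ EG HG} {IM : ModelWithCorners ℝ EM HM}
  {G M : Type u} [TopologicalSpace G] [ChartedSpace HG G] [TopologicalSpace M] [ChartedSpace HM M]
  {𝒢 : LieGroupoid IG IM G M}

/-- Uniqueness of inverses. It makes compatibility with inversion a consequence of compatibility
with products and units, so that morphisms need not record it. -/
theorem IsLieGroupoid.eq_inv {G' M' : Type*} [TopologicalSpace G'] [ChartedSpace HG G']
    [TopologicalSpace M'] [ChartedSpace HM M'] {𝓗 : GroupoidMaps G' M'}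
    (h : IsLieGroupoid IG IM 𝓗) {a b : G'} (hs : 𝓗.src a = 𝓗.tgt b)
    (hab : 𝓗.mul a b = 𝓗.one (𝓗.src b)) : a = 𝓗.inv b := by
  have h1 := h.mul_assoc a b (𝓗.inv b) hs (h.tgt_inv b).symm
  rw [hab, h.mul_inv, ← hs, h.mul_one, ← h.tgt_inv, h.one_mul] at h1
  exact h1.symm

namespace VBGroupoid

/-- A morphism of VB-groupoids over the identity of `𝒢`. -/
structure Hom (V W : VBGroupoid.{u, v} 𝒢) where
  top : ∀ g, V.top.Fiber g →ₗ[ℝ] W.top.Fiber g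
  side : ∀ x, V.side.Fiber x →ₗ[ℝ] W.side.Fiber x
  contMDiff_top : ContMDiff V.top.model W.top.model ∞
    (fun p : V.top.Total => (⟨p.1, top p.1 p.2⟩ : W.top.Total))
  contMDiff_side : ContMDiff V.side.model W.side.model ∞
    (fun p : V.side.Total => (⟨p.1, side p.1 p.2⟩ : W.side.Total))
  map_src : ∀ g v, side _ (V.src g v) = W.src g (top g v)
  map_tgt : ∀ g v, side _ (V.tgt g v) = W.tgt g (top g v)
  map_one : ∀ x e, top _ (V.one x e) = W.one x (side x e)
  map_mul : ∀ g h v w, V.total.src ⟨g, v⟩ = V.total.tgt ⟨h, w⟩ →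
    top _ (V.mul g h v w) = W.mul g h (top g v) (top h w)

namespace Hom

variable {V W X : VBGroupoid.{u, v} 𝒢} (φ : Hom V W)

/-- The map of total spaces of arrows. -/
def topTotal (p : V.top.Total) : W.top.Total := ⟨p.1, φ.top p.1 p.2⟩

/-- The map of total spaces of objects. -/
def sideTotal (p : V.side.Total) : W.side.Total := ⟨p.1, φ.side p.1 p.2⟩

/-- Compatibilities are restated on total spaces, where arrows over base points that are only
propositionally equal can be compared without transport. -/
theorem src_topTotal (p : V.top.Total) : W.total.src (φ.topTotal p) = φ.sideTotal (V.total.src p) :=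
  congrArg (TotalSpace.mk _) (φ.map_src p.1 p.2).symm

theorem tgt_topTotal (p : V.top.Total) : W.total.tgt (φ.topTotal p) = φ.sideTotal (V.total.tgt p) :=
  congrArg (TotalSpace.mk _) (φ.map_tgt p.1 p.2).symm

theorem topTotal_one (p : V.side.Total) :
    φ.topTotal (V.total.one p) = W.total.one (φ.sideTotal p) :=
  congrArg (TotalSpace.mk _) (φ.map_one p.1 p.2)

theorem topTotal_mul {p q : V.top.Total} (h : V.total.src p = V.total.tgt q) :
    φ.topTotal (V.total.mul p q) = W.total.mul (φ.topTotal p) (φ.topTotal q) :=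
  congrArg (TotalSpace.mk _) (φ.map_mul p.1 q.1 p.2 q.2 h)

theorem topTotal_inv (p : V.top.Total) :
    φ.topTotal (V.total.inv p) = W.total.inv (φ.topTotal p) := by
  apply W.isLie.eq_inv
  · rw [src_topTotal, tgt_topTotal, V.isLie.src_inv]
  · rw [← topTotal_mul _ (V.isLie.src_inv p), V.isLie.inv_mul, topTotal_one, src_topTotal]

/-- Composition of morphisms. -/
def comp (ψ : Hom W X) (φ : Hom V W) : Hom V X where
  top g := ψ.top g ∘ₗ φ.top g
  side x := ψ.side x ∘ₗ φ.side x
  contMDiff_top := ψ.contMDiff_top.comp φ.contMDiff_top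
  contMDiff_side := ψ.contMDiff_side.comp φ.contMDiff_side
  map_src g v := by simp [map_src]
  map_tgt g v := by simp [map_tgt]
  map_one g v := by simp [map_one]
  map_mul g h v w hvw := by
    have h1 : W.total.src (φ.topTotal ⟨g, v⟩) = W.total.tgt (φ.topTotal ⟨h, w⟩) := by
      rw [src_topTotal, tgt_topTotal, hvw]
    change ψ.top _ (φ.top _ _) = _
    rw [φ.map_mul _ _ _ _ hvw, ψ.map_mul _ _ _ _ h1]
    rfl

/-- The action of a morphism on sections of the core. -/
def mapCore : V.coreSections →ₗ[ℝ] W.coreSections where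
  toFun c := ⟨fun x => φ.top _ (c.1 x), φ.contMDiff_top.comp c.2.1, fun x => by
    change W.src _ (φ.top _ (c.1 x)) = 0
    have h : V.src _ (c.1 x) = 0 := c.2.2 x
    rw [← φ.map_src, h, map_zero]⟩
  map_add' c d := Subtype.ext (funext fun x => (φ.top _).map_add _ _)
  map_smul' a c := Subtype.ext (funext fun x => (φ.top _).map_smul _ _)

/-- The action of a morphism on multiplicative sections. -/
def mapMult : V.multSections →ₗ[ℝ] W.multSections where
  toFun p := ⟨(⟨fun g => φ.top g (p.1.1 g), φ.contMDiff_top.comp p.1.1.contMDiff⟩,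
      ⟨fun x => φ.side x (p.1.2 x), φ.contMDiff_side.comp p.1.2.contMDiff⟩), by
    obtain ⟨⟨s, e⟩, h1, h2, h3, h4⟩ := p
    refine ⟨fun g => ?_, fun g => ?_, fun x => ?_, fun g h hgh => ?_⟩
    · change W.src g (φ.top g (s g)) = φ.side _ (e _)
      rw [← map_src, h1]
    · change W.tgt g (φ.top g (s g)) = φ.side _ (e _)
      rw [← map_tgt, h2]
    · change W.one x (φ.side _ (e _)) = φ.top _ (s _)
      rw [← map_one, h3]
    · change φ.top _ (s _) = W.mul g h (φ.top g (s g)) (φ.top h (s h))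
      rw [h4 g h hgh, φ.map_mul]
      simpa only [VBGroupoidMaps.total, h1, h2] using V.side.mk_congr e hgh⟩
  map_add' p q := Subtype.ext (Prod.ext (ContMDiffSection.ext fun g => (φ.top g).map_add _ _)
    (ContMDiffSection.ext fun x => (φ.side x).map_add _ _))
  map_smul' a p := Subtype.ext (Prod.ext (ContMDiffSection.ext fun g => (φ.top g).map_smul _ _)
    (ContMDiffSection.ext fun x => (φ.side x).map_smul _ _))

theorem topTotal_zero (g : G) : φ.topTotal ⟨g, 0⟩ = ⟨g, 0⟩ :=
  congrArg (TotalSpace.mk _) (map_zero _)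

theorem rightInvariant_mapCore (c : V.coreSections) (g : G) :
    W.rightInvariant (φ.mapCore c).1 g = φ.top g (V.rightInvariant c.1 g) := by
  apply W.top.mk_inj
  have h := congrArg φ.topTotal (V.mk_rightInvariant c g)
  rw [topTotal_mul _ (V.comp_right c g), topTotal_zero] at h
  rw [mk_rightInvariant]
  exact h.symm

theorem leftInvariant_mapCore (c : V.coreSections) (g : G) :
    W.leftInvariant (φ.mapCore c).1 g = φ.top g (V.leftInvariant c.1 g) := by
  rw [← neg_inj, ← map_neg]
  apply W.top.mk_inj
  have h := congrArg φ.topTotal (V.mk_neg_leftInvariant c g)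
  rw [topTotal_mul _ (V.comp_left c g), topTotal_zero, topTotal_inv] at h
  rw [mk_neg_leftInvariant]
  exact h.symm

theorem anchor_mapCore (c : V.coreSections) (x : M) :
    W.coreAnchor x ⟨(φ.mapCore c).1 x, (φ.mapCore c).2.2 x⟩ =
      φ.side x (V.coreAnchor x ⟨c.1 x, c.2.2 x⟩) := by
  apply W.side.mk_inj
  have h := congrArg φ.sideTotal (V.tgt_core c x)
  rw [← tgt_topTotal] at h
  rw [← tgt_core]
  exact h

/-- A morphism preserves products, inverses and zero arrows, and `c^r`, `c^l` are built from these;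
so `mapCore` and `mapMult` form a cochain map. -/
theorem delta_mapCore (c : V.coreSections) : W.delta (φ.mapCore c) = φ.mapMult (V.delta c) := by
  refine Subtype.ext (Prod.ext (ContMDiffSection.ext fun g => ?_) (ContMDiffSection.ext fun x => ?_))
  · change W.rightInvariant _ g - W.leftInvariant _ g = φ.top g (V.rightInvariant c.1 g -
      V.leftInvariant c.1 g)
    rw [rightInvariant_mapCore, leftInvariant_mapCore, map_sub]
  · exact φ.anchor_mapCore c x

end Hom

section Sum

variable [IsManifold IG ∞ G] [IsManifold IM ∞ M]

/-- The projection of a direct sum to the first summand. -/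
def fstHom (V W : VBGroupoid.{u, v} 𝒢) : Hom (V.directSum W) V where
  top g := LinearMap.fst ℝ (V.top.Fiber g) (W.top.Fiber g)
  side x := LinearMap.fst ℝ (V.side.Fiber x) (W.side.Fiber x)
  contMDiff_top := SmoothVectorBundle.contMDiff_fst
  contMDiff_side := SmoothVectorBundle.contMDiff_fst
  map_src _ _ := rfl
  map_tgt _ _ := rfl
  map_one _ _ := rfl
  map_mul _ _ _ _ _ := rfl

/-- The projection of a direct sum to the second summand. -/
def sndHom (V W : VBGroupoid.{u, v} 𝒢) : Hom (V.directSum W) W where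
  top g := LinearMap.snd ℝ (V.top.Fiber g) (W.top.Fiber g)
  side x := LinearMap.snd ℝ (V.side.Fiber x) (W.side.Fiber x)
  contMDiff_top := SmoothVectorBundle.contMDiff_snd
  contMDiff_side := SmoothVectorBundle.contMDiff_snd
  map_src _ _ := rfl
  map_tgt _ _ := rfl
  map_one _ _ := rfl
  map_mul _ _ _ _ _ := rfl

theorem contMDiff_zero_fiber {EB HB : Type*} [NormedAddCommGroup EB] [NormedSpace ℝ EB]
    [TopologicalSpace HB] {IB : ModelWithCorners ℝ EB HB} {B : Type u} [TopologicalSpace B]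
    [ChartedSpace HB B] (A D : SmoothVectorBundle.{u, v} IB B) :
    ContMDiff A.model D.model ∞ (fun p : A.Total => (⟨p.1, 0⟩ : D.Total)) :=
  D.contMDiff_zero.comp (Bundle.contMDiff_proj A.Fiber)

/-- The inclusion of the first summand in a direct sum. -/
def inlHom (V W : VBGroupoid.{u, v} 𝒢) : Hom V (V.directSum W) where
  top g := LinearMap.inl ℝ (V.top.Fiber g) (W.top.Fiber g)
  side x := LinearMap.inl ℝ (V.side.Fiber x) (W.side.Fiber x)
  contMDiff_top := SmoothVectorBundle.contMDiff_prod_iff.2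
    ⟨contMDiff_id, contMDiff_zero_fiber V.top W.top⟩
  contMDiff_side := SmoothVectorBundle.contMDiff_prod_iff.2
    ⟨contMDiff_id, contMDiff_zero_fiber V.side W.side⟩
  map_src g _ := Prod.ext rfl (W.src g).map_zero.symm
  map_tgt g _ := Prod.ext rfl (W.tgt g).map_zero.symm
  map_one x _ := Prod.ext rfl (W.one x).map_zero.symm
  map_mul g h _ _ hvw := Prod.ext rfl
    (W.mul_zero_zero g h (congrArg TotalSpace.proj hvw)).symm

/-- The inclusion of the second summand in a direct sum. -/
def inrHom (V W : VBGroupoid.{u, v} 𝒢) : Hom W (V.directSum W) where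
  top g := LinearMap.inr ℝ (V.top.Fiber g) (W.top.Fiber g)
  side x := LinearMap.inr ℝ (V.side.Fiber x) (W.side.Fiber x)
  contMDiff_top := SmoothVectorBundle.contMDiff_prod_iff.2
    ⟨contMDiff_zero_fiber W.top V.top, contMDiff_id⟩
  contMDiff_side := SmoothVectorBundle.contMDiff_prod_iff.2
    ⟨contMDiff_zero_fiber W.side V.side, contMDiff_id⟩
  map_src g _ := Prod.ext (V.src g).map_zero.symm rfl
  map_tgt g _ := Prod.ext (V.tgt g).map_zero.symm rfl
  map_one x _ := Prod.ext (V.one x).map_zero.symm rfl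
  map_mul g h _ _ hvw := Prod.ext
    (V.mul_zero_zero g h (congrArg TotalSpace.proj hvw)).symm rfl

end Sum

namespace Iso

variable {V W : VBGroupoid.{u, v} 𝒢} (φ : Iso V W)

/-- The morphism underlying an isomorphism. -/
def toHom : Hom V W where
  top g := (φ.top g).toLinearMap
  side x := (φ.side x).toLinearMap
  contMDiff_top := φ.contMDiff_top
  contMDiff_side := φ.contMDiff_side
  map_src := φ.map_src
  map_tgt := φ.map_tgt
  map_one := φ.map_one
  map_mul := φ.map_mul

/-- The inverse morphism of an isomorphism. -/
def invHom : Hom W V where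
  top g := (φ.top g).symm.toLinearMap
  side x := (φ.side x).symm.toLinearMap
  contMDiff_top := φ.contMDiff_top_symm
  contMDiff_side := φ.contMDiff_side_symm
  map_src g v := (φ.side _).injective (by simp [φ.map_src])
  map_tgt g v := (φ.side _).injective (by simp [φ.map_tgt])
  map_one x e := (φ.top _).injective (by simp [φ.map_one])
  map_mul g h v w hvw := (φ.top _).injective (by
    -- Composability in `W` has to be pulled back to `V` before `map_mul` applies; injectivity on
    -- objects does this.
    have key : ∀ p q : V.side.Total, φ.toHom.sideTotal p = φ.toHom.sideTotal q → p = q := by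
      rintro ⟨x, a⟩ ⟨y, b⟩ hpq
      obtain rfl : x = y := congrArg TotalSpace.proj hpq
      exact congrArg _ ((φ.side x).injective (W.side.mk_inj hpq))
    have h2 : ∀ g v, φ.toHom.topTotal ⟨g, (φ.top g).symm v⟩ = ⟨g, v⟩ := fun g v =>
      congrArg (TotalSpace.mk g) ((φ.top g).apply_symm_apply v)
    have h1 : V.total.src ⟨g, (φ.top g).symm v⟩ = V.total.tgt ⟨h, (φ.top h).symm w⟩ := by
      apply key
      rw [← Hom.src_topTotal, ← Hom.tgt_topTotal, h2, h2, hvw]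
    simp [φ.map_mul _ _ _ _ h1])

end Iso

end VBGroupoid
end VBGroupoidMorphisms

/-! ### Splitting the core anchor, acyclicity in type one, and the quasi-isomorphism. -/

section CoreSplitting

variable {EG HG EM HM : Type*}
  [NormedAddCommGroup EG] [NormedSpace ℝ EG] [TopologicalSpace HG]
  [NormedAddCommGroup EM] [NormedSpace ℝ EM] [TopologicalSpace HM]
  {IG : ModelWithCorners ℝ EG HG} {IM : ModelWithCorners ℝ EM HM}
  {G M : Type u} [TopologicalSpace G] [ChartedSpace HG G] [TopologicalSpace M] [ChartedSpace HM M]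
  {𝒢 : LieGroupoid IG IM G M}

namespace VBGroupoid

/-- The target map over a unit. -/
def tgtOne (V : VBGroupoid.{u, v} 𝒢) (x : M) : V.top.Fiber (𝒢.one x) →ₗ[ℝ] V.side.Fiber x :=
  (V.side.fiberCast (𝒢.isLie.tgt_one x)).toLinearMap ∘ₗ V.tgt (𝒢.one x)

/-- The source map over a unit. -/
def srcOne (V : VBGroupoid.{u, v} 𝒢) (x : M) : V.top.Fiber (𝒢.one x) →ₗ[ℝ] V.side.Fiber x :=
  (V.side.fiberCast (𝒢.isLie.src_one x)).toLinearMap ∘ₗ V.src (𝒢.one x)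

variable (V : VBGroupoid.{u, v} 𝒢)

theorem coreAnchor_apply (x : M) (c : V.coreFiber x) : V.coreAnchor x c = V.tgtOne x c := rfl

theorem mk_tgtOne (x : M) (w : V.top.Fiber (𝒢.one x)) :
    (⟨x, V.tgtOne x w⟩ : V.side.Total) = V.total.tgt ⟨𝒢.one x, w⟩ := by
  simp [tgtOne, VBGroupoidMaps.total]

theorem mk_srcOne (x : M) (w : V.top.Fiber (𝒢.one x)) :
    (⟨x, V.srcOne x w⟩ : V.side.Total) = V.total.src ⟨𝒢.one x, w⟩ := by
  simp [srcOne, VBGroupoidMaps.total]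

theorem srcOne_eq_zero {x : M} {w : V.top.Fiber (𝒢.one x)} :
    V.srcOne x w = 0 ↔ V.src _ w = 0 := by
  simp [srcOne]

theorem tgtOne_one (x : M) (e : V.side.Fiber x) : V.tgtOne x (V.one x e) = e := by
  apply V.side.mk_inj
  rw [mk_tgtOne]
  exact V.isLie.tgt_one ⟨x, e⟩

theorem srcOne_one (x : M) (e : V.side.Fiber x) : V.srcOne x (V.one x e) = e := by
  apply V.side.mk_inj
  rw [mk_srcOne]
  exact V.isLie.src_one ⟨x, e⟩

/-- The projection of `V|_M` to the core along the units. -/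
def coreProj (x : M) : V.top.Fiber (𝒢.one x) →ₗ[ℝ] V.top.Fiber (𝒢.one x) :=
  LinearMap.id - V.one x ∘ₗ V.srcOne x

theorem src_coreProj (x : M) (w : V.top.Fiber (𝒢.one x)) : V.src _ (V.coreProj x w) = 0 := by
  rw [← srcOne_eq_zero]
  simp [coreProj, srcOne_one]

theorem tgtOne_coreProj (x : M) (w : V.top.Fiber (𝒢.one x)) :
    V.tgtOne x (V.coreProj x w) = V.tgtOne x w - V.srcOne x w := by
  simp [coreProj, tgtOne_one]

/-- Over the units `V` is the sum of the core and of the unit arrows; `t - s` is `∂` on the former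
and zero on the latter. The rank hypothesis thus passes to a map defined on a genuine bundle, the
restriction of `V` to `M`. -/
theorem range_coreAnchor (x : M) :
    LinearMap.range (V.coreAnchor x) = LinearMap.range (V.tgtOne x - V.srcOne x) := by
  apply le_antisymm
  · rintro _ ⟨c, rfl⟩
    have h : V.srcOne x c = 0 := V.srcOne_eq_zero.2 c.2
    exact ⟨c, by simp [coreAnchor_apply, h]⟩
  · rintro _ ⟨w, rfl⟩
    exact ⟨⟨V.coreProj x w, V.src_coreProj x w⟩, V.tgtOne_coreProj x w⟩

/-- The unit map as a smooth map. -/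
def unitMap (𝒢 : LieGroupoid IG IM G M) : C^∞⟮IM, M; IG, G⟯ := ⟨𝒢.one, 𝒢.isLie.contMDiff_one⟩

/-- The fiber of the restriction of `V` to the units. -/
def restrictEquiv (x : M) :
    (V.top.pullback (unitMap 𝒢)).Fiber x ≃ₗ[ℝ] V.top.Fiber (𝒢.one x) :=
  V.top.pullbackEquiv (unitMap 𝒢) x

theorem contMDiff_restrictEquiv : ContMDiff (V.top.pullback (unitMap 𝒢)).model V.top.model ∞
    (fun p : (V.top.pullback (unitMap 𝒢)).Total =>
      (⟨𝒢.one p.1, V.restrictEquiv p.1 p.2⟩ : V.top.Total)) :=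
  V.top.contMDiff_pullbackEquiv (unitMap 𝒢)

/-- The difference of target and source as a map on the restriction `V|_M`. -/
def unitDiff (x : M) : (V.top.pullback (unitMap 𝒢)).Fiber x →ₗ[ℝ] V.side.Fiber x :=
  (V.tgtOne x - V.srcOne x) ∘ₗ (V.restrictEquiv x).toLinearMap

theorem contMDiff_unitDiff : ContMDiff (V.top.pullback (unitMap 𝒢)).model V.side.model ∞
    (fun p : (V.top.pullback (unitMap 𝒢)).Total =>
      (⟨p.1, V.unitDiff p.1 p.2⟩ : V.side.Total)) := by
  have h := V.contMDiff_restrictEquiv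
  have h1 := V.isLie.contMDiff_tgt.comp h
  have h2 := V.isLie.contMDiff_src.comp h
  have h1' : ContMDiff (V.top.pullback (unitMap 𝒢)).model V.side.model ∞
      (fun p : (V.top.pullback (unitMap 𝒢)).Total =>
        (⟨p.1, V.tgtOne p.1 (V.restrictEquiv p.1 p.2)⟩ : V.side.Total)) :=
    h1.congr fun p => V.mk_tgtOne _ _
  have h2' : ContMDiff (V.top.pullback (unitMap 𝒢)).model V.side.model ∞
      (fun p : (V.top.pullback (unitMap 𝒢)).Total =>
        (⟨p.1, V.srcOne p.1 (V.restrictEquiv p.1 p.2)⟩ : V.side.Total)) :=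
    h2.congr fun p => V.mk_srcOne _ _
  have h3 := V.side.contMDiff_add h1' (V.side.contMDiff_smul (-1) h2')
  refine h3.congr fun p => ?_
  simp [unitDiff, sub_eq_add_neg]

/-- A smooth splitting of the core anchor map over its image, vanishing on a complement. -/
structure CoreSplitting where
  toFun : ∀ x, V.side.Fiber x →ₗ[ℝ] V.top.Fiber (𝒢.one x)
  smooth : ContMDiff V.side.model V.top.model ∞
    (fun p : V.side.Total => (⟨𝒢.one p.1, toFun p.1 p.2⟩ : V.top.Total))
  src_eq : ∀ x e, V.src _ (toFun x e) = 0
  -- These two identities make `σ` and `∂` generalized inverses of each other: `split` is `σ∂σ = σ`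
  -- and `anchor` is `∂σ∂ = ∂`, so `∂σ` is a projection onto `im ∂`.
  split : ∀ x e, toFun x (V.tgtOne x (toFun x e)) = toFun x e
  anchor : ∀ x w, V.src _ w = 0 → V.tgtOne x (toFun x (V.tgtOne x w)) = V.tgtOne x w

variable {V} in
/-- The core anchor map of a regular VB-groupoid admits a smooth splitting. -/
theorem IsRegular.nonempty_coreSplitting [FiniteDimensional ℝ EM] [IsManifold IM ∞ M] [T2Space M]
    [SigmaCompactSpace M] (hV : V.IsRegular) : Nonempty V.CoreSplitting := by
  obtain ⟨r, hr⟩ := hV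
  have hr' : ∀ x, Module.finrank ℝ (LinearMap.range (V.unitDiff x)) = r := fun x => by
    rw [unitDiff, LinearMap.range_comp, LinearEquiv.range, Submodule.map_top,
      ← range_coreAnchor, hr]
  obtain ⟨S, hS, hinv⟩ := SmoothVectorBundle.exists_genInverse V.contMDiff_unitDiff hr'
  let S' : ∀ x, V.side.Fiber x →ₗ[ℝ] V.top.Fiber (𝒢.one x) := fun x =>
    (V.restrictEquiv x).toLinearMap ∘ₗ S x
  have hS' : ContMDiff V.side.model V.top.model ∞
      (fun p : V.side.Total => (⟨𝒢.one p.1, S' p.1 p.2⟩ : V.top.Total)) :=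
    (V.contMDiff_restrictEquiv).comp hS
  have hinv' : ∀ x w, V.src _ w = 0 → V.tgtOne x (S' x (V.tgtOne x w)) -
      V.srcOne x (S' x (V.tgtOne x w)) = V.tgtOne x w := by
    intro x w hw
    have h1 := hinv x ((V.restrictEquiv x).symm w)
    have h2 : V.unitDiff x ((V.restrictEquiv x).symm w) = V.tgtOne x w := by
      simp [unitDiff, V.srcOne_eq_zero.2 hw]
    rw [h2] at h1
    exact h1
  -- The values of `S'` need not lie in the core. Projecting along the units leaves `t - s`
  -- unchanged and makes the source vanish.
  let R : ∀ x, V.side.Fiber x →ₗ[ℝ] V.top.Fiber (𝒢.one x) := fun x => V.coreProj x ∘ₗ S' x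
  have hR : ContMDiff V.side.model V.top.model ∞
      (fun p : V.side.Total => (⟨𝒢.one p.1, R p.1 p.2⟩ : V.top.Total)) := by
    have h1 : ContMDiff V.side.model V.top.model ∞ (fun p : V.side.Total =>
        (⟨𝒢.one p.1, V.one p.1 (V.srcOne p.1 (S' p.1 p.2))⟩ : V.top.Total)) :=
      (V.isLie.contMDiff_one.comp (V.isLie.contMDiff_src.comp hS')).congr fun p =>
        congrArg V.total.one (V.mk_srcOne _ _)
    refine (V.top.contMDiff_add hS' (V.top.contMDiff_smul (-1) h1)).congr fun p => ?_
    simp [R, coreProj, sub_eq_add_neg]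
  have hanchor : ∀ x w, V.src _ w = 0 → V.tgtOne x (R x (V.tgtOne x w)) = V.tgtOne x w := by
    intro x w hw
    change V.tgtOne x (V.coreProj x (S' x _)) = _
    rw [tgtOne_coreProj, hinv' x w hw]
  -- So far only `∂R∂ = ∂` holds. Replacing `R` by `R∂R` keeps this identity and gains `σ∂σ = σ`.
  refine ⟨⟨fun x => R x ∘ₗ V.tgtOne x ∘ₗ R x, ?_, fun x e => V.src_coreProj x _, fun x e => ?_,
    fun x w hw => ?_⟩⟩
  · refine (hR.comp (V.isLie.contMDiff_tgt.comp hR)).congr fun p => ?_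
    have := congrArg (fun p : V.side.Total => (⟨𝒢.one p.1, R p.1 p.2⟩ : V.top.Total))
      (V.mk_tgtOne p.1 (R p.1 p.2))
    exact this
  · simp only [LinearMap.comp_apply]
    rw [hanchor x (R x e) (V.src_coreProj x _), hanchor x (R x e) (V.src_coreProj x _)]
  · simp only [LinearMap.comp_apply]
    rw [hanchor x _ hw, hanchor x _ hw]

variable {V}

theorem IsTypeOne.isRegular (hV : V.IsTypeOne) : V.IsRegular := by
  refine ⟨Module.finrank ℝ V.side.Model, fun x => ?_⟩
  rw [LinearMap.range_eq_top.2 (hV x).2, finrank_top, SmoothVectorBundle.finrank_fiber]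

/-- In a VB-groupoid of type one, an arrow is determined by its source and target. -/
theorem IsTypeOne.eq_zero (hV : V.IsTypeOne) {g : G} {w : V.top.Fiber g} (hs : V.src g w = 0)
    (ht : V.tgt g w = 0) : w = 0 := by
  -- Over a unit this is injectivity of `∂`. The base point is constrained by an equation because
  -- the key is applied over `g · g⁻¹`, a unit only propositionally.
  have key : ∀ (x : M) (p : V.top.Total), p.1 = 𝒢.one x → V.total.src p = ⟨x, 0⟩ →
      V.total.tgt p = ⟨x, 0⟩ → p = ⟨𝒢.one x, 0⟩ := by
    rintro x ⟨_, p⟩ rfl h1 h2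
    rw [← mk_srcOne] at h1
    rw [← mk_tgtOne] at h2
    have h3 := V.srcOne_eq_zero.1 (V.side.mk_inj h1)
    have h4 : (⟨p, h3⟩ : V.coreFiber x) = 0 := (hV x).1 (by
      rw [map_zero]; exact V.side.mk_inj h2)
    exact congrArg _ (congrArg Subtype.val h4)
  have hs' : V.total.src ⟨g, w⟩ = ⟨𝒢.src g, 0⟩ := congrArg _ hs
  have ht' : V.total.tgt ⟨g, w⟩ = ⟨𝒢.tgt g, 0⟩ := congrArg _ ht
  have hc : V.total.src ⟨g, w⟩ = V.total.tgt (V.total.inv ⟨g, 0⟩) := by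
    rw [V.isLie.tgt_inv, src_zero, hs']
  -- Multiplication by the inverse of `0_g` moves `w` into the core, where it must be zero;
  -- multiplication by `0_g` moves it back.
  have h1 := key (𝒢.tgt g) (V.total.mul ⟨g, w⟩ (V.total.inv ⟨g, 0⟩)) (𝒢.isLie.mul_inv g)
    (by rw [V.isLie.src_mul _ _ hc, V.isLie.src_inv, tgt_zero])
    (by rw [V.isLie.tgt_mul _ _ hc, ht'])
  have h2 := congrArg (fun p => V.total.mul p ⟨g, 0⟩) h1
  rw [V.isLie.mul_assoc _ _ _ hc (V.isLie.src_inv _), V.isLie.inv_mul, src_zero, ← hs',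
    V.isLie.mul_one, total_mul_zero _ (𝒢.isLie.src_one _), 𝒢.isLie.one_mul] at h2
  exact V.top.mk_inj h2

/-- The complex of multiplicative sections of a VB-groupoid of type one is acyclic. -/
theorem IsTypeOne.delta_bijective [FiniteDimensional ℝ EM] [IsManifold IM ∞ M] [T2Space M]
    [SigmaCompactSpace M] (hV : V.IsTypeOne) : Function.Bijective V.delta := by
  constructor
  · rw [← LinearMap.ker_eq_bot, LinearMap.ker_eq_bot']
    intro c hc
    refine Subtype.ext (funext fun x => ?_)
    have h1 : V.coreAnchor x ⟨c.1 x, c.2.2 x⟩ = 0 :=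
      congrArg (fun p : V.multSections => p.1.2 x) hc
    exact congrArg Subtype.val ((hV x).1 (h1.trans (map_zero _).symm))
  · intro p
    obtain ⟨σ⟩ := hV.isRegular.nonempty_coreSplitting
    -- The only candidate is `c = ∂⁻¹e`, where `e` is the section covered by `p`; in type one `σ` is
    -- the inverse of `∂`, and it is smooth.
    let c : V.coreSections := ⟨fun x => σ.toFun x (p.1.2 x), σ.smooth.comp p.1.2.contMDiff,
      fun x => σ.src_eq x _⟩
    have h1 : ∀ x, (V.delta c).1.2 x = p.1.2 x := fun x => by
      obtain ⟨w, hw⟩ := (hV x).2 (p.1.2 x)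
      have := σ.anchor x w w.2
      rw [← coreAnchor_apply, hw] at this
      exact this
    refine ⟨c, Subtype.ext (Prod.ext (ContMDiffSection.ext fun g => ?_)
      (ContMDiffSection.ext h1))⟩
    -- Both sections cover `e`, so over each `g` their difference has zero source and target.
    rw [← sub_eq_zero]
    apply hV.eq_zero
    · rw [map_sub, (V.delta c).2.1, p.2.1, h1, sub_self]
    · rw [map_sub, (V.delta c).2.2.1, p.2.2.1, h1, sub_self]

/-- The complex of multiplicative sections of a VB-groupoid is quasi-isomorphic to that of each of
its type zero components. -/
theorem IsTypeZeroComponent.quasiIsomorphic [FiniteDimensional ℝ EM] [IsManifold IG ∞ G]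
    [IsManifold IM ∞ M] [T2Space M] [SigmaCompactSpace M] {V₀ : VBGroupoid.{u, v} 𝒢}
    (h : V₀.IsTypeZeroComponent V) : QuasiIsomorphic V.multComplex V₀.multComplex := by
  obtain ⟨-, V₁, hV₁, ⟨φ⟩⟩ := h
  let p₀ : Hom V V₀ := (fstHom V₀ V₁).comp φ.toHom
  let p₁ : Hom V V₁ := (sndHom V₀ V₁).comp φ.toHom
  let i₀ : Hom V₀ V := φ.invHom.comp (inlHom V₀ V₁)
  let i₁ : Hom V₁ V := φ.invHom.comp (inrHom V₀ V₁)
  let d₁ := LinearEquiv.ofBijective V₁.delta hV₁.delta_bijective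
  have top0 : ∀ g w, p₀.top g (i₀.top g w) = w := fun g w =>
    congrArg Prod.fst ((φ.top g).apply_symm_apply ((w, 0) : V₀.top.Fiber g × V₁.top.Fiber g))
  have side0 : ∀ x e, p₀.side x (i₀.side x e) = e := fun x e =>
    congrArg Prod.fst ((φ.side x).apply_symm_apply ((e, 0) : V₀.side.Fiber x × V₁.side.Fiber x))
  have top1 : ∀ g w, i₀.top g (p₀.top g w) + i₁.top g (p₁.top g w) = w := fun g w => by
    refine ((φ.top g).symm.map_add _ _).symm.trans (((φ.top g).symm_apply_eq).2 ?_)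
    exact Prod.ext (add_zero _) (zero_add _)
  have side1 : ∀ x e, i₀.side x (p₀.side x e) + i₁.side x (p₁.side x e) = e := fun x e => by
    refine ((φ.side x).symm.map_add _ _).symm.trans (((φ.side x).symm_apply_eq).2 ?_)
    exact Prod.ext (add_zero _) (zero_add _)
  have core0 : ∀ c, p₀.mapCore (i₀.mapCore c) = c := fun c =>
    Subtype.ext (funext fun x => top0 _ _)
  have mult0 : ∀ s, p₀.mapMult (i₀.mapMult s) = s := fun s =>
    Subtype.ext (Prod.ext (ContMDiffSection.ext fun g => top0 _ _)
      (ContMDiffSection.ext fun x => side0 _ _))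
  have core1 : ∀ c, i₀.mapCore (p₀.mapCore c) + i₁.mapCore (p₁.mapCore c) = c := fun c =>
    Subtype.ext (funext fun x => top1 _ _)
  have mult1 : ∀ s, i₀.mapMult (p₀.mapMult s) + i₁.mapMult (p₁.mapMult s) = s := fun s =>
    Subtype.ext (Prod.ext (ContMDiffSection.ext fun g => top1 _ _)
      (ContMDiffSection.ext fun x => side1 _ _))
  have hd : ∀ s, V₁.delta (d₁.symm s) = s := d₁.apply_symm_apply
  have hd' : ∀ c, d₁.symm (V₁.delta c) = c := d₁.symm_apply_apply
  -- The homotopy contracts the type one summand by `δ₁⁻¹`. The minus sign comes from `i₀ p₀ - 1 =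
  -- -i₁ p₁`.
  refine quasiIsomorphic_twoTerm (ModuleCat.ofHom V.delta) (ModuleCat.ofHom V₀.delta)
    (ModuleCat.ofHom p₀.mapCore) (ModuleCat.ofHom p₀.mapMult) (ModuleCat.ofHom i₀.mapCore)
    (ModuleCat.ofHom i₀.mapMult)
    (ModuleCat.ofHom (-(i₁.mapCore ∘ₗ d₁.symm.toLinearMap ∘ₗ p₁.mapMult))) ?_ ?_ ?_ ?_ ?_ ?_
  · exact ModuleCat.hom_ext (LinearMap.ext fun c => p₀.delta_mapCore c)
  · exact ModuleCat.hom_ext (LinearMap.ext fun c => i₀.delta_mapCore c)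
  · exact ModuleCat.hom_ext (LinearMap.ext core0)
  · exact ModuleCat.hom_ext (LinearMap.ext mult0)
  · refine ModuleCat.hom_ext (LinearMap.ext fun c => ?_)
    change -(i₁.mapCore (d₁.symm (p₁.mapMult (V.delta c)))) = i₀.mapCore (p₀.mapCore c) - c
    rw [← p₁.delta_mapCore, hd', neg_eq_iff_add_eq_zero, ← add_sub_assoc, add_comm, core1,
      sub_self]
  · refine ModuleCat.hom_ext (LinearMap.ext fun s => ?_)
    change V.delta (-(i₁.mapCore (d₁.symm (p₁.mapMult s)))) = i₀.mapMult (p₀.mapMult s) - s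
    rw [map_neg, i₁.delta_mapCore, hd, neg_eq_iff_add_eq_zero, ← add_sub_assoc, add_comm, mult1,
      sub_self]

end VBGroupoid
end CoreSplitting

/-! ### Projections of a VB-groupoid, their images, and the resulting direct sum. -/

theorem SmoothVectorBundle.mk_smul_congr {EB HB : Type*} [NormedAddCommGroup EB] [NormedSpace ℝ EB]
    [TopologicalSpace HB] {IB : ModelWithCorners ℝ EB HB} {B : Type u} [TopologicalSpace B]
    [ChartedSpace HB B] (A : SmoothVectorBundle.{u, v} IB B) {x y : B} {a : A.Fiber x}
    {b : A.Fiber y} (c : ℝ) (h : (⟨x, a⟩ : A.Total) = ⟨y, b⟩) :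
    (⟨x, c • a⟩ : A.Total) = ⟨y, c • b⟩ := by
  obtain rfl : x = y := congrArg TotalSpace.proj h
  rw [A.mk_inj h]

namespace SmoothVectorBundle.SmoothProjection

variable {EB HB : Type*} [NormedAddCommGroup EB] [NormedSpace ℝ EB] [TopologicalSpace HB]
  {IB : ModelWithCorners ℝ EB HB} {B : Type u} [TopologicalSpace B] [ChartedSpace HB B]
  {A : SmoothVectorBundle.{u, v} IB B} (P : SmoothProjection A)

/-- The complementary projection. -/
def compl : SmoothProjection A where
  map x := LinearMap.id - P.map x
  idem x a := by simp [P.idem]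
  smooth := by
    refine (A.contMDiff_add (f := fun p : A.Total => p.1) contMDiff_id
      (A.contMDiff_smul (-1) P.smooth)).congr fun p => ?_
    simp [sub_eq_add_neg]
  rank := Module.finrank ℝ A.Model - P.rank
  finrank_range x := by
    have h1 : LinearMap.range (LinearMap.id - P.map x) = LinearMap.ker (P.map x) := by
      apply le_antisymm
      · rintro _ ⟨a, rfl⟩
        simp [P.idem]
      · intro a ha
        exact ⟨a, by simp [LinearMap.mem_ker.1 ha]⟩
    have h2 := LinearMap.finrank_range_add_finrank_ker (P.map x)
    rw [P.finrank_range, finrank_fiber] at h2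
    rw [h1]
    omega

@[simp] theorem compl_map (x : B) (a : A.Fiber x) : P.compl.map x a = a - P.map x a := rfl

end SmoothVectorBundle.SmoothProjection

section Images

variable {EG HG EM HM : Type*}
  [NormedAddCommGroup EG] [NormedSpace ℝ EG] [TopologicalSpace HG]
  [NormedAddCommGroup EM] [NormedSpace ℝ EM] [TopologicalSpace HM]
  {IG : ModelWithCorners ℝ EG HG} {IM : ModelWithCorners ℝ EM HM}
  {G M : Type u} [TopologicalSpace G] [ChartedSpace HG G] [TopologicalSpace M] [ChartedSpace HM M]
  {𝒢 : LieGroupoid IG IM G M}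

namespace VBGroupoid

/-- An idempotent endomorphism of constant rank of a VB-groupoid. -/
structure Projection (V : VBGroupoid.{u, v} 𝒢) where
  arr : V.top.SmoothProjection
  obj : V.side.SmoothProjection
  map_src : ∀ g v, obj.map _ (V.src g v) = V.src g (arr.map g v)
  map_tgt : ∀ g v, obj.map _ (V.tgt g v) = V.tgt g (arr.map g v)
  map_one : ∀ x e, arr.map _ (V.one x e) = V.one x (obj.map x e)
  map_mul : ∀ g h v w, V.total.src ⟨g, v⟩ = V.total.tgt ⟨h, w⟩ →
    arr.map _ (V.mul g h v w) = V.mul g h (arr.map g v) (arr.map h w)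

namespace Projection

variable {V : VBGroupoid.{u, v} 𝒢} (P : V.Projection)

/-- The morphism underlying a projection. -/
def toHom : Hom V V where
  top := P.arr.map
  side := P.obj.map
  contMDiff_top := P.arr.smooth
  contMDiff_side := P.obj.smooth
  map_src := P.map_src
  map_tgt := P.map_tgt
  map_one := P.map_one
  map_mul := P.map_mul

theorem composable_map {g h : G} {v : V.top.Fiber g} {w : V.top.Fiber h}
    (hvw : V.total.src ⟨g, v⟩ = V.total.tgt ⟨h, w⟩) :
    V.total.src ⟨g, P.arr.map g v⟩ = V.total.tgt ⟨h, P.arr.map h w⟩ := by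
  have := congrArg P.toHom.sideTotal hvw
  rwa [← Hom.src_topTotal, ← Hom.tgt_topTotal] at this

theorem mul_sub_of_composable {g h : G} {v v' : V.top.Fiber g} {w w' : V.top.Fiber h}
    (hvw : V.total.src ⟨g, v⟩ = V.total.tgt ⟨h, w⟩)
    (hvw' : V.total.src ⟨g, v'⟩ = V.total.tgt ⟨h, w'⟩) :
    V.mul g h (v - v') (w - w') = V.mul g h v w - V.mul g h v' w' := by
  have hgh : 𝒢.src g = 𝒢.tgt h := congrArg TotalSpace.proj hvw
  have hneg : V.total.src ⟨g, (-1 : ℝ) • v'⟩ = V.total.tgt ⟨h, (-1 : ℝ) • w'⟩ := by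
    have h1 := V.side.mk_smul_congr (-1) hvw'
    rwa [← map_smul, ← map_smul] at h1
  have h1 := V.mul_add g h _ _ _ _ hvw hneg
  rw [V.mul_smul _ _ _ _ _ hvw'] at h1
  simpa [sub_eq_add_neg] using h1

/-- The complementary projection. -/
def compl : V.Projection where
  arr := P.arr.compl
  obj := P.obj.compl
  map_src g v := by simp [P.map_src]
  map_tgt g v := by simp [P.map_tgt]
  map_one x e := by simp [P.map_one]
  map_mul g h v w hvw := by
    simp only [SmoothVectorBundle.SmoothProjection.compl_map]
    rw [P.map_mul _ _ _ _ hvw, mul_sub_of_composable hvw (P.composable_map hvw)]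

/-- The structure maps of the image of a projection. -/
@[reducible] def imageMaps : VBGroupoidMaps.{u, v} 𝒢 where
  top := P.arr.image
  side := P.obj.image
  src g := P.obj.projₗ _ ∘ₗ V.src g ∘ₗ P.arr.inclₗ g
  tgt g := P.obj.projₗ _ ∘ₗ V.tgt g ∘ₗ P.arr.inclₗ g
  one x := P.arr.projₗ _ ∘ₗ V.one x ∘ₗ P.obj.inclₗ x
  inv g := P.arr.projₗ _ ∘ₗ V.inv g ∘ₗ P.arr.inclₗ g
  mul g h v w := P.arr.projₗ _ (V.mul g h (P.arr.inclₗ g v) (P.arr.inclₗ h w))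

theorem topTotal_incl (p : P.arr.image.Total) : P.toHom.topTotal (P.arr.incl p) = P.arr.incl p :=
  congrArg (TotalSpace.mk _) (P.arr.map_inclₗ p.1 p.2)

theorem sideTotal_incl (p : P.obj.image.Total) : P.toHom.sideTotal (P.obj.incl p) = P.obj.incl p :=
  congrArg (TotalSpace.mk _) (P.obj.map_inclₗ p.1 p.2)

/-- The structure maps of `V` commute with `P`, hence preserve its image, so the projection built
into `imageMaps` has no effect. The injective `incl` is thus a strict morphism, and the groupoid
axioms of the image follow from those of `V`. -/
theorem incl_src (p : P.arr.image.Total) :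
    P.obj.incl (P.imageMaps.total.src p) = V.total.src (P.arr.incl p) := by
  have h : P.obj.incl (P.imageMaps.total.src p) = P.toHom.sideTotal (V.total.src (P.arr.incl p)) :=
    rfl
  rw [h, ← Hom.src_topTotal, topTotal_incl]

theorem incl_tgt (p : P.arr.image.Total) :
    P.obj.incl (P.imageMaps.total.tgt p) = V.total.tgt (P.arr.incl p) := by
  have h : P.obj.incl (P.imageMaps.total.tgt p) = P.toHom.sideTotal (V.total.tgt (P.arr.incl p)) :=
    rfl
  rw [h, ← Hom.tgt_topTotal, topTotal_incl]

theorem incl_one (p : P.obj.image.Total) :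
    P.arr.incl (P.imageMaps.total.one p) = V.total.one (P.obj.incl p) := by
  have h : P.arr.incl (P.imageMaps.total.one p) = P.toHom.topTotal (V.total.one (P.obj.incl p)) :=
    rfl
  rw [h, Hom.topTotal_one, sideTotal_incl]

theorem incl_inv (p : P.arr.image.Total) :
    P.arr.incl (P.imageMaps.total.inv p) = V.total.inv (P.arr.incl p) := by
  have h : P.arr.incl (P.imageMaps.total.inv p) = P.toHom.topTotal (V.total.inv (P.arr.incl p)) :=
    rfl
  rw [h, Hom.topTotal_inv, topTotal_incl]

theorem composable_incl {p q : P.arr.image.Total}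
    (h : P.imageMaps.total.src p = P.imageMaps.total.tgt q) :
    V.total.src (P.arr.incl p) = V.total.tgt (P.arr.incl q) := by
  rw [← incl_src, ← incl_tgt, h]

theorem incl_mul {p q : P.arr.image.Total}
    (h : P.imageMaps.total.src p = P.imageMaps.total.tgt q) :
    P.arr.incl (P.imageMaps.total.mul p q) = V.total.mul (P.arr.incl p) (P.arr.incl q) := by
  have h' : P.arr.incl (P.imageMaps.total.mul p q) =
    P.toHom.topTotal (V.total.mul (P.arr.incl p) (P.arr.incl q)) := rfl
  rw [h', Hom.topTotal_mul _ (P.composable_incl h), topTotal_incl, topTotal_incl]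

theorem contMDiff_image_src : ContMDiff P.arr.image.model P.obj.image.model ∞
    P.imageMaps.total.src :=
  P.obj.contMDiff_image_iff.2
    ((V.isLie.contMDiff_src.comp P.arr.contMDiff_incl).congr fun p => P.incl_src p)

theorem isLie_image : IsLieGroupoid P.arr.image.model P.obj.image.model P.imageMaps.total where
  src_one p := P.obj.incl_injective (by rw [incl_src, incl_one, V.isLie.src_one])
  tgt_one p := P.obj.incl_injective (by rw [incl_tgt, incl_one, V.isLie.tgt_one])
  src_mul p q h := P.obj.incl_injective (by
    rw [incl_src, incl_mul _ h, V.isLie.src_mul _ _ (P.composable_incl h), incl_src])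
  tgt_mul p q h := P.obj.incl_injective (by
    rw [incl_tgt, incl_mul _ h, V.isLie.tgt_mul _ _ (P.composable_incl h), incl_tgt])
  mul_assoc p q r h k := P.arr.incl_injective (by
    have hp := P.composable_incl h
    have hq := P.composable_incl k
    rw [incl_mul, incl_mul _ h, incl_mul, incl_mul _ k, V.isLie.mul_assoc _ _ _ hp hq]
    · apply P.obj.incl_injective
      rw [incl_src, incl_tgt, incl_mul _ k, V.isLie.tgt_mul _ _ hq, hp]
    · apply P.obj.incl_injective
      rw [incl_src, incl_tgt, incl_mul _ h, V.isLie.src_mul _ _ hp, hq])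
  one_mul p := P.arr.incl_injective (by
    rw [incl_mul, incl_one, incl_tgt, V.isLie.one_mul]
    apply P.obj.incl_injective
    rw [incl_src, incl_one, V.isLie.src_one])
  mul_one p := P.arr.incl_injective (by
    rw [incl_mul, incl_one, incl_src, V.isLie.mul_one]
    apply P.obj.incl_injective
    rw [incl_tgt, incl_one, V.isLie.tgt_one])
  src_inv p := P.obj.incl_injective (by rw [incl_src, incl_inv, V.isLie.src_inv, incl_tgt])
  tgt_inv p := P.obj.incl_injective (by rw [incl_tgt, incl_inv, V.isLie.tgt_inv, incl_src])
  inv_mul p := P.arr.incl_injective (by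
    rw [incl_mul, incl_inv, V.isLie.inv_mul, incl_one, incl_src]
    apply P.obj.incl_injective
    rw [incl_src, incl_inv, V.isLie.src_inv, incl_tgt])
  mul_inv p := P.arr.incl_injective (by
    rw [incl_mul, incl_inv, V.isLie.mul_inv, incl_one, incl_tgt]
    apply P.obj.incl_injective
    rw [incl_tgt, incl_inv, V.isLie.tgt_inv, incl_src])
  contMDiff_src := P.contMDiff_image_src
  contMDiff_tgt := P.obj.contMDiff_image_iff.2
    ((V.isLie.contMDiff_tgt.comp P.arr.contMDiff_incl).congr fun p => P.incl_tgt p)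
  contMDiff_one := P.arr.contMDiff_image_iff.2
    ((V.isLie.contMDiff_one.comp P.obj.contMDiff_incl).congr fun p => P.incl_one p)
  contMDiff_inv := P.arr.contMDiff_image_iff.2
    ((V.isLie.contMDiff_inv.comp P.arr.contMDiff_incl).congr fun p => P.incl_inv p)
  contMDiffOn_mul := fun p hp => P.arr.contMDiffWithinAt_image_iff.2 (by
    have h1 : ContMDiff (P.arr.image.model.prod P.arr.image.model) (V.top.model.prod V.top.model) ∞
        (fun p : P.arr.image.Total × P.arr.image.Total => (P.arr.incl p.1, P.arr.incl p.2)) :=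
      (P.arr.contMDiff_incl.comp contMDiff_fst).prodMk (P.arr.contMDiff_incl.comp contMDiff_snd)
    have h2 := (V.isLie.contMDiffOn_mul _ (P.composable_incl hp)).comp p
      h1.contMDiffAt.contMDiffWithinAt (fun _ hq => P.composable_incl hq)
    exact h2.congr (fun q hq => P.incl_mul hq) (P.incl_mul hp))
  submersion_src p := by
    refine (SmoothVectorBundle.mfderiv_bundleMap P.arr.image P.obj.image P.imageMaps.src
      𝒢.isLie.contMDiff_src P.contMDiff_image_src p).1 (𝒢.isLie.submersion_src p.1) ?_
    intro e
    -- A source preimage in `V` is turned into one in the image by the projection, which commutes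
    -- with the source and fixes `e`.
    obtain ⟨w, hw⟩ := V.src_surjective p.1 (P.obj.inclₗ _ e)
    refine ⟨P.arr.projₗ p.1 w, P.obj.inclₗ_injective _ ?_⟩
    change P.obj.map _ (V.src p.1 (P.arr.map p.1 w)) = _
    rw [← P.map_src, hw, P.obj.map_inclₗ, P.obj.map_inclₗ]

/-- The image of a projection of a VB-groupoid. -/
@[reducible] def image : VBGroupoid.{u, v} 𝒢 where
  toVBGroupoidMaps := P.imageMaps
  isLie := P.isLie_image
  mul_add g h v v' w w' hvw hvw' := by
    change P.arr.projₗ _ _ = P.arr.projₗ _ _ + P.arr.projₗ _ _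
    rw [← map_add, ← V.mul_add g h _ _ _ _ (P.composable_incl hvw) (P.composable_incl hvw'),
      map_add, map_add]
  mul_smul g h a v w hvw := by
    change P.arr.projₗ _ _ = a • P.arr.projₗ _ _
    rw [← map_smul, ← V.mul_smul g h _ _ _ (P.composable_incl hvw), map_smul, map_smul]

theorem inclₗ_src (g : G) (w : P.image.top.Fiber g) :
    P.obj.inclₗ _ (P.image.src g w) = V.src g (P.arr.inclₗ g w) :=
  V.side.mk_inj (P.incl_src ⟨g, w⟩)

theorem inclₗ_tgt (g : G) (w : P.image.top.Fiber g) :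
    P.obj.inclₗ _ (P.image.tgt g w) = V.tgt g (P.arr.inclₗ g w) :=
  V.side.mk_inj (P.incl_tgt ⟨g, w⟩)

theorem inclₗ_tgtOne (x : M) (w : P.image.top.Fiber (𝒢.one x)) :
    P.obj.inclₗ x (P.image.tgtOne x w) = V.tgtOne x (P.arr.inclₗ _ w) := by
  apply V.side.mk_inj
  have h := congrArg P.obj.incl (P.image.mk_tgtOne x w)
  rw [mk_tgtOne]
  exact h.trans (P.incl_tgt _)

/-- The morphism onto the image of a projection. -/
def projHom : Hom V P.image where
  top := P.arr.projₗ
  side := P.obj.projₗ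
  contMDiff_top := P.arr.contMDiff_proj
  contMDiff_side := P.obj.contMDiff_proj
  map_src g v := P.obj.inclₗ_injective _ (by
    rw [inclₗ_src, P.obj.incl_projₗ, P.map_src, P.arr.incl_projₗ])
  map_tgt g v := P.obj.inclₗ_injective _ (by
    rw [inclₗ_tgt, P.obj.incl_projₗ, P.map_tgt, P.arr.incl_projₗ])
  map_one x e := P.arr.inclₗ_injective _ (by
    change P.arr.map _ _ = P.arr.map _ (V.one x (P.obj.map x e))
    rw [P.map_one, P.map_one, P.obj.idem])
  map_mul g h v w hvw := P.arr.inclₗ_injective _ (by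
    change P.arr.map _ _ = P.arr.map _ (V.mul g h (P.arr.map g v) (P.arr.map h w))
    rw [← P.map_mul _ _ _ _ hvw, P.arr.idem])

section Decomposition

open SmoothVectorBundle

/-- The fiberwise decomposition of a vector bundle with a projection. -/
def fiberDecomp {EB HB : Type*} [NormedAddCommGroup EB] [NormedSpace ℝ EB] [TopologicalSpace HB]
    {IB : ModelWithCorners ℝ EB HB} {B : Type u} [TopologicalSpace B] [ChartedSpace HB B]
    {A : SmoothVectorBundle.{u, v} IB B} (P : SmoothProjection A) (x : B) :
    A.Fiber x ≃ₗ[ℝ] P.compl.image.Fiber x × P.image.Fiber x :=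
  LinearEquiv.ofLinearMap ((P.compl.projₗ x).prod (P.projₗ x))
    ((P.compl.inclₗ x).coprod (P.inclₗ x))
    (by
      refine LinearMap.ext fun p => Prod.ext (P.compl.inclₗ_injective x ?_)
        (P.inclₗ_injective x ?_)
      · change P.compl.map x (P.compl.inclₗ x p.1 + P.inclₗ x p.2) = P.compl.inclₗ x p.1
        rw [map_add, P.compl.map_inclₗ, P.compl_map, P.map_inclₗ, sub_self, add_zero]
      · change P.map x (P.compl.inclₗ x p.1 + P.inclₗ x p.2) = P.inclₗ x p.2
        have h : P.map x (P.compl.inclₗ x p.1) = 0 := by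
          have h1 := P.compl.map_inclₗ x p.1
          rw [P.compl_map] at h1
          simpa using h1
        rw [map_add, P.map_inclₗ, h, zero_add])
    (by
      refine LinearMap.ext fun a => ?_
      change P.compl.map x a + P.map x a = a
      rw [P.compl_map, sub_add_cancel])

theorem contMDiff_fiberDecomp_symm {EB HB : Type*} [NormedAddCommGroup EB] [NormedSpace ℝ EB]
    [TopologicalSpace HB] {IB : ModelWithCorners ℝ EB HB} {B : Type u} [TopologicalSpace B]
    [ChartedSpace HB B] [IsManifold IB ∞ B]
    {A : SmoothVectorBundle.{u, v} IB B} (P : SmoothProjection A) :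
    ContMDiff (P.compl.image.prod P.image).model A.model ∞
      (fun p : (P.compl.image.prod P.image).Total =>
        (⟨p.1, (fiberDecomp P p.1).symm p.2⟩ : A.Total)) :=
  A.contMDiff_add (f := fun p : (P.compl.image.prod P.image).Total => p.1)
    (P.compl.contMDiff_incl.comp contMDiff_fst) (P.contMDiff_incl.comp contMDiff_snd)

variable [IsManifold IG ∞ G] [IsManifold IM ∞ M]

/-- A VB-groupoid with a projection is the direct sum of the images of the complementary projection
and of the projection. -/
def decomp : V.Iso (P.compl.image.directSum P.image) where
  top := fiberDecomp P.arr
  side := fiberDecomp P.obj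
  contMDiff_top := contMDiff_prod_iff.2 ⟨P.compl.arr.contMDiff_proj, P.arr.contMDiff_proj⟩
  contMDiff_top_symm := contMDiff_fiberDecomp_symm P.arr
  contMDiff_side := contMDiff_prod_iff.2 ⟨P.compl.obj.contMDiff_proj, P.obj.contMDiff_proj⟩
  contMDiff_side_symm := contMDiff_fiberDecomp_symm P.obj
  map_src g v := Prod.ext (P.compl.projHom.map_src g v) (P.projHom.map_src g v)
  map_tgt g v := Prod.ext (P.compl.projHom.map_tgt g v) (P.projHom.map_tgt g v)
  map_one x e := Prod.ext (P.compl.projHom.map_one x e) (P.projHom.map_one x e)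
  map_mul g h v w hvw := Prod.ext (P.compl.projHom.map_mul g h v w hvw)
    (P.projHom.map_mul g h v w hvw)

end Decomposition

end Projection

end VBGroupoid
end Images

/-! ### The projection onto a type one summand built from a core splitting. -/

section Decomposition

variable {EG HG EM HM : Type*}
  [NormedAddCommGroup EG] [NormedSpace ℝ EG] [TopologicalSpace HG]
  [NormedAddCommGroup EM] [NormedSpace ℝ EM] [TopologicalSpace HM]
  {IG : ModelWithCorners ℝ EG HG} {IM : ModelWithCorners ℝ EM HM}
  {G M : Type u} [TopologicalSpace G] [ChartedSpace HG G] [TopologicalSpace M] [ChartedSpace HM M]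
  {𝒢 : LieGroupoid IG IM G M}

namespace VBGroupoid

namespace CoreSplitting

variable {V : VBGroupoid.{u, v} 𝒢} (σ : V.CoreSplitting)

/-- The splitting as a map of total spaces. -/
def total (p : V.side.Total) : V.top.Total := ⟨𝒢.one p.1, σ.toFun p.1 p.2⟩

/-- The projection of the side bundle onto the image of the core anchor map. -/
def objMap (x : M) : V.side.Fiber x →ₗ[ℝ] V.side.Fiber x := V.tgtOne x ∘ₗ σ.toFun x

/-- The projection of the side bundle as a map of total spaces. -/
def objTotal (p : V.side.Total) : V.side.Total := ⟨p.1, σ.objMap p.1 p.2⟩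

theorem src_total (p : V.side.Total) : V.total.src (σ.total p) = ⟨p.1, 0⟩ := by
  refine (V.mk_srcOne _ _).symm.trans (congrArg _ ?_)
  rw [srcOne_eq_zero, σ.src_eq]

theorem tgt_total (p : V.side.Total) : V.total.tgt (σ.total p) = σ.objTotal p :=
  (V.mk_tgtOne _ _).symm

theorem total_objTotal (p : V.side.Total) : σ.total (σ.objTotal p) = σ.total p :=
  congrArg (TotalSpace.mk _) (σ.split p.1 p.2)

theorem objTotal_objTotal (p : V.side.Total) : σ.objTotal (σ.objTotal p) = σ.objTotal p := by
  rw [← tgt_total, total_objTotal, tgt_total]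

theorem contMDiff_objTotal : ContMDiff V.side.model V.side.model ∞ σ.objTotal :=
  (V.isLie.contMDiff_tgt.comp σ.smooth).congr fun p => (σ.tgt_total p).symm

/-- The zero arrow over `g`. -/
abbrev zeroArrow (V : VBGroupoid.{u, v} 𝒢) (g : G) : V.top.Total := ⟨g, 0⟩

/-- The arrow `σ(a) · 0_g · σ(b)⁻¹`. -/
def conj (g : G) (p q : V.side.Total) : V.top.Total :=
  V.total.mul (V.total.mul (σ.total p) (zeroArrow V g)) (V.total.inv (σ.total q))

section

variable {g : G} {p q : V.side.Total} (hp : p.1 = 𝒢.tgt g) (hq : q.1 = 𝒢.src g)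

include hp in
theorem comp_left_conj : V.total.src (σ.total p) = V.total.tgt (zeroArrow V g) := by
  rw [src_total, tgt_zero, hp]

include hp hq in
theorem comp_right_conj : V.total.src (V.total.mul (σ.total p) (zeroArrow V g)) =
    V.total.tgt (V.total.inv (σ.total q)) := by
  rw [V.isLie.src_mul _ _ (σ.comp_left_conj hp), V.isLie.tgt_inv, src_total, src_zero, hq]

include hp hq in
theorem src_conj : V.total.src (σ.conj g p q) = σ.objTotal q := by
  rw [conj, V.isLie.src_mul _ _ (σ.comp_right_conj hp hq), V.isLie.src_inv, tgt_total]

include hp hq in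
theorem tgt_conj : V.total.tgt (σ.conj g p q) = σ.objTotal p := by
  rw [conj, V.isLie.tgt_mul _ _ (σ.comp_right_conj hp hq),
    V.isLie.tgt_mul _ _ (σ.comp_left_conj hp), tgt_total]

end

/-- Telescoping: in `σ(p) 0_g σ(q)⁻¹ · σ(q) 0_h σ(r)⁻¹` the middle factors cancel and `0_g · 0_h` is
the zero arrow over the product. Most of the proof records that the bracketings are composable. -/
theorem conj_mul {g h : G} (hgh : 𝒢.src g = 𝒢.tgt h) {p q r : V.side.Total}
    (hp : p.1 = 𝒢.tgt g) (hq : q.1 = 𝒢.src g) (hr : r.1 = 𝒢.src h) :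
    V.total.mul (σ.conj g p q) (σ.conj h q r) = σ.conj (𝒢.mul g h) p r := by
  have hq' : q.1 = 𝒢.tgt h := hq.trans hgh
  have a1 := σ.comp_left_conj hp
  have a2 := σ.comp_right_conj hp hq
  have b1 := σ.comp_left_conj hq'
  have b2 := σ.comp_right_conj hq' hr
  have z : V.total.src (zeroArrow V g) = V.total.tgt (zeroArrow V h) := by
    rw [src_zero, tgt_zero, hgh]
  have i1 : V.total.src (V.total.inv (σ.total q)) = V.total.tgt (σ.total q) := V.isLie.src_inv _
  have c1 : V.total.src (zeroArrow V h) = V.total.tgt (V.total.inv (σ.total r)) := by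
    rw [← V.isLie.src_mul _ _ b1]
    exact b2
  have c2 : V.total.src (V.total.mul (σ.total p) (zeroArrow V g)) =
      V.total.tgt (zeroArrow V h) := by rw [V.isLie.src_mul _ _ a1, z]
  rw [conj, conj, conj, V.isLie.mul_assoc _ _ _ a2
    (by rw [i1, V.isLie.tgt_mul _ _ b2, V.isLie.tgt_mul _ _ b1]),
    ← V.isLie.mul_assoc (V.total.inv (σ.total q)) _ _ (by rw [i1, V.isLie.tgt_mul _ _ b1]) b2,
    ← V.isLie.mul_assoc (V.total.inv (σ.total q)) _ _ i1 b1, V.isLie.inv_mul, b1, V.isLie.one_mul,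
    ← V.isLie.mul_assoc _ _ _ c2 c1, V.isLie.mul_assoc _ _ _ a1 z, total_mul_zero _ hgh]

/-- The zero arrow over a unit is the unit at the zero object, which is the source of `σ(p)`; what
remains is `σ(p) σ(p)⁻¹`. -/
theorem conj_one (p : V.side.Total) : σ.conj (𝒢.one p.1) p p = V.total.one (σ.objTotal p) := by
  have h : zeroArrow V (𝒢.one p.1) = V.total.one (V.total.src (σ.total p)) := by
    rw [src_total]
    exact congrArg (TotalSpace.mk _) (map_zero _).symm
  rw [conj, h, V.isLie.mul_one, V.isLie.mul_inv, tgt_total]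

/-- A consequence of `σ∂σ = σ`: only the projections of `p` and `q` to `im ∂` matter. Idempotence on
arrows rests on this. -/
theorem conj_objTotal (g : G) (p q : V.side.Total) :
    σ.conj g (σ.objTotal p) (σ.objTotal q) = σ.conj g p q := by
  rw [conj, total_objTotal, total_objTotal, conj]

theorem conj_base (g : G) :
    𝒢.mul (𝒢.mul (𝒢.one (𝒢.tgt g)) g) (𝒢.inv (𝒢.one (𝒢.src g))) = g := by
  rw [𝒢.isLie.one_mul, mul_inv_one_src]

/-- The arrow `σ(a) · 0_g · σ(b)⁻¹` as a linear function of `(a, b)`. -/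
def lift (g : G) : V.side.Fiber (𝒢.tgt g) × V.side.Fiber (𝒢.src g) →ₗ[ℝ] V.top.Fiber g where
  toFun a := V.top.fiberCast (conj_base g) (V.mul _ _
    (V.mul (𝒢.one (𝒢.tgt g)) g (σ.toFun _ a.1) 0) (V.inv _ (σ.toFun _ a.2)))
  map_add' a b := by
    -- Multiplication is additive on composable pairs, not in each factor, so the fixed factor `0_g`
    -- is split as `0 + 0`.
    have h1 : V.mul (𝒢.one (𝒢.tgt g)) g (σ.toFun _ a.1 + σ.toFun _ b.1) (0 + 0) =
        V.mul (𝒢.one (𝒢.tgt g)) g (σ.toFun _ a.1) 0 +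
          V.mul (𝒢.one (𝒢.tgt g)) g (σ.toFun _ b.1) 0 :=
      V.mul_add _ _ _ _ _ _ (σ.comp_left_conj (g := g) (p := ⟨_, a.1⟩) rfl)
        (σ.comp_left_conj (g := g) (p := ⟨_, b.1⟩) rfl)
    have h2 := V.mul_add (𝒢.mul (𝒢.one (𝒢.tgt g)) g) (𝒢.inv (𝒢.one (𝒢.src g))) _ _ _ _
      (σ.comp_right_conj (g := g) (p := ⟨_, a.1⟩) (q := ⟨_, a.2⟩) rfl rfl)
      (σ.comp_right_conj (g := g) (p := ⟨_, b.1⟩) (q := ⟨_, b.2⟩) rfl rfl)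
    rw [add_zero] at h1
    rw [← map_add]
    refine congrArg _ (Eq.trans ?_ h2)
    rw [Prod.fst_add, Prod.snd_add, map_add, map_add, h1, map_add]
    rfl
  map_smul' c a := by
    have h1 : V.mul (𝒢.one (𝒢.tgt g)) g (c • σ.toFun _ a.1) (c • 0) =
        c • V.mul (𝒢.one (𝒢.tgt g)) g (σ.toFun _ a.1) 0 :=
      V.mul_smul _ _ c _ _ (σ.comp_left_conj (g := g) (p := ⟨_, a.1⟩) rfl)
    have h2 := V.mul_smul (𝒢.mul (𝒢.one (𝒢.tgt g)) g) (𝒢.inv (𝒢.one (𝒢.src g))) c _ _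
      (σ.comp_right_conj (g := g) (p := ⟨_, a.1⟩) (q := ⟨_, a.2⟩) rfl rfl)
    rw [smul_zero] at h1
    rw [RingHom.id_apply, ← map_smul]
    refine congrArg _ (Eq.trans ?_ h2)
    rw [Prod.smul_fst, Prod.smul_snd, map_smul, map_smul, h1, map_smul]
    rfl

theorem mk_lift (g : G) (a : V.side.Fiber (𝒢.tgt g)) (b : V.side.Fiber (𝒢.src g)) :
    (⟨g, σ.lift g (a, b)⟩ : V.top.Total) = σ.conj g ⟨_, a⟩ ⟨_, b⟩ :=
  V.top.mk_fiberCast _ _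

theorem src_lift (g : G) (a : V.side.Fiber (𝒢.tgt g)) (b : V.side.Fiber (𝒢.src g)) :
    V.src g (σ.lift g (a, b)) = σ.objMap _ b := by
  apply V.side.mk_inj
  change V.total.src ⟨g, σ.lift g (a, b)⟩ = _
  rw [mk_lift, src_conj _ rfl rfl]
  rfl

theorem tgt_lift (g : G) (a : V.side.Fiber (𝒢.tgt g)) (b : V.side.Fiber (𝒢.src g)) :
    V.tgt g (σ.lift g (a, b)) = σ.objMap _ a := by
  apply V.side.mk_inj
  change V.total.tgt ⟨g, σ.lift g (a, b)⟩ = _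
  rw [mk_lift, tgt_conj _ rfl rfl]
  rfl

theorem lift_objMap (g : G) (a : V.side.Fiber (𝒢.tgt g)) (b : V.side.Fiber (𝒢.src g)) :
    σ.lift g (σ.objMap _ a, σ.objMap _ b) = σ.lift g (a, b) := by
  apply V.top.mk_inj
  rw [mk_lift, mk_lift]
  exact σ.conj_objTotal g ⟨_, a⟩ ⟨_, b⟩

/-- The projection `v ↦ σ(t(v)) · 0_g · σ(s(v))⁻¹` of the bundle of arrows. -/
def arrMap (g : G) : V.top.Fiber g →ₗ[ℝ] V.top.Fiber g :=
  σ.lift g ∘ₗ (V.tgt g).prod (V.src g)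

theorem arrMap_apply (g : G) (w : V.top.Fiber g) :
    σ.arrMap g w = σ.lift g (V.tgt g w, V.src g w) := rfl

theorem mk_arrMap (g : G) (w : V.top.Fiber g) : (⟨g, σ.arrMap g w⟩ : V.top.Total) =
    σ.conj g (V.total.tgt ⟨g, w⟩) (V.total.src ⟨g, w⟩) := by
  rw [arrMap_apply, mk_lift]
  rfl

theorem arrMap_idem (g : G) (w : V.top.Fiber g) : σ.arrMap g (σ.arrMap g w) = σ.arrMap g w := by
  rw [arrMap_apply, arrMap_apply, src_lift, tgt_lift, lift_objMap]

theorem objMap_idem (x : M) (e : V.side.Fiber x) : σ.objMap x (σ.objMap x e) = σ.objMap x e :=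
  V.side.mk_inj (σ.objTotal_objTotal ⟨x, e⟩)

theorem contMDiff_arrMap : ContMDiff V.top.model V.top.model ∞
    (fun p : V.top.Total => (⟨p.1, σ.arrMap p.1 p.2⟩ : V.top.Total)) := by
  have h0 : ContMDiff V.top.model V.top.model ∞ (fun p : V.top.Total => zeroArrow V p.1) :=
    V.top.contMDiff_zero.comp (Bundle.contMDiff_proj V.top.Fiber)
  have h1 := V.isLie.contMDiffOn_mul.comp_contMDiff
    ((σ.smooth.comp V.isLie.contMDiff_tgt).prodMk h0) fun p =>
      σ.comp_left_conj (p := V.total.tgt p) rfl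
  have h2 := V.isLie.contMDiffOn_mul.comp_contMDiff
    (h1.prodMk (V.isLie.contMDiff_inv.comp (σ.smooth.comp V.isLie.contMDiff_src))) fun p =>
      σ.comp_right_conj (p := V.total.tgt p) (q := V.total.src p) rfl rfl
  exact h2.congr fun p => σ.mk_arrMap p.1 p.2

/-- By `anchor`, `∂σ` fixes `im ∂` pointwise. Regularity of `V` thereby becomes constancy of the
rank of the projection on objects. -/
theorem range_objMap (x : M) :
    LinearMap.range (σ.objMap x) = LinearMap.range (V.coreAnchor x) := by
  apply le_antisymm
  · rintro _ ⟨e, rfl⟩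
    exact ⟨⟨σ.toFun x e, σ.src_eq x e⟩, rfl⟩
  · rintro _ ⟨c, rfl⟩
    exact ⟨V.tgtOne x c, σ.anchor x c c.2⟩

theorem objMap_of_mem {x : M} {e : V.side.Fiber x} (he : e ∈ LinearMap.range (σ.objMap x)) :
    σ.objMap x e = e := by
  obtain ⟨e, rfl⟩ := he
  exact σ.objMap_idem x e

/-- The pair `(t, s)` is an isomorphism from the range over `g` onto the two ranges on objects:
injective because `arrMap` factors through `(t, s)`, surjective because `lift` provides preimages.
-/
theorem finrank_range_arrMap (g : G) : Module.finrank ℝ (LinearMap.range (σ.arrMap g)) =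
    Module.finrank ℝ (LinearMap.range (σ.objMap (𝒢.tgt g))) +
      Module.finrank ℝ (LinearMap.range (σ.objMap (𝒢.src g))) := by
  let F : LinearMap.range (σ.arrMap g) →ₗ[ℝ]
      LinearMap.range (σ.objMap (𝒢.tgt g)) × LinearMap.range (σ.objMap (𝒢.src g)) :=
    (LinearMap.codRestrict _ (V.tgt g ∘ₗ Submodule.subtype _) (by
        rintro ⟨_, w, rfl⟩
        exact ⟨V.tgt g w, (σ.tgt_lift g _ _).symm⟩)).prod
      (LinearMap.codRestrict _ (V.src g ∘ₗ Submodule.subtype _) (by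
        rintro ⟨_, w, rfl⟩
        exact ⟨V.src g w, (σ.src_lift g _ _).symm⟩))
  have hF : Function.Bijective F := by
    constructor
    · rw [← LinearMap.ker_eq_bot, LinearMap.ker_eq_bot']
      rintro ⟨_, w, rfl⟩ hw
      have h1 : V.tgt g (σ.arrMap g w) = 0 := congrArg Subtype.val (congrArg Prod.fst hw)
      have h2 : V.src g (σ.arrMap g w) = 0 := congrArg Subtype.val (congrArg Prod.snd hw)
      apply Subtype.ext
      change σ.arrMap g w = 0
      rw [← arrMap_idem, arrMap_apply, h1, h2, Prod.mk_zero_zero, map_zero]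
    · rintro ⟨⟨a, ha⟩, ⟨b, hb⟩⟩
      have h1 : V.tgt g (σ.lift g (a, b)) = a := by rw [tgt_lift, σ.objMap_of_mem ha]
      have h2 : V.src g (σ.lift g (a, b)) = b := by rw [src_lift, σ.objMap_of_mem hb]
      exact ⟨⟨σ.lift g (a, b), σ.lift g (a, b), by rw [arrMap_apply, h1, h2]⟩,
        Prod.ext (Subtype.ext h1) (Subtype.ext h2)⟩
  rw [(LinearEquiv.ofBijective F hF).finrank_eq, Module.finrank_prod]

/-- The projection of a regular VB-groupoid onto a component of type one. -/
def projection {r : ℕ} (hr : ∀ x, Module.finrank ℝ (LinearMap.range (V.coreAnchor x)) = r) :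
    V.Projection where
  arr :=
    { map := σ.arrMap
      idem := σ.arrMap_idem
      smooth := σ.contMDiff_arrMap
      rank := r + r
      finrank_range := fun g => by
        rw [finrank_range_arrMap, range_objMap, range_objMap, hr, hr] }
  obj :=
    { map := σ.objMap
      idem := σ.objMap_idem
      smooth := σ.contMDiff_objTotal
      rank := r
      finrank_range := fun x => by rw [range_objMap, hr] }
  map_src g w := (σ.src_lift g _ _).symm
  map_tgt g w := (σ.tgt_lift g _ _).symm
  map_one x e := by
    apply V.top.mk_inj
    rw [mk_arrMap]
    have h1 : V.total.tgt ⟨𝒢.one x, V.one x e⟩ = ⟨x, e⟩ := V.isLie.tgt_one ⟨x, e⟩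
    have h2 : V.total.src ⟨𝒢.one x, V.one x e⟩ = ⟨x, e⟩ := V.isLie.src_one ⟨x, e⟩
    rw [h1, h2]
    exact σ.conj_one ⟨x, e⟩
  map_mul g h w w' hw := by
    apply V.top.mk_inj
    have hgh : 𝒢.src g = 𝒢.tgt h := congrArg TotalSpace.proj hw
    have h1 := σ.mk_arrMap (𝒢.mul g h) (V.mul g h w w')
    have h2 : V.total.tgt ⟨𝒢.mul g h, V.mul g h w w'⟩ = V.total.tgt ⟨g, w⟩ :=
      V.isLie.tgt_mul _ _ hw
    have h3 : V.total.src ⟨𝒢.mul g h, V.mul g h w w'⟩ = V.total.src ⟨h, w'⟩ :=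
      V.isLie.src_mul _ _ hw
    -- The middle object of the telescoping is the source of `w`, which `hw` equates with the target
    -- of `w'`.
    rw [h2, h3, ← σ.conj_mul (q := V.total.src ⟨g, w⟩) hgh rfl rfl rfl, ← mk_arrMap, hw,
      ← mk_arrMap] at h1
    exact h1

variable {r : ℕ} (hr : ∀ x, Module.finrank ℝ (LinearMap.range (V.coreAnchor x)) = r)

/-- Injectivity: a core vector killed by `∂` has zero source and target, and the projection, which
fixes it, depends on nothing else. Surjectivity: a vector `e` of the image satisfies `e = ∂σ(e)`, so
the projection of `σ(e)` to the image is a preimage. -/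
theorem isTypeOne_image : (σ.projection hr).image.IsTypeOne := by
  set P := σ.projection hr with hP
  intro x
  constructor
  · rw [← LinearMap.ker_eq_bot, LinearMap.ker_eq_bot']
    rintro ⟨w, hw⟩ h
    have hs : V.src _ (P.arr.inclₗ _ w) = 0 := by
      rw [← P.inclₗ_src, LinearMap.mem_ker.1 hw, map_zero]
    have ht : V.tgtOne x (P.arr.inclₗ _ w) = 0 := by
      rw [← P.inclₗ_tgtOne]
      exact (congrArg (P.obj.inclₗ x) h).trans (map_zero _)
    have ht' : V.tgt _ (P.arr.inclₗ _ w) = 0 := by simpa [tgtOne] using ht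
    refine Subtype.ext (P.arr.inclₗ_injective _ ?_)
    have h1 : P.arr.inclₗ _ w = σ.arrMap _ (P.arr.inclₗ _ w) := (P.arr.map_inclₗ _ w).symm
    rw [arrMap_apply, hs, ht', Prod.mk_zero_zero, map_zero] at h1
    exact h1.trans (map_zero _).symm
  · intro e
    have hs : P.image.src _ (P.projHom.top _ (σ.toFun x (P.obj.inclₗ x e))) = 0 := by
      rw [← P.projHom.map_src, σ.src_eq, map_zero]
    refine ⟨⟨P.projHom.top _ (σ.toFun x (P.obj.inclₗ x e)), hs⟩, P.obj.inclₗ_injective x ?_⟩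
    refine (P.inclₗ_tgtOne x _).trans ?_
    apply V.side.mk_inj
    have h1 := congrArg P.toHom.sideTotal (V.mk_tgtOne x (σ.toFun x (P.obj.inclₗ x e)))
    rw [← Hom.tgt_topTotal] at h1
    rw [mk_tgtOne]
    refine Eq.trans h1.symm (congrArg (TotalSpace.mk x) ?_)
    exact (σ.objMap_idem x _).trans (P.obj.map_inclₗ x e)

/-- For a core vector of the complement, `∂w` lies in `im ∂` and is fixed by `∂σ`; it also lies in
the image of `1 - ∂σ` and is killed by `∂σ`. Hence it vanishes. -/
theorem isTypeZero_image_compl : (σ.projection hr).compl.image.IsTypeZero := by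
  set P := σ.projection hr with hP
  refine fun x => LinearMap.ext fun ⟨w, hw⟩ => P.compl.obj.inclₗ_injective x ?_
  have hs : V.src _ (P.compl.arr.inclₗ _ w) = 0 := by
    rw [← P.compl.inclₗ_src, LinearMap.mem_ker.1 hw, map_zero]
  have h1 : σ.objMap x (V.tgtOne x (P.compl.arr.inclₗ _ w)) =
      V.tgtOne x (P.compl.arr.inclₗ _ w) := σ.anchor x _ hs
  have h2 := P.compl.obj.map_inclₗ x (P.compl.image.tgtOne x w)
  rw [P.compl.inclₗ_tgtOne] at h2
  have h3 : V.tgtOne x (P.compl.arr.inclₗ _ w) -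
    σ.objMap x (V.tgtOne x (P.compl.arr.inclₗ _ w)) = V.tgtOne x (P.compl.arr.inclₗ _ w) := h2
  rw [h1, sub_self] at h3
  exact (P.compl.inclₗ_tgtOne x w).trans (h3.symm.trans (map_zero _).symm)

end CoreSplitting

/-- A regular VB-groupoid has a type zero component. -/
theorem IsRegular.exists_typeZeroComponent {V : VBGroupoid.{u, v} 𝒢} [FiniteDimensional ℝ EM]
    [IsManifold IG ∞ G] [IsManifold IM ∞ M] [T2Space M] [SigmaCompactSpace M] (hV : V.IsRegular) :
    ∃ V₀ : VBGroupoid.{u, v} 𝒢, V₀.IsTypeZeroComponent V := by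
  obtain ⟨σ⟩ := hV.nonempty_coreSplitting
  obtain ⟨r, hr⟩ := hV
  exact ⟨_, σ.isTypeZero_image_compl hr, _, σ.isTypeOne_image hr, ⟨(σ.projection hr).decomp⟩⟩

end VBGroupoid
end Decomposition

end

theorem corollary3p15 {EG HG EM HM : Type*} {G M : Type u}
    [NormedAddCommGroup EG] [NormedSpace ℝ EG] [FiniteDimensional ℝ EG] [TopologicalSpace HG]
    [NormedAddCommGroup EM] [NormedSpace ℝ EM] [FiniteDimensional ℝ EM] [TopologicalSpace HM]
    (IG : ModelWithCorners ℝ EG HG) (IM : ModelWithCorners ℝ EM HM)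
    [IG.Boundaryless] [IM.Boundaryless]
    [TopologicalSpace G] [ChartedSpace HG G] [IsManifold IG ∞ G]
    [TopologicalSpace M] [ChartedSpace HM M] [IsManifold IM ∞ M]
    [T2Space M] [SigmaCompactSpace M]
    (𝒢 : LieGroupoid IG IM G M) (V : VBGroupoid.{u, v} 𝒢) (hV : V.IsRegular) :
    (∃ V₀ : VBGroupoid.{u, v} 𝒢, V₀.IsTypeZeroComponent V) ∧
      ∀ V₀ : VBGroupoid.{u, v} 𝒢, V₀.IsTypeZeroComponent V →
        QuasiIsomorphic V.multComplex V₀.multComplex :=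
  ⟨hV.exists_typeZeroComponent, fun _ h => h.quasiIsomorphic⟩
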